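/- \textbf{Setting.} Let $(M,T,\mu)$ be a conservative ergodic measure preserving dynamical system with $\mu$ infinite and $\sigma$-finite, and let $\tau:M\to(0,\infty)$ be measurable with $0<\inf_M\tau\le\sup_M\tau<\infty$. Put $t_n:=\sum_{k=0}^{n-1}\tau\circ T^k$ and $n_t:=\sup\{n\in\mathbb N:\ t_n\le t\}$. Let $(\mathcal M,(\varphi_t)_{t\ge0},\nu)$ be the suspension flow: $\mathcal M=\{(y,s):y\in M,\ 0\le s<\tau(y)\}$, $\nu=\mu\otimes\mathrm{Leb}$ restricted to $\mathcal M$, and $\varphi_t(y,s)=(T^{n}y,\ t+s-t_{n}(y))$ with $n=n_{t+s}(y)$. Let $f:\mathbb R^d\times\mathcal M\to\mathbb R^d$ and $\bar f:\mathbb R^d\to\mathbb R^d$ be measurable, uniformly bounded, and Lipschitz in $x\in\mathbb R^d$ (uniformly in the second variable of $f$). Fix $x\in\mathbb R^d$. For $t\ge0$, $\epsilon>0$, $\omega\in\mathcal M$ let $W$ and $X^\epsilon$ be the solutions (of the integrated equations) of \[ \frac{dW_t}{dt}=\bar f(W_t),\quad W_0=x,\qquad \frac{dX^\epsilon_t}{dt}(\omega)=f(X^\epsilon_t(\omega),\varphi_{t/\epsilon}(\omega))+\bar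 f(X^\epsilon_t(\omega)),\quad X^\epsilon_0=x . \] Let $\bar\tau>0$, $w_t:=W_{\bar\tau t}$ and $F(y,\omega):=\int_0^{\tau(\omega)}f(y,(\omega,s))\,ds$ for $y\in\mathbb R^d$, $\omega\in M$. Let $\bar\mu$ be a probability measure on $M$ absolutely continuous with respect to $\mu$, and let $(\mathfrak a_\epsilon)_{\epsilon>0}$ be positive reals with $\mathfrak a_\epsilon\to0$ and $\epsilon/\mathfrak a_\epsilon\to0$ as $\epsilon\to0$. \textbf{Assumptions.} (a) The functions $F(\cdot,\omega)$, $\omega\in M$, and $\bar f$ are twice differentiable and bounded, with first and second order derivatives bounded, uniformly in $\omega$. (b) As $\epsilon\to0$, the processes $v^\epsilon_t:=\mathfrak a_\epsilon\int_0^{t/\epsilon}F(w_{\epsilon s},T^{\lfloor s\rfloor})\,ds$ converge in distribution with respect to $\bar\mu$, in $\mathcal C([0,S'])$ for all $S'>0$, to a continuous process $(v_t)_{t\ge0}$; and the processes $\dot v^\epsilon_t:=\mathfrak a_\epsilon\int_0^{t/\epsilon}D_1F(w_{\epsilon s},T^{\lfloor s\rfloor})\,ds$ are tight with respect to $\bar\mu$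 in $\mathcal C([0,S'])$, as $\epsilon\to0$, for all $S'>0$. (c) For all $S'>0$, $\sup_{t\in[0,S']}|\epsilon n_{t/\epsilon}-t/\bar\tau|\to0$ in probability with respect to $\bar\mu$ as $\epsilon\to0$. (d) As $\epsilon\to0$, with respect to $\bar\mu$, the processes $z^\epsilon_t:=\sqrt{\epsilon\mathfrak a_\epsilon}\int_0^{t/\epsilon}(\tau\circ T^{\lfloor s\rfloor}-\bar\tau)\bar f(w_{\epsilon s})\,ds$ converge in distribution to $0$ in $\mathcal C([0,S'])$ for all $S'>0$, and the processes $\dot z^\epsilon_t:=\epsilon\int_0^{t/\epsilon}(\tau\circ T^{\lfloor s\rfloor}-\bar\tau)D\bar f(w_{\epsilon s})\,ds$ converge to $0$ in the sense of finite-dimensional distributions. \textbf{Conclusion.} Under every probability measure on $\mathcal M$ that is absolutely continuous with respect to $\nu$, as $\epsilon\to0$ the processes $\big((\mathfrak a_\epsilon/\epsilon)(X^\epsilon_t-W_t)\big)_{t\ge0}$ converge in distribution, in $\mathcal C([0,S])$ with the uniform metric for every $S>0$ (strong convergence in distribution with respect to $\nu$ for the local topology), to the continuous process \[ Y_t=v_{t/\bar\tau}+\int_0^t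 \mathcal E(s,t)\,D\bar f(W_s)\,v_{s/\bar\tau}\,ds , \] where $\mathcal E(s,t)$ is the time-ordered exponential of $\int_s^tD\bar f(W_u)\,du$: \[ \mathcal E(s,t)=\sum_{n\ge0}\ \int_{s\le u_1\le\dots\le u_n\le t}D\bar f(W_{u_n})\cdots D\bar f(W_{u_1})\,du_1\cdots du_n . \] Moreover $Y$ solves $Y_t=v_{t/\bar\tau}+\int_0^tD\bar f(W_s)Y_s\,ds$ for $t\ge0$, and if the matrices $D\bar f(W_u)$, $u\ge0$, commute (in particular if $d=1$), then \[ Y_t=v_{t/\bar\tau}+\int_0^tD\bar f(W_s)\exp\Big(\int_s^tD\bar f(W_u)\,du\Big)v_{s/\bar\tau}\,ds . \] -/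

import Mathlib

open Filter Topology MeasureTheory ProbabilityTheory Set

/-! ### Suspension flows -/

section Suspension

/-- A roof function: measurable, bounded above, and bounded away from `0`. -/
structure IsRoof {M : Type*} [MeasurableSpace M] (τ : M → ℝ) : Prop where
  measurable : Measurable τ
  bounded_below : ∃ c : ℝ, 0 < c ∧ ∀ y, c ≤ τ y
  bounded_above : ∃ C : ℝ, ∀ y, τ y ≤ C

/-- The space `{(y, s) : 0 ≤ s < τ y}` under the graph of the roof function. -/
abbrev SuspensionSpace {M : Type*} (τ : M → ℝ) : Type _ :=
  {p : M × ℝ // 0 ≤ p.2 ∧ p.2 < τ p.1}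

/-- The restriction of `μ ⊗ Leb` to the suspension space. -/
noncomputable def suspensionMeasure {M : Type*} [MeasurableSpace M] (μ : Measure M)
    (τ : M → ℝ) : Measure (SuspensionSpace τ) :=
  (μ.prod volume).comap Subtype.val

/-- `n_t(y) = sup {n : t_n(y) ≤ t}`, where `t_n(y) = ∑_{k < n} τ (T^k y)`. -/
noncomputable def visitCount {M : Type*} (T : M → M) (τ : M → ℝ) (t : ℝ) (y : M) : ℕ :=
  sSup {n : ℕ | birkhoffSum T τ n y ≤ t}

theorem IsRoof.mul_le_birkhoffSum {M : Type*} {τ : M → ℝ} {c : ℝ} (hc : ∀ y, c ≤ τ y)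
    (T : M → M) (n : ℕ) (y : M) : n * c ≤ birkhoffSum T τ n y := by
  induction n with
  | zero => simp
  | succ k ih =>
    rw [birkhoffSum_succ]
    have := hc (T^[k] y)
    push_cast
    linarith

theorem IsRoof.visitCount_spec {M : Type*} [MeasurableSpace M] {τ : M → ℝ} (hτ : IsRoof τ)
    (T : M → M) {t : ℝ} (ht : 0 ≤ t) (y : M) :
    0 ≤ t - birkhoffSum T τ (visitCount T τ t y) y ∧
      t - birkhoffSum T τ (visitCount T τ t y) y < τ (T^[visitCount T τ t y] y) := by
  obtain ⟨c, hc0, hc⟩ := hτ.bounded_below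
  have hbdd : BddAbove {n : ℕ | birkhoffSum T τ n y ≤ t} := by
    refine ⟨⌈t / c⌉₊, fun n hn => ?_⟩
    have h1 : (n : ℝ) * c ≤ t := (IsRoof.mul_le_birkhoffSum hc T n y).trans hn
    have h2 : (n : ℝ) ≤ t / c := by rwa [le_div_iff₀ hc0]
    exact_mod_cast h2.trans (Nat.le_ceil _)
  have hne : {n : ℕ | birkhoffSum T τ n y ≤ t}.Nonempty := ⟨0, by simpa using ht⟩
  have hmem : birkhoffSum T τ (visitCount T τ t y) y ≤ t := Nat.sSup_mem hne hbdd
  refine ⟨by linarith, ?_⟩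
  by_contra hcon
  have hsucc : visitCount T τ t y + 1 ∈ {n : ℕ | birkhoffSum T τ n y ≤ t} := by
    change birkhoffSum T τ (visitCount T τ t y + 1) y ≤ t
    rw [birkhoffSum_succ]
    linarith
  have := le_csSup hbdd hsucc
  exact absurd this (by simp [visitCount])

/-- The suspension flow `φ_t(y, s) = (T^n y, t + s - t_n(y))` with `n = n_{t+s}(y)`. -/
noncomputable def suspensionFlow {M : Type*} [MeasurableSpace M] (T : M → M) {τ : M → ℝ}
    (hτ : IsRoof τ) (t : NNReal) (p : SuspensionSpace τ) : SuspensionSpace τ :=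
  ⟨(T^[visitCount T τ (t + p.1.2) p.1.1] p.1.1,
      t + p.1.2 - birkhoffSum T τ (visitCount T τ (t + p.1.2) p.1.1) p.1.1),
    hτ.visitCount_spec T (add_nonneg t.2 p.2.1) p.1.1⟩

open Classical in
/-- `F(x, y) = ∫_0^{τ(y)} f(x, (y, s)) ds`. -/
noncomputable def roofIntegral {M E : Type*} [NormedAddCommGroup E] [NormedSpace ℝ E]
    (τ : M → ℝ) (f : E → SuspensionSpace τ → E) (x : E) (y : M) : E :=
  ∫ s in (0 : ℝ)..τ y, if h : 0 ≤ s ∧ s < τ y then f x ⟨(y, s), h⟩ else 0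

end Suspension

/-! ### Differential equations -/

section ODE

/-- `Z` is the (Carathéodory) solution on `[0, ∞)` of `dZ_t/dt = g_t(Z_t)`, `Z_0 = x`. -/
def IsSolution {E : Type*} [NormedAddCommGroup E] [NormedSpace ℝ E]
    (g : ℝ → E → E) (x : E) (Z : ℝ → E) : Prop :=
  ContinuousOn Z (Ici 0) ∧
    ∀ t, 0 ≤ t → IntervalIntegrable (fun s => g s (Z s)) volume 0 t ∧
      Z t = x + ∫ s in (0 : ℝ)..t, g s (Z s)

/-- Twice differentiable functions which are uniformly bounded, together with their
derivatives of first and second order (uniformly over the family). -/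
def UniformlyBoundedTwiceDiff {ι E : Type*} [NormedAddCommGroup E] [NormedSpace ℝ E]
    (G : ι → E → E) : Prop :=
  (∀ i, Differentiable ℝ (G i)) ∧ (∀ i, Differentiable ℝ (fderiv ℝ (G i))) ∧
    ∃ C : ℝ, ∀ i x, ‖G i x‖ ≤ C ∧ ‖fderiv ℝ (G i) x‖ ≤ C ∧
      ‖fderiv ℝ (fderiv ℝ (G i)) x‖ ≤ C

/-- The iterated integrals
`∫_{s ≤ u_1 ≤ ... ≤ u_n ≤ t} A(u_n) ⋯ A(u_1) du_1 ⋯ du_n` of an operator-valued function. -/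
noncomputable def orderedExpTerm {E : Type*} [NormedAddCommGroup E] [NormedSpace ℝ E]
    (A : ℝ → E →L[ℝ] E) (s : ℝ) : ℕ → ℝ → E →L[ℝ] E
  | 0 => fun _ => ContinuousLinearMap.id ℝ E
  | n + 1 => fun t => ∫ u in s..t, (A u).comp (orderedExpTerm A s n u)

/-- The time-ordered exponential of `∫_s^t A(u) du` (Peano–Baker / Dyson series). -/
noncomputable def orderedExp {E : Type*} [NormedAddCommGroup E] [NormedSpace ℝ E]
    (A : ℝ → E →L[ℝ] E) (s t : ℝ) : E →L[ℝ] E :=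
  ∑' n, orderedExpTerm A s n t

/-- `V_t + ∫_0^t Texp(∫_s^t A(u) du) A(s) V_s ds`. -/
noncomputable def linearResponse {E : Type*} [NormedAddCommGroup E] [NormedSpace ℝ E]
    (A : ℝ → E →L[ℝ] E) (V : ℝ → E) (t : ℝ) : E :=
  V t + ∫ s in (0 : ℝ)..t, orderedExp A s t (A s (V s))

end ODE

/-! ### Convergence in distribution of continuous processes -/

section Convergence

instance continuousMapMeasurableSpace {X Y : Type*} [TopologicalSpace X] [TopologicalSpace Y] :
    MeasurableSpace C(X, Y) := borel _

instance continuousMapBorelSpace {X Y : Type*} [TopologicalSpace X] [TopologicalSpace Y] :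
    BorelSpace C(X, Y) := ⟨rfl⟩

open Classical in
/-- The restriction of a path to `[0, S]`, as an element of `C([0, S], G)` with the uniform
metric. The value `0` is a convention for paths that are not continuous on `[0, S]`. -/
noncomputable def pathOn {G : Type*} [NormedAddCommGroup G] (S : ℝ) (g : ℝ → G) :
    C(Icc (0 : ℝ) S, G) :=
  if h : ContinuousOn g (Icc 0 S) then ⟨(Icc (0 : ℝ) S).domRestrict g, h.domRestrict⟩ else 0

/-- The family `(Z^ε_t)_{t ≥ 0}`, `ε > 0`, of continuous processes under `P` converges in
distribution, as `ε → 0`, to the continuous process `(Z⁰_t)_{t ≥ 0}` under `Q`, in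
`C([0, S])` with the uniform metric for all `S > 0`. -/
structure LocallyConvergesInLaw {Ω Ω' G : Type*} [MeasurableSpace Ω] [MeasurableSpace Ω']
    [NormedAddCommGroup G] (P : Measure Ω) [IsProbabilityMeasure P]
    (Z : ℝ → ℝ → Ω → G) (Q : Measure Ω') [IsProbabilityMeasure Q] (Z₀ : ℝ → Ω' → G) :
    Prop where
  continuous_paths : ∀ ε, 0 < ε → ∀ ω, ContinuousOn (fun t => Z ε t ω) (Ici 0)
  continuous_limit : ∀ ω, ContinuousOn (fun t => Z₀ t ω) (Ici 0)
  tendsto : ∀ S : ℝ, 0 < S →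
    TendstoInDistribution
      (fun (ε : Ioi (0 : ℝ)) (ω : Ω) => pathOn S (fun t => Z ε t ω))
      (comap (fun ε : Ioi (0 : ℝ) => (ε : ℝ)) (𝓝[>] 0))
      (fun ω => pathOn S (fun t => Z₀ t ω)) (fun _ => P) Q

/-- Strong convergence in distribution with respect to `ν`, for the local topology:
convergence under every probability measure absolutely continuous with respect to `ν`. -/
def StronglyLocallyConvergesInLaw {Ω Ω' G : Type*} [MeasurableSpace Ω] [MeasurableSpace Ω']
    [NormedAddCommGroup G] (ν : Measure Ω)
    (Z : ℝ → ℝ → Ω → G) (Q : Measure Ω') [IsProbabilityMeasure Q] (Z₀ : ℝ → Ω' → G) : Prop :=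
  ∀ (P : Measure Ω) [IsProbabilityMeasure P], P ≪ ν → LocallyConvergesInLaw P Z Q Z₀

/-- Tightness in `C([0, S])`, as `ε → 0`, for all `S > 0`. -/
def TightAtZero {Ω G : Type*} [MeasurableSpace Ω] [NormedAddCommGroup G] (P : Measure Ω)
    (Z : ℝ → ℝ → Ω → G) : Prop :=
  ∀ S : ℝ, 0 < S → ∀ δ : ENNReal, 0 < δ →
    ∃ K : Set C(Icc (0 : ℝ) S, G), IsCompact K ∧
      ∀ᶠ ε in 𝓝[>] (0 : ℝ), P {ω | pathOn S (fun t => Z ε t ω) ∉ K} ≤ δ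

/-- Convergence to `0` of the finite-dimensional distributions, as `ε → 0`. -/
def FiniteDimConvergesToZero {Ω G : Type*} [MeasurableSpace Ω] [NormedAddCommGroup G]
    [MeasurableSpace G] [BorelSpace G] [SecondCountableTopology G]
    (P : Measure Ω) [IsProbabilityMeasure P] (Z : ℝ → ℝ → Ω → G) : Prop :=
  ∀ (k : ℕ) (t : Fin k → ℝ), (∀ i, 0 ≤ t i) →
    TendstoInDistribution
      (fun (ε : Ioi (0 : ℝ)) (ω : Ω) => fun i => Z ε (t i) ω)
      (comap (fun ε : Ioi (0 : ℝ) => (ε : ℝ)) (𝓝[>] 0))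
      (fun _ : Ω => (0 : Fin k → G)) (fun _ => P) P

end Convergence

/-! ### The processes attached to the averaging problem -/

section Processes

variable {M E : Type*} [NormedAddCommGroup E] [NormedSpace ℝ E]

/-- `v^ε_t = a_ε ∫_0^{t/ε} F(w_{εs}, T^{⌊s⌋} y) ds`. -/
noncomputable def perturbedBirkhoff (T : M → M) (F : E → M → E) (a : ℝ → ℝ) (w : ℝ → E)
    (ε t : ℝ) (y : M) : E :=
  a ε • ∫ s in (0 : ℝ)..t / ε, F (w (ε * s)) (T^[⌊s⌋₊] y)

/-- `v̇^ε_t = a_ε ∫_0^{t/ε} D₁F(w_{εs}, T^{⌊s⌋} y) ds`. -/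
noncomputable def perturbedBirkhoffDeriv (T : M → M) (F : E → M → E) (a : ℝ → ℝ) (w : ℝ → E)
    (ε t : ℝ) (y : M) : E →L[ℝ] E :=
  a ε • ∫ s in (0 : ℝ)..t / ε, fderiv ℝ (fun x => F x (T^[⌊s⌋₊] y)) (w (ε * s))

/-- `z^ε_t = √(ε a_ε) ∫_0^{t/ε} (τ(T^{⌊s⌋} y) - τ̄) f̄(w_{εs}) ds`. -/
noncomputable def roofFluctuation (T : M → M) (τ : M → ℝ) (τbar : ℝ) (fbar : E → E) (a : ℝ → ℝ)
    (w : ℝ → E) (ε t : ℝ) (y : M) : E :=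
  Real.sqrt (ε * a ε) • ∫ s in (0 : ℝ)..t / ε, (τ (T^[⌊s⌋₊] y) - τbar) • fbar (w (ε * s))

/-- `ż^ε_t = ε ∫_0^{t/ε} (τ(T^{⌊s⌋} y) - τ̄) Df̄(w_{εs}) ds`. -/
noncomputable def roofFluctuationDeriv (T : M → M) (τ : M → ℝ) (τbar : ℝ) (fbar : E → E)
    (w : ℝ → E) (ε t : ℝ) (y : M) : E →L[ℝ] E :=
  ε • ∫ s in (0 : ℝ)..t / ε, (τ (T^[⌊s⌋₊] y) - τbar) • fderiv ℝ fbar (w (ε * s))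

end Processes

/-!
Write `w t = W (τbar t)` and let `x_k` be the perturbed solution at the time `ε t_k` of the `k`-th
passage through the base of the suspension, for the orbit started at `(y, 0)`. During one passage
the fast field integrates to `F (·, T^k y)`, so that the error `E_k = x_k - w (ε k)` satisfies, up to
`O(ε²)`,
`E_{k+1} - E_k = ε F(x_k, T^k y) + ε τ(T^k y) (fbar x_k - fbar (w (ε k)))
  + ε (τ(T^k y) - τbar) fbar (w (ε k))`.

A discrete Gronwall inequality first bounds `E_k` by a multiple of
`(ε / a ε) sup ‖v^ε‖ + √(ε / a ε) sup ‖z^ε‖ + ε`, which is `o(√(ε / a ε))` because `z^ε → 0`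
(`PassageSystem.norm_error_le`). Then the fast part of the rescaled error,
`(a ε / ε) ∫ f (X^ε, φ)`, is expanded around `w`: its main term is `v^ε` at time `ε n`, its
quadratic term is of the order of `(a ε / ε) sup ‖E_k‖²`, hence `o(1)`, and its linear term pairs the
increments of `v̇^ε` with the errors `E_k`. Since `v̇^ε` is equicontinuous and the `E_k` are small and
vary slowly, summation by parts against a moving average shows that the linear term is negligible
(`norm_sum_sub_apply_le`, `PassageSystem.norm_smul_integral_field_sub_le`). As the number of
passages before time `t` is close to `t / (ε τbar)`, the fast part is close to `v^ε` at time
`t / τbar`, and the rescaled error solves the linearized equation driven by it up to a small term.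
Hence it is close to the linear response to `v^ε (· / τbar)`
(`PassageSystem.exists_eventually_norm_sub_linearResponse_le`). The linear response is identified
with the solution of the linear Volterra equation in `linearResponse_eq_add_integral`, and it is a
continuous functional of the driving path (`exists_continuous_linearResponse`).

All these estimates are uniform over the orbits on which `v^ε` and `v̇^ε` have an oscillation bounded
by `η + Λ |s - t|`. Tightness and convergence in law provide such bounds with a probability close
to `1`, and the continuous mapping theorem together with Slutsky's lemma gives the convergence in
law for orbits started from the base under `μbar`
(`AveragingBounds.tendstoInDistribution_basePoint`).

It remains to change the reference measure. Replacing the initial point `(y, 0)` by `(T y, 0)` or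
by `(y, s)` shifts the time of the fast motion by a bounded amount, which moves the rescaled error
by `O(a ε)`. For such asymptotically invariant observables of an ergodic map, the limit of the
integrals against `P ≪ μ` does not depend on `P`, because every weak-* limit point is an invariant
function and thus a constant (`Ergodic.tendstoInDistribution_of_asymptotically_invariant`).
-/

/-! ### Grönwall inequalities and linear Volterra equations -/

/-- Grönwall's inequality in integral form. -/
theorem le_mul_exp_of_le_add_integral {u : ℝ → ℝ} {S K L : ℝ} (hL : 0 < L)
    (hu : ContinuousOn u (Icc 0 S))
    (h : ∀ t ∈ Icc 0 S, u t ≤ K + L * ∫ s in (0 : ℝ)..t, u s) :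
    ∀ t ∈ Icc 0 S, u t ≤ K * Real.exp (L * t) := by
  intro t ht
  have hS : (0 : ℝ) ≤ S := ht.1.trans ht.2
  set w : ℝ → ℝ := fun s => u (projIcc 0 S hS s) with hw
  have hwc : Continuous w := by
    have := hu.domRestrict
    exact this.comp continuous_projIcc
  have hwu : ∀ s ∈ Icc 0 S, w s = u s := fun s hs => by
    simp [hw, projIcc_of_mem hS hs]
  have hint : ∀ s ∈ Icc 0 S, ∫ r in (0 : ℝ)..s, u r = ∫ r in (0 : ℝ)..s, w r := by
    intro s hs
    refine intervalIntegral.integral_congr fun r hr => ?_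
    rw [uIcc_of_le hs.1] at hr
    exact (hwu r ⟨hr.1, hr.2.trans hs.2⟩).symm
  have hder : ∀ s, HasDerivAt (fun r => ∫ q in (0 : ℝ)..r, w q) (w s) s := fun s =>
    (hwc.integral_hasStrictDerivAt 0 s).hasDerivAt
  have key := le_gronwallBound_of_liminf_deriv_right_le
    (f := fun r => ∫ q in (0 : ℝ)..r, w q) (f' := w) (δ := 0) (K := L) (ε := K) (a := 0) (b := S)
    (fun s _ => (hder s).continuousAt.continuousWithinAt)
    (fun s _ r hr => ((hder s).hasDerivWithinAt).liminf_right_slope_le hr)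
    (by simp)
    (fun s hs => by
      have hs' : s ∈ Icc 0 S := ⟨hs.1, hs.2.le⟩
      have := h s hs'
      rw [hint s hs'] at this
      rw [hwu s hs']; linarith) t ht
  rw [gronwallBound_of_K_ne_0 hL.ne'] at key
  have h1 := h t ht
  rw [hint t ht] at h1
  have h2 := mul_le_mul_of_nonneg_left key hL.le
  simp only [sub_zero, zero_mul, zero_add] at h2
  have h3 : L * (K / L * (Real.exp (L * t) - 1)) = K * Real.exp (L * t) - K := by
    field_simp
  linarith

theorem mul_integral_exp_le {C s t : ℝ} (hC : 0 < C) :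
    C * ∫ u in s..t, Real.exp (2 * C * (u - s)) ≤ Real.exp (2 * C * (t - s)) / 2 := by
  have hder : ∀ u ∈ uIcc s t, HasDerivAt (fun u => Real.exp (2 * C * (u - s)) / (2 * C))
      (Real.exp (2 * C * (u - s))) u := by
    intro u _
    have h1 : HasDerivAt (fun u => 2 * C * (u - s)) (2 * C) u := by
      simpa using ((hasDerivAt_id u).sub_const s).const_mul (2 * C)
    exact (h1.exp.div_const (2 * C)).congr_deriv (mul_div_cancel_right₀ _ (by positivity))
  rw [intervalIntegral.integral_eq_sub_of_hasDerivAt hder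
    (Continuous.intervalIntegrable (by fun_prop) _ _)]
  have : C * (Real.exp (2 * C * (t - s)) / (2 * C) - Real.exp (2 * C * (s - s)) / (2 * C))
      = Real.exp (2 * C * (t - s)) / 2 - 1 / 2 := by
    simp; field_simp
  rw [this]; linarith

section OrderedExp

variable {E : Type*} [NormedAddCommGroup E] [NormedSpace ℝ E]

theorem continuous_orderedExpTerm {A : ℝ → E →L[ℝ] E} (hA : Continuous A) (n : ℕ) :
    Continuous fun p : ℝ × ℝ => orderedExpTerm A p.1 n p.2 := by
  induction n with
  | zero => exact continuous_const
  | succ n ih =>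
    have hk : Continuous (Function.uncurry fun (p : ℝ × ℝ) (u : ℝ) =>
        (A u).comp (orderedExpTerm A p.1 n u)) := by
      have h1 : Continuous fun q : (ℝ × ℝ) × ℝ => orderedExpTerm A q.1.1 n q.2 :=
        ih.comp (f := fun q : (ℝ × ℝ) × ℝ => (q.1.1, q.2)) (by fun_prop)
      exact (hA.comp continuous_snd).clm_comp h1
    have hsub : (fun p : ℝ × ℝ => orderedExpTerm A p.1 (n + 1) p.2) = fun p =>
        (∫ u in (0 : ℝ)..p.2, (A u).comp (orderedExpTerm A p.1 n u)) -
          ∫ u in (0 : ℝ)..p.1, (A u).comp (orderedExpTerm A p.1 n u) := by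
      funext p
      have hc : Continuous fun u => (A u).comp (orderedExpTerm A p.1 n u) :=
        hk.comp (f := fun u : ℝ => (p, u)) (by fun_prop)
      rw [intervalIntegral.integral_interval_sub_left (hc.intervalIntegrable _ _)
        (hc.intervalIntegrable _ _)]
      rfl
    rw [hsub]
    exact (intervalIntegral.continuous_parametric_intervalIntegral_of_continuous (μ := volume) hk
      continuous_snd).sub
      (intervalIntegral.continuous_parametric_intervalIntegral_of_continuous (μ := volume) hk
        continuous_fst)

/-- The factor `exp (2 C (t - s))` turns the iterated integrals into a geometric series. -/
theorem norm_orderedExpTerm_le {A : ℝ → E →L[ℝ] E} {C : ℝ} (hC : 0 < C)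
    (hAC : ∀ u, ‖A u‖ ≤ C) (n : ℕ) {s t : ℝ} (hst : s ≤ t) :
    ‖orderedExpTerm A s n t‖ ≤ (1 / 2) ^ n * Real.exp (2 * C * (t - s)) := by
  induction n generalizing t with
  | zero =>
    have h1 : (1 : ℝ) ≤ Real.exp (2 * C * (t - s)) :=
      Real.one_le_exp (mul_nonneg (by positivity) (by linarith))
    simpa [orderedExpTerm] using ContinuousLinearMap.norm_id_le.trans h1
  | succ n ih =>
    have hb : ∀ u ∈ Ioc s t, ‖(A u).comp (orderedExpTerm A s n u)‖ ≤
        C * ((1 / 2) ^ n * Real.exp (2 * C * (u - s))) := fun u hu =>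
      (ContinuousLinearMap.opNorm_comp_le _ _).trans
        (mul_le_mul (hAC u) (ih hu.1.le) (norm_nonneg _) hC.le)
    have hc : Continuous fun u => C * ((1 / 2) ^ n * Real.exp (2 * C * (u - s))) := by fun_prop
    refine (intervalIntegral.norm_integral_le_of_norm_le hst (ae_of_all _ fun u hu => hb u hu)
      (hc.intervalIntegrable _ _)).trans ?_
    rw [intervalIntegral.integral_const_mul, intervalIntegral.integral_const_mul]
    have h2 := mul_integral_exp_le (s := s) (t := t) hC
    calc C * ((1 / 2) ^ n * ∫ u in s..t, Real.exp (2 * C * (u - s)))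
        = (1 / 2) ^ n * (C * ∫ u in s..t, Real.exp (2 * C * (u - s))) := by ring
      _ ≤ (1 / 2) ^ n * (Real.exp (2 * C * (t - s)) / 2) := by gcongr
      _ = _ := by rw [pow_succ]; ring

variable [CompleteSpace E]

theorem summable_orderedExpTerm {A : ℝ → E →L[ℝ] E} {C : ℝ} (hC : 0 < C)
    (hAC : ∀ u, ‖A u‖ ≤ C) {s t : ℝ} (hst : s ≤ t) :
    Summable fun n => orderedExpTerm A s n t :=
  Summable.of_norm_bounded ((summable_geometric_of_lt_one (by norm_num) (by norm_num)).mul_right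
    (Real.exp (2 * C * (t - s)))) fun n => norm_orderedExpTerm_le hC hAC n hst

/-- Taking the maximum restricts the time-ordered exponential to `s ≤ t`, where its series converges
uniformly after division by `exp (2 C (t - s))`. -/
theorem continuous_orderedExp_max {A : ℝ → E →L[ℝ] E} (hA : Continuous A) {C : ℝ} (hC : 0 < C)
    (hAC : ∀ u, ‖A u‖ ≤ C) :
    Continuous fun p : ℝ × ℝ => orderedExp A p.1 (max p.1 p.2) := by
  have h1 : Continuous fun p : ℝ × ℝ => ∑' n, Real.exp (-(2 * C * (max p.1 p.2 - p.1))) •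
      orderedExpTerm A p.1 n (max p.1 p.2) := by
    refine continuous_tsum (u := fun n => (1 / 2 : ℝ) ^ n) (fun n => ?_)
      (summable_geometric_of_lt_one (by norm_num) (by norm_num)) fun n p => ?_
    · have := (continuous_orderedExpTerm hA n).comp
        (f := fun p : ℝ × ℝ => (p.1, max p.1 p.2)) (by fun_prop)
      have he : Continuous fun p : ℝ × ℝ => Real.exp (-(2 * C * (max p.1 p.2 - p.1))) := by
        fun_prop
      exact he.smul this
    · rw [norm_smul, Real.norm_of_nonneg (Real.exp_pos _).le]
      have := norm_orderedExpTerm_le hC hAC n (le_max_left p.1 p.2)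
      calc _ ≤ Real.exp (-(2 * C * (max p.1 p.2 - p.1))) *
            ((1 / 2) ^ n * Real.exp (2 * C * (max p.1 p.2 - p.1))) := by gcongr
        _ = (1 / 2) ^ n * (Real.exp (-(2 * C * (max p.1 p.2 - p.1))) *
            Real.exp (2 * C * (max p.1 p.2 - p.1))) := by ring
        _ = _ := by rw [← Real.exp_add]; simp
  have h2 : (fun p : ℝ × ℝ => orderedExp A p.1 (max p.1 p.2)) = fun p =>
      Real.exp (2 * C * (max p.1 p.2 - p.1)) •
        ∑' n, Real.exp (-(2 * C * (max p.1 p.2 - p.1))) •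
          orderedExpTerm A p.1 n (max p.1 p.2) := by
    funext p
    rw [(summable_orderedExpTerm hC hAC (le_max_left p.1 p.2)).tsum_const_smul, smul_smul,
      ← Real.exp_add]
    simp [orderedExp]
  rw [h2]
  have he : Continuous fun p : ℝ × ℝ => Real.exp (2 * C * (max p.1 p.2 - p.1)) := by fun_prop
  exact he.smul h1

/-- The integral equation which characterizes the time-ordered exponential. -/
theorem orderedExp_eq_id_add_integral {A : ℝ → E →L[ℝ] E} (hA : Continuous A) {C : ℝ}
    (hC : 0 < C) (hAC : ∀ u, ‖A u‖ ≤ C) {s t : ℝ} (hst : s ≤ t) :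
    orderedExp A s t = ContinuousLinearMap.id ℝ E + ∫ u in s..t, (A u).comp (orderedExp A s u) := by
  have hsum : ∀ u ∈ Icc s t, HasSum (fun n => (A u).comp (orderedExpTerm A s n u))
      ((A u).comp (orderedExp A s u)) := fun u hu =>
    (summable_orderedExpTerm hC hAC hu.1).hasSum.mapL
      ((ContinuousLinearMap.compL ℝ E E E) (A u))
  have hcont : ∀ n, Continuous fun u => (A u).comp (orderedExpTerm A s n u) := fun n =>
    hA.clm_comp ((continuous_orderedExpTerm hA n).comp (f := fun u : ℝ => (s, u)) (by fun_prop))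
  have h := intervalIntegral.hasSum_integral_of_dominated_convergence (μ := volume)
    (a := s) (b := t)
    (F := fun n u => (A u).comp (orderedExpTerm A s n u))
    (f := fun u => (A u).comp (orderedExp A s u))
    (fun n _ => (1 / 2 : ℝ) ^ n * (C * Real.exp (2 * C * (t - s))))
    (fun n => (hcont n).aestronglyMeasurable)
    (fun n => ae_of_all _ fun u hu => by
      rw [uIoc_of_le hst] at hu
      refine (ContinuousLinearMap.opNorm_comp_le _ _).trans ?_
      have h1 := norm_orderedExpTerm_le hC hAC n hu.1.le
      have h2 : Real.exp (2 * C * (u - s)) ≤ Real.exp (2 * C * (t - s)) := by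
        gcongr; exact hu.2
      calc ‖A u‖ * ‖orderedExpTerm A s n u‖
          ≤ C * ((1 / 2) ^ n * Real.exp (2 * C * (t - s))) := by
            refine mul_le_mul (hAC u) (h1.trans ?_) (norm_nonneg _) hC.le
            gcongr
        _ = _ := by ring)
    (ae_of_all _ fun u _ =>
      (summable_geometric_of_lt_one (by norm_num) (by norm_num)).mul_right _)
    (by simp)
    (ae_of_all _ fun u hu => by
      rw [uIoc_of_le hst] at hu
      exact hsum u ⟨hu.1.le, hu.2⟩)
  have h0 := (summable_orderedExpTerm hC hAC hst).tsum_eq_zero_add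
  rw [orderedExp, h0, ← h.tsum_eq]
  rfl

end OrderedExp

/-- Fubini on the triangle `{0 ≤ s ≤ u ≤ t}`. -/
theorem integral_integral_triangle_swap {E : Type*} [NormedAddCommGroup E] [NormedSpace ℝ E]
    {k : ℝ × ℝ → E} (hk : Continuous k) {t : ℝ} (ht : 0 ≤ t) :
    ∫ s in (0 : ℝ)..t, ∫ u in s..t, k (s, u) = ∫ u in (0 : ℝ)..t, ∫ s in (0 : ℝ)..u, k (s, u) := by
  have hmeas : MeasurableSet {p : ℝ × ℝ | p.1 ≤ p.2} := measurableSet_le measurable_fst measurable_snd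
  have hint : Integrable (Function.uncurry fun s u => {p : ℝ × ℝ | p.1 ≤ p.2}.indicator k (s, u))
      ((volume.restrict (Ioc 0 t)).prod (volume.restrict (Ioc 0 t))) := by
    rw [Measure.prod_restrict]
    have h1 : IntegrableOn k (Icc 0 t ×ˢ Icc 0 t) (volume.prod volume) :=
      hk.continuousOn.integrableOn_compact (isCompact_Icc.prod isCompact_Icc)
    exact (h1.mono_set (prod_mono Ioc_subset_Icc_self Ioc_subset_Icc_self)).indicator hmeas
  have hswap := integral_integral_swap hint
  rw [intervalIntegral.integral_of_le ht, intervalIntegral.integral_of_le ht]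
  have hL : ∀ s ∈ Ioc 0 t, ∫ u in s..t, k (s, u) =
      ∫ u in Ioc 0 t, {p : ℝ × ℝ | p.1 ≤ p.2}.indicator k (s, u) := by
    intro s hs
    have h1 : (fun u => {p : ℝ × ℝ | p.1 ≤ p.2}.indicator k (s, u)) =
        (Ici s).indicator fun u => k (s, u) := by
      funext u; simp [indicator]
    rw [h1, setIntegral_indicator measurableSet_Ici, intervalIntegral.integral_of_le hs.2,
      ← integral_Icc_eq_integral_Ioc]
    congr 2
    ext u
    simp only [mem_inter_iff, mem_Ioc, mem_Ici, mem_Icc]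
    constructor
    · rintro ⟨h1, h2⟩; exact ⟨⟨hs.1.trans_le h1, h2⟩, h1⟩
    · rintro ⟨⟨_, h2⟩, h1⟩; exact ⟨h1, h2⟩
  have hR : ∀ u ∈ Ioc 0 t, ∫ s in (0 : ℝ)..u, k (s, u) =
      ∫ s in Ioc 0 t, {p : ℝ × ℝ | p.1 ≤ p.2}.indicator k (s, u) := by
    intro u hu
    have h1 : (fun s => {p : ℝ × ℝ | p.1 ≤ p.2}.indicator k (s, u)) =
        (Iic u).indicator fun s => k (s, u) := by
      funext s; simp [indicator]
    rw [h1, setIntegral_indicator measurableSet_Iic, intervalIntegral.integral_of_le hu.1.le]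
    congr 2
    ext s
    simp only [mem_inter_iff, mem_Ioc, mem_Iic]
    constructor
    · rintro ⟨h1, h2⟩; exact ⟨⟨h1, h2.trans hu.2⟩, h2⟩
    · rintro ⟨⟨h1, _⟩, h2⟩; exact ⟨h1, h2⟩
  rw [setIntegral_congr_fun measurableSet_Ioc hL, setIntegral_congr_fun measurableSet_Ioc hR]
  exact hswap

section LinearResponse

variable {E : Type*} [NormedAddCommGroup E] [NormedSpace ℝ E]

theorem orderedExpTerm_congr {A B : ℝ → E →L[ℝ] E} (hAB : ∀ u, 0 ≤ u → A u = B u) (n : ℕ)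
    {s t : ℝ} (hs : 0 ≤ s) (ht : 0 ≤ t) : orderedExpTerm A s n t = orderedExpTerm B s n t := by
  induction n generalizing t with
  | zero => rfl
  | succ n ih =>
    refine intervalIntegral.integral_congr fun u hu => ?_
    have hu0 : 0 ≤ u := (le_min hs ht).trans hu.1
    simp only [hAB u hu0, ih hu0]

theorem linearResponse_congr {A B : ℝ → E →L[ℝ] E} {V V' : ℝ → E}
    (hAB : ∀ u, 0 ≤ u → A u = B u) (hV : ∀ u, 0 ≤ u → V u = V' u) {t : ℝ} (ht : 0 ≤ t) :
    linearResponse A V t = linearResponse B V' t := by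
  rw [linearResponse, linearResponse, hV t ht]
  congr 1
  refine intervalIntegral.integral_congr fun s hs => ?_
  rw [uIcc_of_le ht] at hs
  simp only [orderedExp, orderedExpTerm_congr hAB _ hs.1 ht, hAB s hs.1, hV s hs.1]

variable [CompleteSpace E]

theorem continuousOn_linearResponse_of_continuous {A : ℝ → E →L[ℝ] E} {V : ℝ → E} (hA : Continuous A)
    (hV : Continuous V) {C : ℝ} (hC : 0 < C) (hAC : ∀ u, ‖A u‖ ≤ C) :
    ContinuousOn (linearResponse A V) (Ici 0) := by
  have h1 : Continuous (Function.uncurry fun t s : ℝ =>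
      orderedExp A s (max s t) (A s (V s))) := by
    have := (continuous_orderedExp_max hA hC hAC).comp
      (f := fun p : ℝ × ℝ => (p.2, p.1)) (by fun_prop)
    exact this.clm_apply ((hA.comp continuous_snd).clm_apply (hV.comp continuous_snd))
  have h2 := hV.add (intervalIntegral.continuous_parametric_intervalIntegral_of_continuous
    (μ := volume) (a₀ := 0) h1 (continuous_id (X := ℝ)))
  refine h2.continuousOn.congr fun t ht => ?_
  simp only [linearResponse, id]
  congr 1
  refine intervalIntegral.integral_congr fun s hs => ?_
  rw [uIcc_of_le ht] at hs
  simp only [max_eq_right hs.2]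

theorem linearResponse_eq_add_integral_of_continuous {A : ℝ → E →L[ℝ] E} {V : ℝ → E}
    (hA : Continuous A) (hV : Continuous V) {C : ℝ} (hC : 0 < C) (hAC : ∀ u, ‖A u‖ ≤ C)
    {t : ℝ} (ht : 0 ≤ t) :
    linearResponse A V t = V t + ∫ s in (0 : ℝ)..t, A s (linearResponse A V s) := by
  have hE := continuous_orderedExp_max hA hC hAC
  have hAV : Continuous fun s => A s (V s) := hA.clm_apply hV
  set k : ℝ × ℝ → E := fun p => A p.2 (orderedExp A p.1 (max p.1 p.2) (A p.1 (V p.1))) with hk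
  have hkc : Continuous k :=
    (hA.comp continuous_snd).clm_apply (hE.clm_apply (hAV.comp continuous_fst))
  have hEs : ∀ u, Continuous fun s => orderedExp A s (max s u) (A s (V s)) := fun u =>
    (hE.comp (f := fun s : ℝ => (s, u)) (by fun_prop)).clm_apply hAV
  -- the right-hand side, with the inner integral expanded
  have hR : ∫ u in (0 : ℝ)..t, A u (linearResponse A V u) =
      (∫ u in (0 : ℝ)..t, A u (V u)) + ∫ u in (0 : ℝ)..t, ∫ s in (0 : ℝ)..u, k (s, u) := by
    rw [← intervalIntegral.integral_add (hAV.intervalIntegrable _ _)]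
    · refine intervalIntegral.integral_congr fun u hu => ?_
      rw [uIcc_of_le ht] at hu
      simp only [linearResponse, map_add]
      congr 1
      have : ∫ s in (0 : ℝ)..u, orderedExp A s u (A s (V s)) =
          ∫ s in (0 : ℝ)..u, orderedExp A s (max s u) (A s (V s)) := by
        refine intervalIntegral.integral_congr fun s hs => ?_
        rw [uIcc_of_le hu.1] at hs
        simp only [max_eq_right hs.2]
      rw [this, ← ContinuousLinearMap.intervalIntegral_comp_comm _
        ((hEs u).intervalIntegrable _ _)]
    · refine Continuous.intervalIntegrable ?_ _ _
      exact intervalIntegral.continuous_parametric_intervalIntegral_of_continuous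
        (f := fun u s : ℝ => k (s, u)) (hkc.comp continuous_swap) (continuous_id (X := ℝ))
  rw [hR, ← integral_integral_triangle_swap hkc ht, linearResponse]
  congr 1
  have hin : ∀ s ∈ Icc 0 t, ∫ u in s..t, k (s, u) =
      orderedExp A s t (A s (V s)) - A s (V s) := by
    intro s hs
    have hc : Continuous fun u => (A u).comp (orderedExp A s (max s u)) :=
      hA.clm_comp (hE.comp (f := fun u : ℝ => (s, u)) (by fun_prop))
    have h1 : ∫ u in s..t, (A u).comp (orderedExp A s u) =
        ∫ u in s..t, (A u).comp (orderedExp A s (max s u)) := by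
      refine intervalIntegral.integral_congr fun u hu => ?_
      rw [uIcc_of_le hs.2] at hu
      simp only [max_eq_right hu.1]
    rw [orderedExp_eq_id_add_integral hA hC hAC hs.2, h1, add_apply,
      ContinuousLinearMap.intervalIntegral_apply (hc.intervalIntegrable _ _)]
    simp [hk]
  have hin' : ∫ s in (0 : ℝ)..t, ∫ u in s..t, k (s, u) =
      ∫ s in (0 : ℝ)..t, (orderedExp A s (max s t) (A s (V s)) - A s (V s)) := by
    refine intervalIntegral.integral_congr fun s hs => ?_
    rw [uIcc_of_le ht] at hs
    simp only [hin s hs, max_eq_right hs.2]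
  rw [hin', intervalIntegral.integral_sub ((hEs t).intervalIntegrable _ _)
    (hAV.intervalIntegrable _ _), add_sub_cancel]
  refine intervalIntegral.integral_congr fun s hs => ?_
  rw [uIcc_of_le ht] at hs
  simp only [max_eq_right hs.2]

variable {A : ℝ → E →L[ℝ] E} {V : ℝ → E} {C : ℝ}

theorem continuous_comp_max_zero {X : Type*} [TopologicalSpace X] {V : ℝ → X}
    (hV : ContinuousOn V (Ici 0)) : Continuous fun s => V (max s 0) :=
  hV.comp_continuous (by fun_prop) fun s => le_max_right s 0

theorem continuousOn_linearResponse (hA : ContinuousOn A (Ici 0)) (hV : ContinuousOn V (Ici 0))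
    (hC : 0 < C) (hAC : ∀ u, 0 ≤ u → ‖A u‖ ≤ C) :
    ContinuousOn (linearResponse A V) (Ici 0) := by
  refine (continuousOn_linearResponse_of_continuous (continuous_comp_max_zero hA)
    (continuous_comp_max_zero hV) hC fun u => hAC _ (le_max_right u 0)).congr fun t ht => ?_
  exact linearResponse_congr (fun u hu => by simp [hu]) (fun u hu => by simp [hu]) ht

theorem linearResponse_eq_add_integral (hA : ContinuousOn A (Ici 0)) (hV : ContinuousOn V (Ici 0))
    (hC : 0 < C) (hAC : ∀ u, 0 ≤ u → ‖A u‖ ≤ C) {t : ℝ} (ht : 0 ≤ t) :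
    linearResponse A V t = V t + ∫ s in (0 : ℝ)..t, A s (linearResponse A V s) := by
  have hlr : ∀ s, 0 ≤ s → linearResponse A V s =
      linearResponse (fun s => A (max s 0)) (fun s => V (max s 0)) s := fun s hs =>
    linearResponse_congr (fun u hu => by simp [hu]) (fun u hu => by simp [hu]) hs
  rw [hlr t ht, linearResponse_eq_add_integral_of_continuous (continuous_comp_max_zero hA)
    (continuous_comp_max_zero hV) hC (fun u => hAC _ (le_max_right u 0)) ht]
  simp only [max_eq_left ht]
  congr 1
  refine intervalIntegral.integral_congr fun s hs => ?_
  rw [uIcc_of_le ht] at hs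
  simp only [max_eq_left hs.1, ← hlr s hs.1]

omit [CompleteSpace E] in
/-- Solutions of linear Volterra equations depend continuously on the forcing term. -/
theorem norm_sub_le_of_volterra {S δ : ℝ} (hA : ContinuousOn A (Ici 0)) (hC : 0 < C)
    (hAC : ∀ u, 0 ≤ u → ‖A u‖ ≤ C) {y₁ y₂ V₁ V₂ : ℝ → E} (hy₁ : ContinuousOn y₁ (Icc 0 S))
    (hy₂ : ContinuousOn y₂ (Icc 0 S))
    (h₁ : ∀ t ∈ Icc 0 S, y₁ t = V₁ t + ∫ s in (0 : ℝ)..t, A s (y₁ s))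
    (h₂ : ∀ t ∈ Icc 0 S, y₂ t = V₂ t + ∫ s in (0 : ℝ)..t, A s (y₂ s))
    (hV : ∀ t ∈ Icc 0 S, ‖V₁ t - V₂ t‖ ≤ δ) :
    ∀ t ∈ Icc 0 S, ‖y₁ t - y₂ t‖ ≤ δ * Real.exp (C * S) := by
  intro t ht
  have hδ : 0 ≤ δ := (norm_nonneg _).trans (hV t ht)
  have hcont : ∀ y : ℝ → E, ContinuousOn y (Icc 0 S) → ∀ r ∈ Icc 0 S,
      IntervalIntegrable (fun s => A s (y s)) volume 0 r := by
    intro y hy r hr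
    refine ContinuousOn.intervalIntegrable ?_
    rw [uIcc_of_le hr.1]
    exact (hA.mono Icc_subset_Ici_self).clm_apply (hy.mono (Icc_subset_Icc_right hr.2))
  have hd : ContinuousOn (fun s => ‖y₁ s - y₂ s‖) (Icc 0 S) := (hy₁.sub hy₂).norm
  have := le_mul_exp_of_le_add_integral hC hd (K := δ) (fun r hr => by
    rw [h₁ r hr, h₂ r hr, add_sub_add_comm,
      ← intervalIntegral.integral_sub (hcont y₁ hy₁ r hr) (hcont y₂ hy₂ r hr)]
    refine (norm_add_le _ _).trans (add_le_add (hV r hr) ?_)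
    rw [← intervalIntegral.integral_const_mul]
    refine intervalIntegral.norm_integral_le_of_norm_le hr.1 (ae_of_all _ fun s hs => ?_) ?_
    · rw [← map_sub]
      exact (ContinuousLinearMap.le_opNorm _ _).trans
        (mul_le_mul_of_nonneg_right (hAC s hs.1.le) (norm_nonneg _))
    · refine ContinuousOn.intervalIntegrable ?_
      rw [uIcc_of_le hr.1]
      exact (hd.mono (Icc_subset_Icc_right hr.2)).const_mul C) t ht
  refine this.trans ?_
  gcongr
  exact ht.2

theorem commute_intervalIntegral (hA : Continuous A) {L : E →L[ℝ] E} (h : ∀ u, Commute L (A u))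
    {s t : ℝ} : Commute L (∫ u in s..t, A u) := by
  have hi := hA.intervalIntegrable (μ := volume) s t
  have h1 : L * ∫ u in s..t, A u = ∫ u in s..t, L * A u :=
    (((ContinuousLinearMap.mul ℝ (E →L[ℝ] E)) L).intervalIntegral_comp_comm hi).symm
  have h2 : (∫ u in s..t, A u) * L = ∫ u in s..t, A u * L :=
    (((ContinuousLinearMap.mul ℝ (E →L[ℝ] E)).flip L).intervalIntegral_comp_comm hi).symm
  rw [Commute, SemiconjBy, h1, h2]
  exact intervalIntegral.integral_congr fun u _ => h u

/-- For a commuting family the iterated integrals are the terms of the exponential series. -/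
theorem orderedExpTerm_eq_pow_of_commute (hA : Continuous A) (hcomm : ∀ r u, Commute (A r) (A u))
    (n : ℕ) (s t : ℝ) :
    orderedExpTerm A s n t = ((n.factorial : ℝ)⁻¹) • (∫ u in s..t, A u) ^ n := by
  have hB : ∀ t, HasDerivAt (fun t => ∫ u in s..t, A u) (A t) t := fun t =>
    (hA.integral_hasStrictDerivAt s t).hasDerivAt
  have hAB : ∀ t, Commute (A t) (∫ u in s..t, A u) := fun t =>
    commute_intervalIntegral hA fun u => hcomm t u
  have hpow : ∀ (n : ℕ) (t : ℝ), HasDerivAt (fun t => (∫ u in s..t, A u) ^ (n + 1))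
      (((n : ℝ) + 1) • (A t * (∫ u in s..t, A u) ^ n)) t := by
    intro n
    induction n with
    | zero => intro t; simpa using hB t
    | succ n ih =>
      intro t
      have := (ih t).mul (hB t)
      refine (this.congr_of_eventuallyEq (.of_forall fun r => pow_succ _ _)).congr_deriv ?_
      have hc : (∫ u in s..t, A u) ^ (n + 1) * A t = A t * (∫ u in s..t, A u) ^ (n + 1) :=
        ((hAB t).pow_right (n + 1)).eq.symm
      rw [hc, smul_mul_assoc, mul_assoc, ← pow_succ]
      push_cast
      module
  induction n generalizing t with
  | zero => simp [orderedExpTerm]; rfl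
  | succ n ih =>
    have hBc : Continuous fun t => ∫ u in s..t, A u :=
      continuous_iff_continuousAt.2 fun t => (hB t).continuousAt
    have h1 : orderedExpTerm A s (n + 1) t =
        ∫ u in s..t, ((n.factorial : ℝ)⁻¹) • (A u * (∫ r in s..u, A r) ^ n) := by
      refine intervalIntegral.integral_congr fun u _ => ?_
      simp only [ih u]
      rw [← mul_smul_comm]; rfl
    have h2 : ∀ u ∈ uIcc s t, HasDerivAt
        (fun t => (((n + 1).factorial : ℝ)⁻¹) • (∫ u in s..t, A u) ^ (n + 1))
        (((n.factorial : ℝ)⁻¹) • (A u * (∫ r in s..u, A r) ^ n)) u := by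
      intro u _
      refine ((hpow n u).const_smul (((n + 1).factorial : ℝ)⁻¹)).congr_deriv ?_
      rw [smul_smul, Nat.factorial_succ]
      congr 1
      push_cast
      field_simp
    have h3 : Continuous fun u => ((n.factorial : ℝ)⁻¹) • (A u * (∫ r in s..u, A r) ^ n) :=
      (hA.mul (hBc.pow n)).const_smul ((n.factorial : ℝ)⁻¹)
    rw [h1, intervalIntegral.integral_eq_sub_of_hasDerivAt h2 (h3.intervalIntegrable _ _)]
    simp

theorem linearResponse_eq_of_commute (hA : ContinuousOn A (Ici 0))
    (hcomm : ∀ r u, 0 ≤ r → 0 ≤ u → Commute (A r) (A u)) {t : ℝ} (ht : 0 ≤ t) :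
    linearResponse A V t = V t + ∫ s in (0 : ℝ)..t,
      (A s * NormedSpace.exp (∫ u in s..t, A u)) (V s) := by
  rw [linearResponse]
  congr 1
  refine intervalIntegral.integral_congr fun s hs => ?_
  rw [uIcc_of_le ht] at hs
  set B : ℝ → E →L[ℝ] E := fun s => A (max s 0) with hB
  have hBc : Continuous B := continuous_comp_max_zero hA
  have hBcomm : ∀ r u, Commute (B r) (B u) := fun r u =>
    hcomm _ _ (le_max_right _ _) (le_max_right _ _)
  have hint : ∫ u in s..t, A u = ∫ u in s..t, B u := by
    refine intervalIntegral.integral_congr fun u hu => ?_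
    rw [uIcc_of_le hs.2] at hu
    simp [hB, hs.1.trans hu.1]
  have hexp : orderedExp A s t = NormedSpace.exp (∫ u in s..t, B u) := by
    rw [orderedExp, NormedSpace.exp_eq_tsum ℝ]
    refine tsum_congr fun n => ?_
    rw [orderedExpTerm_congr (B := B) (fun u hu => by simp [hB, hu]) n hs.1 ht,
      orderedExpTerm_eq_pow_of_commute hBc hBcomm]
  have hc : Commute (A s) (∫ u in s..t, B u) :=
    commute_intervalIntegral hBc fun u => hcomm s _ hs.1 (le_max_right _ _)
  change orderedExp A s t (A s (V s)) = _
  rw [hexp, hint, hc.exp_right.eq]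
  rfl

end LinearResponse

/-! ### Asymptotically invariant observables of an ergodic map -/

section Invariant

variable {M : Type*} [MeasurableSpace M] {ι : Type*}

/-- Uniformly bounded functions have a weak limit in `L²` along an ultrafilter, by the
Banach–Alaoglu theorem. -/
theorem exists_weak_limit_L2 (m : Measure M) [IsFiniteMeasure m] (U : Ultrafilter ι)
    {g : ι → M → ℝ} (hg : ∀ i, Measurable (g i)) {C : ℝ} (hgC : ∀ i y, |g i y| ≤ C) :
    ∃ h : M → ℝ, Measurable h ∧ Integrable h m ∧ ∀ s, MeasurableSet s → ∀ c : ℝ,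
      Tendsto (fun i => ∫ y, g i y * s.indicator (fun _ => c) y ∂m) U
        (𝓝 (∫ y, h y * s.indicator (fun _ => c) y ∂m)) := by
  have hmem : ∀ i, MemLp (g i) 2 m := fun i =>
    MemLp.of_bound (hg i).aestronglyMeasurable C (ae_of_all _ (hgC i))
  set G : ι → Lp ℝ 2 m := fun i => (hmem i).toLp with hG
  set r : ℝ := m.real univ ^ ((2 : ENNReal).toReal⁻¹) * |C|
  have hGr : ∀ i, ‖G i‖ ≤ r := fun i => by
    refine Lp.norm_le_of_ae_bound (abs_nonneg C) ?_
    filter_upwards [(hmem i).coeFn_toLp] with y hy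
    rw [hy]
    exact (hgC i y).trans (le_abs_self C)
  set φ : ι → WeakDual ℝ (Lp ℝ 2 m) := fun i =>
    StrongDual.toWeakDual (InnerProductSpace.toDual ℝ (Lp ℝ 2 m) (G i)) with hφ
  have hcomp := WeakDual.isCompact_closedBall (𝕜 := ℝ)
    (0 : StrongDual ℝ (Lp ℝ 2 m)) r
  obtain ⟨ψ, -, hψ⟩ := hcomp.ultrafilter_le_nhds (U.map φ) (by
    rw [le_principal_iff, Ultrafilter.mem_coe, Ultrafilter.mem_map]
    refine univ_mem' fun i => ?_
    simpa [hφ] using hGr i)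
  obtain ⟨H, hH⟩ := (InnerProductSpace.toDual ℝ (Lp ℝ 2 m)).surjective (WeakDual.toStrongDual ψ)
  have hlim : ∀ q : Lp ℝ 2 m, Tendsto (fun i => inner ℝ (G i) q) U (𝓝 (inner ℝ H q)) := by
    intro q
    have h1 : Tendsto (fun i => φ i q) U (𝓝 (ψ q)) :=
      ((WeakDual.eval_continuous q).tendsto ψ).comp hψ
    have h2 : ψ q = inner ℝ H q := by
      rw [← InnerProductSpace.toDual_apply_apply, hH]; rfl
    rw [← h2]; exact h1
  refine ⟨H, (Lp.stronglyMeasurable H).measurable, (Lp.memLp H).integrable (by norm_num), ?_⟩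
  intro s hs c
  have hq : MemLp (s.indicator fun _ => c) 2 m := (memLp_const c).indicator hs
  have h3 : ∀ (F : Lp ℝ 2 m), inner ℝ F hq.toLp =
      ∫ y, F y * s.indicator (fun _ => c) y ∂m := by
    intro F
    rw [L2.inner_def]
    refine integral_congr_ae ?_
    filter_upwards [hq.coeFn_toLp] with y hy
    rw [hy]
    simp [mul_comm]
  have h4 := hlim hq.toLp
  simp only [h3] at h4
  refine h4.congr fun i => integral_congr_ae ?_
  filter_upwards [(hmem i).coeFn_toLp] with y hy
  rw [hy]

/-- Uniformly bounded functions have a weak-* limit in `L^∞` along an ultrafilter. -/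
theorem exists_weakStar_limit (m : Measure M) [IsFiniteMeasure m] (U : Ultrafilter ι)
    {g : ι → M → ℝ} (hg : ∀ i, Measurable (g i)) {C : ℝ} (hgC : ∀ i y, |g i y| ≤ C) :
    ∃ h : M → ℝ, Measurable h ∧ (∀ y, |h y| ≤ |C|) ∧ ∀ ρ : Measure M, IsFiniteMeasure ρ → ρ ≪ m →
      Tendsto (fun i => ∫ y, g i y ∂ρ) U (𝓝 (∫ y, h y ∂ρ)) := by
  obtain ⟨h₀, hh₀, hint₀, hlim₀⟩ := exists_weak_limit_L2 m U hg hgC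
  have hgC' : ∀ i y, |g i y| ≤ |C| := fun i y => (hgC i y).trans (le_abs_self C)
  have hgi : ∀ i, Integrable (g i) m := fun i =>
    Integrable.of_bound (hg i).aestronglyMeasurable |C| (ae_of_all _ (hgC' i))
  have hset : ∀ s, MeasurableSet s →
      Tendsto (fun i => ∫ y in s, g i y ∂m) U (𝓝 (∫ y in s, h₀ y ∂m)) := by
    intro s hs
    have := hlim₀ s hs 1
    have h1 : ∀ F : M → ℝ, ∫ y, F y * s.indicator (fun _ => (1 : ℝ)) y ∂m = ∫ y in s, F y ∂m := by
      intro F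
      rw [← integral_indicator hs]
      congr 1 with y
      by_cases hy : y ∈ s <;> simp [hy]
    simpa only [h1] using this
  have hle : h₀ ≤ᵐ[m] fun _ => |C| := by
    refine ae_le_of_forall_setIntegral_le hint₀ (integrable_const _) fun s hs _ => ?_
    refine le_of_tendsto (hset s hs) (.of_forall fun i => ?_)
    exact setIntegral_mono (hgi i).integrableOn (integrable_const _).integrableOn
      fun y => (abs_le.1 (hgC' i y)).2
  have hge : (fun _ => -|C|) ≤ᵐ[m] h₀ := by
    refine ae_le_of_forall_setIntegral_le (integrable_const _) hint₀ fun s hs _ => ?_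
    refine ge_of_tendsto (hset s hs) (.of_forall fun i => ?_)
    exact setIntegral_mono (integrable_const _).integrableOn (hgi i).integrableOn
      fun y => (abs_le.1 (hgC' i y)).1
  set h : M → ℝ := fun y => max (-|C|) (min |C| (h₀ y)) with hdef
  have hh : Measurable h := by fun_prop
  have hhC : ∀ y, |h y| ≤ |C| := fun y =>
    abs_le.2 ⟨le_max_left _ _, max_le (neg_le_self (abs_nonneg C)) (min_le_left _ _)⟩
  have hhh : h₀ =ᵐ[m] h := by
    filter_upwards [hle, hge] with y h1 h2
    simp only [hdef]
    rw [min_eq_right h1, max_eq_right h2]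
  have key : ∀ q : M → ℝ, Integrable q m →
      Tendsto (fun i => ∫ y, g i y * q y ∂m) U (𝓝 (∫ y, h y * q y ∂m)) := by
    have hmul : ∀ F : M → ℝ, Measurable F → (∀ y, |F y| ≤ |C|) → ∀ q : M → ℝ, Integrable q m →
        Integrable (fun y => F y * q y) m := fun F hF hFC q hq =>
      hq.bdd_mul hF.aestronglyMeasurable (ae_of_all _ hFC)
    intro q hq
    refine Integrable.induction (P := fun q =>
      Tendsto (fun i => ∫ y, g i y * q y ∂m) U (𝓝 (∫ y, h y * q y ∂m))) ?_ ?_ ?_ ?_ hq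
    · intro c s hs _
      have h1 : ∫ y, h y * s.indicator (fun _ => c) y ∂m =
          ∫ y, h₀ y * s.indicator (fun _ => c) y ∂m := by
        refine integral_congr_ae ?_
        filter_upwards [hhh] with y hy
        rw [hy]
      rw [h1]
      exact hlim₀ s hs c
    · intro p q _ hp hq h1 h2
      have := h1.add h2
      simp only [Pi.add_apply, mul_add]
      rw [integral_add (hmul h hh hhC p hp) (hmul h hh hhC q hq)]
      refine this.congr fun i => ?_
      rw [integral_add (hmul _ (hg i) (hgC' i) p hp) (hmul _ (hg i) (hgC' i) q hq)]
    · refine isClosed_of_closure_subset fun f hf => ?_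
      rw [mem_ofPred_eq, Metric.tendsto_nhds]
      intro ε hε
      obtain ⟨p, hp, hpf⟩ := Metric.mem_closure_iff.1 hf (ε / (2 * |C| + 2)) (by positivity)
      have h1 := (Metric.tendsto_nhds.1 hp) (ε / (2 * |C| + 2)) (by positivity)
      have hbd : ∀ F : M → ℝ, Measurable F → (∀ y, |F y| ≤ |C|) →
          |(∫ y, F y * f y ∂m) - ∫ y, F y * p y ∂m| ≤ |C| * (ε / (2 * |C| + 2)) := by
        intro F hF hFC
        rw [← integral_sub (hmul F hF hFC f (L1.integrable_coeFn f))
          (hmul F hF hFC p (L1.integrable_coeFn p))]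
        calc ‖∫ y, (F y * f y - F y * p y) ∂m‖ ≤ ∫ y, |C| * ‖f y - p y‖ ∂m := by
              refine norm_integral_le_of_norm_le
                (((L1.integrable_coeFn f).sub (L1.integrable_coeFn p)).norm.const_mul _)
                (ae_of_all _ fun y => ?_)
              rw [← mul_sub, norm_mul]
              exact mul_le_mul_of_nonneg_right (hFC y) (norm_nonneg _)
          _ = |C| * dist f p := by
              rw [integral_const_mul, dist_eq_norm, L1.norm_eq_integral_norm]
              congr 1
              refine integral_congr_ae ?_
              filter_upwards [Lp.coeFn_sub f p] with y hy
              rw [hy]; rfl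
          _ ≤ _ := by gcongr
      filter_upwards [h1] with i hi
      have e1 := hbd _ (hg i) (hgC' i)
      have e2 := hbd h hh hhC
      rw [Real.dist_eq] at hi ⊢
      have e3 : |C| * (ε / (2 * |C| + 2)) + |C| * (ε / (2 * |C| + 2)) + ε / (2 * |C| + 2) < ε := by
        have : |C| * (ε / (2 * |C| + 2)) + |C| * (ε / (2 * |C| + 2)) + ε / (2 * |C| + 2) =
          ε * ((2 * |C| + 1) / (2 * |C| + 2)) := by field_simp; ring
        rw [this]
        refine mul_lt_of_lt_one_right hε ?_
        rw [div_lt_one (by positivity)]; linarith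
      rw [abs_le] at e1 e2
      rw [abs_lt] at hi ⊢
      constructor <;> linarith [e1.1, e1.2, e2.1, e2.2, hi.1, hi.2]
    · intro p q hpq _ hp
      have : ∀ F : M → ℝ, ∫ y, F y * p y ∂m = ∫ y, F y * q y ∂m := fun F => by
        refine integral_congr_ae ?_
        filter_upwards [hpq] with y hy
        rw [hy]
      simpa only [this] using hp
  refine ⟨h, hh, hhC, fun ρ _ hρ => ?_⟩
  have hq : Integrable (fun y => (ρ.rnDeriv m y).toReal) m := Measure.integrable_toReal_rnDeriv
  have e : ∀ F : M → ℝ, ∫ y, F y * (ρ.rnDeriv m y).toReal ∂m = ∫ y, F y ∂ρ := fun F => by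
    rw [← integral_rnDeriv_smul hρ]
    simp [mul_comm]
  simpa only [e] using key _ hq

/-- Along asymptotically invariant, uniformly bounded observables of an ergodic map, the integral
against a probability measure `P ≪ μ` does not depend on `P` in the limit: every weak-* limit
point is an invariant function, hence constant. -/
theorem Ergodic.tendsto_integral_of_asymptotically_invariant {μ : Measure M} [SigmaFinite μ]
    {T : M → M} (hT : Ergodic T μ) {l : Filter ι} {g : ι → M → ℝ}
    (hg : ∀ i, Measurable (g i)) {C : ℝ} (hgC : ∀ i y, |g i y| ≤ C)
    {r : ι → ℝ} (hr : Tendsto r l (𝓝 0)) (hinv : ∀ᶠ i in l, ∀ y, |g i (T y) - g i y| ≤ r i)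
    {P P' : Measure M} [IsProbabilityMeasure P] [IsProbabilityMeasure P'] (hP : P ≪ μ)
    (hP' : P' ≪ μ) {c : ℝ} (hc : Tendsto (fun i => ∫ y, g i y ∂P) l (𝓝 c)) :
    Tendsto (fun i => ∫ y, g i y ∂P') l (𝓝 c) := by
  rw [tendsto_iff_ultrafilter]
  intro U hU
  have hμm : μ ≪ μ.toFinite := absolutelyContinuous_toFinite μ
  have hmμ : μ.toFinite ≪ μ := toFinite_absolutelyContinuous μ
  obtain ⟨h, hh, hhC, hlim⟩ := exists_weakStar_limit μ.toFinite U hg hgC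
  have hTm : Measurable T := hT.measurable
  have hhi : ∀ ρ : Measure M, IsFiniteMeasure ρ → Integrable h ρ := fun ρ _ =>
    Integrable.of_bound hh.aestronglyMeasurable |C| (ae_of_all _ hhC)
  have hgi : ∀ ρ : Measure M, IsFiniteMeasure ρ → ∀ i, Integrable (g i) ρ := fun ρ _ i =>
    Integrable.of_bound (hg i).aestronglyMeasurable C (ae_of_all _ (hgC i))
  have hinvh : h ∘ T =ᵐ[μ.toFinite] h := by
    have hhTi : Integrable (h ∘ T) μ.toFinite :=
      Integrable.of_bound (hh.comp hTm).aestronglyMeasurable |C| (ae_of_all _ fun y => hhC (T y))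
    refine Integrable.ae_eq_of_forall_setIntegral_eq _ _ hhTi (hhi _ inferInstance)
      fun s hs _ => ?_
    have hac : (μ.toFinite.restrict s).map T ≪ μ.toFinite := by
      have h1 : (μ.toFinite.restrict s).map T ≪ μ.map T :=
        (Measure.absolutelyContinuous_of_le Measure.restrict_le_self).trans hmμ |>.map hTm
      rw [hT.map_eq] at h1
      exact h1.trans hμm
    have l1 := hlim _ inferInstance hac
    have l2 := hlim (μ.toFinite.restrict s) inferInstance
      (Measure.absolutelyContinuous_of_le Measure.restrict_le_self)
    rw [integral_map hTm.aemeasurable hh.aestronglyMeasurable] at l1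
    have e : ∀ i, ∫ y, g i y ∂((μ.toFinite.restrict s).map T) =
        ∫ y in s, g i (T y) ∂μ.toFinite := fun i =>
      integral_map hTm.aemeasurable (hg i).aestronglyMeasurable
    simp only [e] at l1
    have l3 : Tendsto (fun i => (∫ y in s, g i (T y) ∂μ.toFinite) - ∫ y in s, g i y ∂μ.toFinite) U
        (𝓝 0) := by
      refine squeeze_zero_norm' (a := fun i => r i * (μ.toFinite.restrict s).real univ) ?_ ?_
      · filter_upwards [hU hinv] with i hi
        have hgTi : Integrable (fun y => g i (T y)) (μ.toFinite.restrict s) :=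
          Integrable.of_bound ((hg i).comp hTm).aestronglyMeasurable C
            (ae_of_all _ fun y => hgC i (T y))
        rw [← integral_sub hgTi (hgi _ inferInstance i)]
        exact norm_integral_le_of_norm_le_const (ae_of_all _ hi)
      · simpa using (hr.mono_left hU).mul_const ((μ.toFinite.restrict s).real univ)
    have l4 := l1.sub l2
    have := tendsto_nhds_unique l4 l3
    exact sub_eq_zero.1 this
  obtain ⟨b, hb⟩ := hT.ae_eq_const_of_ae_eq_comp_ae hh.aestronglyMeasurable (hμm.ae_le hinvh)
  have hconst : ∀ ρ : Measure M, IsProbabilityMeasure ρ → ρ ≪ μ → ∫ y, h y ∂ρ = b := by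
    intro ρ _ hρ
    rw [integral_congr_ae (hρ.ae_le hb)]
    simp
  have l1 := hlim P inferInstance (hP.trans hμm)
  have l2 := hlim P' inferInstance (hP'.trans hμm)
  rw [hconst P inferInstance hP] at l1
  rw [hconst P' inferInstance hP'] at l2
  rw [tendsto_nhds_unique (hc.mono_left hU) l1]
  exact l2

/-- A convergence in distribution of asymptotically invariant random elements of a metric space
passes from one probability measure absolutely continuous with respect to `μ` to all the others. -/
theorem Ergodic.tendstoInDistribution_of_asymptotically_invariant {μ : Measure M} [SigmaFinite μ]
    {T : M → M} (hT : Ergodic T μ) {l : Filter ι} [l.IsCountablyGenerated]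
    {G : Type*} [PseudoMetricSpace G] [MeasurableSpace G] [BorelSpace G]
    {R : ι → M → G} (hR : ∀ i, Measurable (R i))
    {r : ι → ℝ} (hr : Tendsto r l (𝓝 0)) (hinv : ∀ᶠ i in l, ∀ y, dist (R i (T y)) (R i y) ≤ r i)
    {P P' : Measure M} [IsProbabilityMeasure P] [IsProbabilityMeasure P'] (hP : P ≪ μ)
    (hP' : P' ≪ μ) {Ω' : Type*} [MeasurableSpace Ω'] {Q : Measure Ω'} [IsProbabilityMeasure Q]
    {Z : Ω' → G} (hZ : TendstoInDistribution R l Z (fun _ => P) Q) :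
    TendstoInDistribution R l Z (fun _ => P') Q := by
  refine ⟨fun i => (hR i).aemeasurable, hZ.aemeasurable_limit, ?_⟩
  have h0 := hZ.tendsto
  refine tendsto_iff_forall_lipschitz_integral_tendsto.2 fun F hFb hFl => ?_
  have h1 := tendsto_iff_forall_lipschitz_integral_tendsto.1 h0 F hFb hFl
  obtain ⟨C, hC⟩ := hFb
  obtain ⟨L, hL⟩ := hFl
  have hFm : Measurable F := hL.continuous.measurable
  simp only [ProbabilityMeasure.coe_mk] at h1 ⊢
  have e : ∀ (P : Measure M) (i : ι), ∫ ω, F ω ∂(P.map (R i)) = ∫ y, F (R i y) ∂P := fun P i =>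
    integral_map (hR i).aemeasurable hFm.aestronglyMeasurable
  simp only [e] at h1 ⊢
  rcases isEmpty_or_nonempty G with hG | ⟨⟨x₀⟩⟩
  · have : IsEmpty M := by
      by_contra hM
      rw [not_isEmpty_iff] at hM
      obtain ⟨y⟩ := hM
      rcases isEmpty_or_nonempty ι with hι | ⟨⟨i⟩⟩
      · have : IsEmpty Ω' := ⟨fun ω => hG.elim (Z ω)⟩
        exact (IsProbabilityMeasure.ne_zero Q) (Measure.eq_zero_of_isEmpty Q)
      · exact hG.elim (R i y)
    exact absurd (Measure.eq_zero_of_isEmpty P) (IsProbabilityMeasure.ne_zero P)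
  refine hT.tendsto_integral_of_asymptotically_invariant (fun i => hFm.comp (hR i))
    (C := C + |F x₀|) (fun i y => ?_) (r := fun i => L * r i) (by simpa using hr.const_mul (L : ℝ))
    ?_ hP hP' h1
  · have h2 := hC (R i y) x₀
    rw [Real.dist_eq] at h2
    have h3 := abs_sub_abs_le_abs_sub (F (R i y)) (F x₀)
    simp only [Function.comp]
    linarith
  · filter_upwards [hinv] with i hi y
    have := hL.dist_le_mul (R i (T y)) (R i y)
    rw [Real.dist_eq] at this
    exact this.trans (mul_le_mul_of_nonneg_left (hi y) L.2)

end Invariant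

/-! ### Visit counts and the suspension flow -/

section Flow

variable {M : Type*} [MeasurableSpace M] {T : M → M} {τ : M → ℝ}

theorem IsRoof.birkhoffSum_mono (hτ : IsRoof τ) (T : M → M) (y : M) :
    Monotone fun n => birkhoffSum T τ n y := by
  obtain ⟨c, hc0, hc⟩ := hτ.bounded_below
  refine monotone_nat_of_le_succ fun n => ?_
  rw [birkhoffSum_succ]
  linarith [hc (T^[n] y)]

theorem IsRoof.le_visitCount_iff (hτ : IsRoof τ) (T : M → M) {t : ℝ} (ht : 0 ≤ t) (y : M) (n : ℕ) :
    n ≤ visitCount T τ t y ↔ birkhoffSum T τ n y ≤ t := by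
  refine ⟨fun h => (hτ.birkhoffSum_mono T y h).trans
    (sub_nonneg.1 (hτ.visitCount_spec T ht y).1), fun h => ?_⟩
  by_contra! hlt
  have h1 := hτ.birkhoffSum_mono T y (Nat.succ_le_of_lt hlt)
  have h2 := (hτ.visitCount_spec T ht y).2
  simp only [Nat.succ_eq_add_one, birkhoffSum_succ] at h1
  linarith

theorem IsRoof.visitCount_eq (hτ : IsRoof τ) (T : M → M) {t : ℝ} (y : M) (n : ℕ)
    (h₁ : birkhoffSum T τ n y ≤ t) (h₂ : t < birkhoffSum T τ (n + 1) y) :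
    visitCount T τ t y = n := by
  obtain ⟨c, hc0, hc⟩ := hτ.bounded_below
  have ht : 0 ≤ t := by
    have := IsRoof.mul_le_birkhoffSum hc T n y
    exact le_trans (by positivity) (this.trans h₁)
  refine le_antisymm ?_ ((hτ.le_visitCount_iff T ht y n).2 h₁)
  by_contra! hlt
  exact absurd ((hτ.le_visitCount_iff T ht y (n + 1)).1 hlt) (not_le.2 h₂)

theorem measurable_birkhoffSum {τ : M → ℝ} (hT : Measurable T) (hτ : Measurable τ) (n : ℕ) :
    Measurable (birkhoffSum T τ n) := by
  have : birkhoffSum T τ n = fun y => ∑ k ∈ Finset.range n, τ (T^[k] y) := rfl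
  rw [this]
  exact Finset.measurable_sum _ fun k _ => hτ.comp (hT.iterate k)

theorem IsRoof.measurable_visitCount (hτ : IsRoof τ) (hT : Measurable T) :
    Measurable fun q : ℝ × M => visitCount T τ q.1 q.2 := by
  have hset : ∀ n : ℕ, MeasurableSet {q : ℝ × M | n ≤ visitCount T τ q.1 q.2} := by
    intro n
    rcases n with _ | n
    · simp
    · have : {q : ℝ × M | n + 1 ≤ visitCount T τ q.1 q.2} =
          {q : ℝ × M | birkhoffSum T τ (n + 1) q.2 ≤ q.1} := by
        ext ⟨t, y⟩
        simp only [mem_ofPred_eq]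
        rcases le_or_gt 0 t with ht | ht
        · exact hτ.le_visitCount_iff T ht y (n + 1)
        · have hpos : ∀ k, ¬ birkhoffSum T τ k y ≤ t := fun k => by
            have := hτ.birkhoffSum_mono T y (Nat.zero_le k)
            simp only [birkhoffSum_zero] at this
            linarith
          have h0 : visitCount T τ t y = 0 := by
            simp [visitCount, hpos]
          simp [h0, hpos]
      rw [this]
      exact measurableSet_le ((measurable_birkhoffSum hT hτ.measurable _).comp measurable_snd)
        measurable_fst
  refine measurable_to_countable' fun n => ?_
  have : (fun q : ℝ × M => visitCount T τ q.1 q.2) ⁻¹' {n} =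
      {q : ℝ × M | n ≤ visitCount T τ q.1 q.2} \ {q : ℝ × M | n + 1 ≤ visitCount T τ q.1 q.2} := by
    ext q
    simp only [mem_preimage, mem_singleton_iff, Set.mem_sdiff, mem_ofPred_eq]
    omega
  rw [this]
  exact (hset n).diff (hset (n + 1))

theorem IsRoof.measurable_suspensionFlow (hτ : IsRoof τ) (hT : Measurable T) :
    Measurable fun q : NNReal × SuspensionSpace τ => suspensionFlow T hτ q.1 q.2 := by
  have ht : Measurable fun q : NNReal × SuspensionSpace τ => (q.1 : ℝ) + q.2.1.2 :=
    (measurable_coe_nnreal_real.comp measurable_fst).add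
      (measurable_snd.comp (measurable_subtype_coe.comp measurable_snd))
  have hy : Measurable fun q : NNReal × SuspensionSpace τ => q.2.1.1 :=
    measurable_fst.comp (measurable_subtype_coe.comp measurable_snd)
  have hn : Measurable fun q : NNReal × SuspensionSpace τ =>
      visitCount T τ (q.1 + q.2.1.2) q.2.1.1 :=
    (hτ.measurable_visitCount hT).comp (ht.prodMk hy)
  have h1 : Measurable fun r : M × ℕ => T^[r.2] r.1 :=
    measurable_from_prod_countable_left fun n => hT.iterate n
  have h2 : Measurable fun r : M × ℕ => birkhoffSum T τ r.2 r.1 :=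
    measurable_from_prod_countable_left fun n => measurable_birkhoffSum hT hτ.measurable n
  refine Measurable.subtype_mk ?_
  exact (h1.comp (hy.prodMk hn)).prodMk (ht.sub (h2.comp (hy.prodMk hn)))

/-- The point of the base `M × {0}` of the suspension above `y`. -/
def IsRoof.basePoint (hτ : IsRoof τ) (y : M) : SuspensionSpace τ :=
  ⟨(y, 0), le_rfl, by
    obtain ⟨c, hc0, hc⟩ := hτ.bounded_below
    exact hc0.trans_le (hc y)⟩

theorem IsRoof.measurable_basePoint (hτ : IsRoof τ) : Measurable hτ.basePoint :=
  Measurable.subtype_mk (measurable_id.prodMk measurable_const)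

theorem suspensionFlow_eq_basePoint (hτ : IsRoof τ) (T : M → M) {t : ℝ} (ht : 0 ≤ t)
    (p : SuspensionSpace τ) :
    suspensionFlow T hτ t.toNNReal p =
      suspensionFlow T hτ (t + p.1.2).toNNReal (hτ.basePoint p.1.1) := by
  have h1 : ((t + p.1.2).toNNReal : ℝ) = t + p.1.2 := Real.coe_toNNReal _ (add_nonneg ht p.2.1)
  refine Subtype.ext ?_
  simp only [suspensionFlow, IsRoof.basePoint, h1, Real.coe_toNNReal t ht, add_zero]

/-- One full passage through the suspension leads from the base point above `y` to the base point
above `T y`. -/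
theorem suspensionFlow_basePoint_map (hτ : IsRoof τ) (T : M → M) {t : ℝ} (ht : 0 ≤ t) (y : M) :
    suspensionFlow T hτ t.toNNReal (hτ.basePoint (T y)) =
      suspensionFlow T hτ (t + τ y).toNNReal (hτ.basePoint y) := by
  have hτy : 0 ≤ τ y := by
    obtain ⟨c, hc0, hc⟩ := hτ.bounded_below
    exact hc0.le.trans (hc y)
  have h1 : ((t + τ y).toNNReal : ℝ) = t + τ y := Real.coe_toNNReal _ (add_nonneg ht hτy)
  have hb : ∀ n, birkhoffSum T τ (n + 1) y = τ y + birkhoffSum T τ n (T y) := fun n =>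
    birkhoffSum_succ' T τ n y
  have hspec := hτ.visitCount_spec T ht (T y)
  have hv : visitCount T τ (t + τ y) y = visitCount T τ t (T y) + 1 := by
    refine hτ.visitCount_eq T y _ ?_ ?_
    · rw [hb]; linarith [hspec.1]
    · rw [hb, birkhoffSum_succ]; linarith [hspec.2]
  refine Subtype.ext ?_
  simp only [suspensionFlow, IsRoof.basePoint, h1, Real.coe_toNNReal t ht, add_zero, hv]
  rw [hb, Function.iterate_succ_apply]
  congr 1
  ring

/-- The flow line of a base point during its passage above `T^k y`. -/
theorem suspensionFlow_basePoint_of_mem (hτ : IsRoof τ) (T : M → M) (y : M) (k : ℕ) {u : ℝ}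
    (h : 0 ≤ u ∧ u < τ (T^[k] y)) :
    suspensionFlow T hτ (u + birkhoffSum T τ k y).toNNReal (hτ.basePoint y) =
      ⟨(T^[k] y, u), h⟩ := by
  have h0 : 0 ≤ birkhoffSum T τ k y := by
    simpa using hτ.birkhoffSum_mono T y (Nat.zero_le k)
  have h1 : ((u + birkhoffSum T τ k y).toNNReal : ℝ) = u + birkhoffSum T τ k y :=
    Real.coe_toNNReal _ (add_nonneg h.1 h0)
  have hv : visitCount T τ (u + birkhoffSum T τ k y) y = k := by
    refine hτ.visitCount_eq T y _ ?_ ?_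
    · linarith [h.1]
    · rw [birkhoffSum_succ]; linarith [h.2]
  refine Subtype.ext ?_
  simp only [suspensionFlow, IsRoof.basePoint, h1, add_zero, hv, add_sub_cancel_right]

end Flow

/-! ### Measurability of solutions and of path-valued maps -/

section Measurability

/-- The Picard iterates of the integral equation `Z_t = x + ∫_0^t g_s(Z_s) ds`. -/
noncomputable def picardIterate {E : Type*} [NormedAddCommGroup E] [NormedSpace ℝ E]
    (g : ℝ → E → E) (x : E) : ℕ → ℝ → E
  | 0 => fun _ => x
  | n + 1 => fun t => x + ∫ s in (0 : ℝ)..t, g s (picardIterate g x n s)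

variable {P E : Type*} [MeasurableSpace P] [NormedAddCommGroup E] [NormedSpace ℝ E]
  [MeasurableSpace E] [BorelSpace E] [SecondCountableTopology E]

theorem measurable_picardIterate {g : P → ℝ → E → E}
    (hg : Measurable fun q : P × ℝ × E => g q.1 q.2.1 q.2.2) (x : E) (n : ℕ) :
    Measurable fun q : P × ℝ => picardIterate (g q.1) x n q.2 := by
  induction n with
  | zero => exact measurable_const
  | succ n ih =>
    have h1 : (fun q : P × ℝ => picardIterate (g q.1) x (n + 1) q.2) = fun q : P × ℝ =>
        x + q.2 • ∫ s in Ioc (0 : ℝ) 1, g q.1 (q.2 * s) (picardIterate (g q.1) x n (q.2 * s)) := by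
      funext q
      have := intervalIntegral.smul_integral_comp_mul_left (a := 0) (b := 1)
        (fun s => g q.1 s (picardIterate (g q.1) x n s)) q.2
      rw [mul_zero, mul_one, intervalIntegral.integral_of_le zero_le_one] at this
      simp only [picardIterate, ← this]
    rw [h1]
    have h2 : Measurable fun r : (P × ℝ) × ℝ =>
        g r.1.1 (r.1.2 * r.2) (picardIterate (g r.1.1) x n (r.1.2 * r.2)) := by
      have h3 : Measurable fun r : (P × ℝ) × ℝ => (r.1.1, r.1.2 * r.2) := by fun_prop
      have h4 := ih.comp h3
      exact hg.comp ((measurable_fst.comp h3).prodMk ((measurable_snd.comp h3).prodMk h4))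
    have h5 := (h2.stronglyMeasurable.integral_prod_right'
      (ν := (volume : Measure ℝ).restrict (Ioc 0 1))).measurable
    exact (measurable_snd.smul h5).const_add x

/-- The weight `exp (2 L t)` makes the Picard iteration a contraction with ratio `1 / 2` on the whole
half-line. -/
theorem norm_sub_picardIterate_le {g : ℝ → E → E}
    (hg : Measurable fun q : ℝ × E => g q.1 q.2) {C L : ℝ} (hL : 1 ≤ L) (hgC : ∀ t y, ‖g t y‖ ≤ C)
    (hgL : ∀ t y z, ‖g t y - g t z‖ ≤ L * ‖y - z‖) {x : E} {Z : ℝ → E} (hZ : IsSolution g x Z)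
    (n : ℕ) {t : ℝ} (ht : 0 ≤ t) :
    ‖Z t - picardIterate g x n t‖ ≤ C * ((1 / 2) ^ n * Real.exp (2 * L * (t - 0))) := by
  have hC : 0 ≤ C := (norm_nonneg _).trans (hgC 0 0)
  induction n generalizing t with
  | zero =>
    obtain ⟨hi, he⟩ := hZ.2 t ht
    simp only [picardIterate, pow_zero, one_mul, sub_zero]
    rw [he, add_sub_cancel_left]
    have h1 := intervalIntegral.norm_integral_le_of_norm_le_const (a := 0) (b := t)
      (f := fun s => g s (Z s)) (C := C) fun s _ => hgC s _
    rw [sub_zero, abs_of_nonneg ht] at h1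
    refine h1.trans (mul_le_mul_of_nonneg_left ?_ hC)
    have := Real.add_one_le_exp (2 * L * t)
    nlinarith
  | succ n ih =>
    obtain ⟨hi, he⟩ := hZ.2 t ht
    have hm : Measurable fun s => g s (picardIterate g x n s) := by
      have h1 := (measurable_picardIterate (P := Unit) (g := fun _ => g)
        (hg.comp measurable_snd) x n).comp (measurable_const (a := ()) |>.prodMk measurable_id)
      exact hg.comp (measurable_id.prodMk h1)
    have hi' : IntervalIntegrable (fun s => g s (picardIterate g x n s)) volume 0 t := by
      refine (intervalIntegrable_const (c := C)).mono_fun hm.aestronglyMeasurable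
        (ae_of_all _ fun s => ?_)
      rw [Real.norm_of_nonneg hC]; exact hgC s _
    simp only [picardIterate]
    rw [he, add_sub_add_left_eq_sub, ← intervalIntegral.integral_sub hi hi']
    have hc : Continuous fun s => L * (C * ((1 / 2) ^ n * Real.exp (2 * L * (s - 0)))) := by
      fun_prop
    refine (intervalIntegral.norm_integral_le_of_norm_le ht (ae_of_all _ fun s hs =>
      (hgL s _ _).trans (mul_le_mul_of_nonneg_left (ih hs.1.le) (by linarith)))
      (hc.intervalIntegrable _ _)).trans ?_
    have h2 := mul_integral_exp_le (C := L) (s := 0) (t := t) (by linarith)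
    simp only [intervalIntegral.integral_const_mul]
    calc L * (C * ((1 / 2) ^ n * ∫ s in (0 : ℝ)..t, Real.exp (2 * L * (s - 0))))
        = C * ((1 / 2) ^ n * (L * ∫ s in (0 : ℝ)..t, Real.exp (2 * L * (s - 0)))) := by ring
      _ ≤ C * ((1 / 2) ^ n * (Real.exp (2 * L * (t - 0)) / 2)) := by gcongr
      _ = _ := by rw [pow_succ]; ring

/-- The solution of a measurable family of differential equations is measurable with respect to
the parameter, as the limit of its Picard iterates. -/
theorem measurable_of_isSolution {g : P → ℝ → E → E}
    (hg : Measurable fun q : P × ℝ × E => g q.1 q.2.1 q.2.2) {C L : ℝ} (hL : 1 ≤ L)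
    (hgC : ∀ p t y, ‖g p t y‖ ≤ C) (hgL : ∀ p t y z, ‖g p t y - g p t z‖ ≤ L * ‖y - z‖) {x : E}
    {Z : P → ℝ → E} (hZ : ∀ p, IsSolution (g p) x (Z p)) {t : ℝ} (ht : 0 ≤ t) :
    Measurable fun p => Z p t := by
  refine measurable_of_tendsto_metrizable (f := fun n p => picardIterate (g p) x n t)
    (fun n => (measurable_picardIterate hg x n).comp (measurable_id.prodMk measurable_const)) ?_
  refine tendsto_pi_nhds.2 fun p => ?_
  rw [tendsto_iff_norm_sub_tendsto_zero]
  have hlim : Tendsto (fun n : ℕ => C * ((1 / 2 : ℝ) ^ n * Real.exp (2 * L * (t - 0)))) atTop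
      (𝓝 0) := by
    have := (tendsto_pow_atTop_nhds_zero_of_lt_one (r := (1 / 2 : ℝ)) (by norm_num)
      (by norm_num)).mul_const (Real.exp (2 * L * (t - 0))) |>.const_mul C
    simpa using this
  refine squeeze_zero (fun _ => norm_nonneg _) (fun n => ?_) hlim
  rw [norm_sub_rev]
  exact norm_sub_picardIterate_le (hg.comp (measurable_const.prodMk measurable_id)) hL (hgC p)
    (hgL p) (hZ p) n ht

omit [NormedSpace ℝ E] in
/-- The Borel `σ`-algebra of a space of continuous functions is generated by the evaluations. -/
theorem measurable_continuousMap_of_eval {X : Type*} [TopologicalSpace X] [CompactSpace X]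
    [SecondCountableTopology X] [LocallyCompactSpace X] {R : P → C(X, E)}
    (hR : ∀ t, Measurable fun p => R p t) : Measurable R := by
  have hborel : (continuousMapMeasurableSpace : MeasurableSpace C(X, E)) =
      MeasurableSpace.generateFrom
        (image2 (fun K U ↦ {f : C(X, E) | MapsTo f K U}) {K | IsCompact K} {U | IsOpen U}) :=
    borel_eq_generateFrom_of_subbasis ContinuousMap.compactOpen_eq
  rw [hborel]
  refine measurable_generateFrom ?_
  rintro _ ⟨K, hK, U, hU, rfl⟩
  obtain ⟨D, hDc, hDd⟩ := TopologicalSpace.exists_countable_dense K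
  set F : ℕ → Set E := fun n => {z | (n : ENNReal)⁻¹ ≤ Metric.infEDist z Uᶜ} with hF
  have hFc : ∀ n, IsClosed (F n) := fun n =>
    isClosed_le continuous_const Metric.continuous_infEDist
  have hFU : ∀ n, F n ⊆ U := by
    intro n z hz
    by_contra hzU
    have h1 : Metric.infEDist z Uᶜ = 0 := Metric.infEDist_zero_of_mem hzU
    simp [hF, h1] at hz
  -- a compact subset of `U` stays at a positive distance from the complement of `U`
  have hiff : R ⁻¹' {f : C(X, E) | MapsTo f K U} = ⋃ n, ⋂ d ∈ D, {p | R p (d : K) ∈ F n} := by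
    ext p
    simp only [mem_preimage, mem_ofPred_eq, mem_iUnion, mem_iInter]
    constructor
    · intro h
      obtain ⟨δ, hδ, hδU⟩ := (hK.image (R p).continuous).exists_thickening_subset_open hU
        h.image_subset
      obtain ⟨n, hn⟩ := ENNReal.exists_inv_nat_lt (ENNReal.ofReal_pos.2 hδ).ne'
      refine ⟨n, fun d _ => ?_⟩
      refine Metric.le_infEDist.2 fun z hz => ?_
      by_contra! hlt
      refine hz (hδU (Metric.mem_thickening_iff.2 ⟨R p d, mem_image_of_mem _ d.2, ?_⟩))
      rw [dist_comm]
      exact edist_lt_ofReal.1 (hlt.trans hn)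
    · rintro ⟨n, hn⟩ t ht
      have hcl : IsClosed {t : K | R p t ∈ F n} :=
        (hFc n).preimage ((R p).continuous.comp continuous_subtype_val)
      have := hcl.closure_subset_iff.2 (fun d hd => hn d hd : D ⊆ {t : K | R p t ∈ F n})
      rw [hDd.closure_eq] at this
      exact hFU n (this (mem_univ ⟨t, ht⟩))
  rw [hiff]
  exact MeasurableSet.iUnion fun n => MeasurableSet.biInter hDc fun d _ =>
    (hFc n).measurableSet.preimage (hR _)

end Measurability

/-! ### Elementary estimates for differential equations -/

section ODEEstimates

variable {E : Type*} [NormedAddCommGroup E] [NormedSpace ℝ E]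
  {g : ℝ → E → E} {x : E} {Z : ℝ → E}

theorem IsSolution.intervalIntegrable (hZ : IsSolution g x Z) {s t : ℝ} (hs : 0 ≤ s) (ht : 0 ≤ t) :
    IntervalIntegrable (fun r => g r (Z r)) volume s t :=
  (hZ.2 s hs).1.symm.trans (hZ.2 t ht).1

theorem IsSolution.sub_eq_integral (hZ : IsSolution g x Z) {s t : ℝ} (hs : 0 ≤ s) (ht : 0 ≤ t) :
    Z t - Z s = ∫ r in s..t, g r (Z r) := by
  rw [(hZ.2 t ht).2, (hZ.2 s hs).2, add_sub_add_left_eq_sub,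
    intervalIntegral.integral_interval_sub_left (hZ.2 t ht).1 (hZ.2 s hs).1]

theorem IsSolution.norm_sub_le (hZ : IsSolution g x Z) {C : ℝ} (hC : ∀ t y, ‖g t y‖ ≤ C)
    {s t : ℝ} (hs : 0 ≤ s) (ht : 0 ≤ t) : ‖Z t - Z s‖ ≤ C * |t - s| := by
  rw [hZ.sub_eq_integral hs ht]
  exact intervalIntegral.norm_integral_le_of_norm_le_const fun r _ => hC r _

theorem IsSolution.apply_zero (hZ : IsSolution g x Z) : Z 0 = x := by
  simpa using (hZ.2 0 le_rfl).2

/-- Shifting the time of a bounded Lipschitz field by `h` moves the solution by `O(h)`. -/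
theorem IsSolution.norm_sub_le_of_shift {g' : ℝ → E → E} {Z' : ℝ → E} (hZ : IsSolution g x Z)
    (hZ' : IsSolution g' x Z') {C L h S : ℝ} (hL : 0 < L) (hh : 0 ≤ h)
    (hC : ∀ t y, ‖g t y‖ ≤ C) (hgL : ∀ t y z, ‖g t y - g t z‖ ≤ L * ‖y - z‖)
    (hg' : ∀ t, 0 ≤ t → g' t = g (t + h)) {t : ℝ} (ht : t ∈ Icc 0 S) :
    ‖Z' t - Z t‖ ≤ C * h * (Real.exp (L * S) + 1) := by
  have hshift : ∀ r, 0 ≤ r → Z (r + h) = Z h + ∫ s in (0 : ℝ)..r, g (s + h) (Z (s + h)) := by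
    intro r hr
    have h1 := hZ.sub_eq_integral hh (add_nonneg hr hh)
    have h2 := intervalIntegral.integral_comp_add_right (a := 0) (b := r)
      (fun s => g s (Z s)) h
    rw [zero_add] at h2
    rw [h2, ← h1]; abel
  have hZc : ContinuousOn (fun r => Z (r + h)) (Ici 0) :=
    hZ.1.comp (by fun_prop) fun r hr => add_nonneg hr hh
  have hd : ContinuousOn (fun r => ‖Z' r - Z (r + h)‖) (Icc 0 S) :=
    ((hZ'.1.sub hZc).norm).mono Icc_subset_Ici_self
  have key := le_mul_exp_of_le_add_integral hL hd (K := C * h) (fun r hr => by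
    have hi : IntervalIntegrable (fun s => g (s + h) (Z (s + h))) volume 0 r := by
      have := (hZ.intervalIntegrable hh (add_nonneg hr.1 hh)).comp_add_right h
      simpa using this
    have hi' : IntervalIntegrable (fun s => g' s (Z' s)) volume 0 r :=
      hZ'.intervalIntegrable le_rfl hr.1
    have e1 : Z' r - Z (r + h) = (Z 0 - Z h) +
        ∫ s in (0 : ℝ)..r, (g' s (Z' s) - g (s + h) (Z (s + h))) := by
      rw [intervalIntegral.integral_sub hi' hi, hshift r hr.1, (hZ'.2 r hr.1).2, hZ.apply_zero]
      abel
    rw [e1]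
    refine (norm_add_le _ _).trans (add_le_add ?_ ?_)
    · have := hZ.norm_sub_le hC hh le_rfl
      rwa [zero_sub, abs_neg, abs_of_nonneg hh] at this
    · rw [← intervalIntegral.integral_const_mul]
      refine intervalIntegral.norm_integral_le_of_norm_le hr.1 (ae_of_all _ fun s hs => ?_) ?_
      · rw [hg' s hs.1.le]
        exact hgL _ _ _
      · refine ContinuousOn.intervalIntegrable ?_
        rw [uIcc_of_le hr.1]
        exact (hd.mono (Icc_subset_Icc_right hr.2)).const_mul L) t ht
  have hCh : 0 ≤ C * h := mul_nonneg ((norm_nonneg _).trans (hC 0 0)) hh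
  have h2 := hZ.norm_sub_le hC ht.1 (add_nonneg ht.1 hh)
  rw [add_sub_cancel_left, abs_of_nonneg hh] at h2
  calc ‖Z' t - Z t‖ = ‖(Z' t - Z (t + h)) + (Z (t + h) - Z t)‖ := by congr 1; abel
    _ ≤ ‖Z' t - Z (t + h)‖ + ‖Z (t + h) - Z t‖ := norm_add_le _ _
    _ ≤ C * h * Real.exp (L * t) + C * h := add_le_add key h2
    _ ≤ C * h * Real.exp (L * S) + C * h := by gcongr; exact ht.2
    _ = _ := by ring

end ODEEstimates

section Taylor

variable {E F : Type*} [NormedAddCommGroup E] [NormedSpace ℝ E] [NormedAddCommGroup F]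
  [NormedSpace ℝ F]

theorem norm_sub_le_of_fderiv_le {G : E → F} {C : ℝ} (hG : Differentiable ℝ G)
    (hC : ∀ x, ‖fderiv ℝ G x‖ ≤ C) (x y : E) : ‖G y - G x‖ ≤ C * ‖y - x‖ :=
  convex_univ.norm_image_sub_le_of_norm_fderiv_le (fun z _ => hG z) (fun z _ => hC z)
    (mem_univ x) (mem_univ y)

theorem norm_sub_sub_fderiv_le {G : E → F} {C : ℝ} (hG : Differentiable ℝ G)
    (hG' : Differentiable ℝ (fderiv ℝ G)) (hC : ∀ x, ‖fderiv ℝ (fderiv ℝ G) x‖ ≤ C) (x y : E) :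
    ‖G y - G x - fderiv ℝ G x (y - x)‖ ≤ C * ‖y - x‖ ^ 2 := by
  have hC0 : 0 ≤ C := (norm_nonneg (fderiv ℝ (fderiv ℝ G) x)).trans (hC x)
  have h := (convex_closedBall x ‖y - x‖).norm_image_sub_le_of_norm_hasFDerivWithin_le'
    (f := G) (f' := fderiv ℝ G) (φ := fderiv ℝ G x) (C := C * ‖y - x‖)
    (fun z _ => (hG z).hasFDerivAt.hasFDerivWithinAt)
    (fun z hz => (norm_sub_le_of_fderiv_le hG' hC x z).trans
      (mul_le_mul_of_nonneg_left (mem_closedBall_iff_norm.1 hz) hC0))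
    (Metric.mem_closedBall_self (norm_nonneg _)) (mem_closedBall_iff_norm.2 le_rfl)
  rw [pow_two, ← mul_assoc]
  exact h

end Taylor

/-! ### Summation by parts against a slowly varying sequence -/

section Abel

variable {E F : Type*} [NormedAddCommGroup E] [NormedSpace ℝ E] [NormedAddCommGroup F]
  [NormedSpace ℝ F]

theorem sum_sub_apply_by_parts (R : ℕ → E →L[ℝ] F) (e : ℕ → E) (n : ℕ) :
    ∑ k ∈ Finset.range n, (R (k + 1) - R k) (e k) =
      R n (e n) - R 0 (e 0) - ∑ k ∈ Finset.range n, R (k + 1) (e (k + 1) - e k) := by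
  induction n with
  | zero => simp
  | succ n ih =>
    rw [Finset.sum_range_succ, ih, Finset.sum_range_succ]
    simp only [sub_apply, map_sub]
    abel

/-- If `e` is small, both `e` and `G` are slowly varying, the sum `∑ (G_{k+1} - G_k) e_k` is small.
The sequence `G` is compared with its moving average over `m` terms: the average varies slowly
enough for a term by term estimate, the difference is small and is treated by summation by parts. -/
theorem norm_sum_sub_apply_le {G : ℕ → E →L[ℝ] F} {e : ℕ → E} {n m : ℕ} (hm : 0 < m)
    {η Θ κ : ℝ} (hG : ∀ k l, k ≤ n → l ≤ m → ‖G (k + l) - G k‖ ≤ η)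
    (he : ∀ k ≤ n, ‖e k‖ ≤ Θ) (he' : ∀ k < n, ‖e (k + 1) - e k‖ ≤ κ) :
    ‖∑ k ∈ Finset.range n, (G (k + 1) - G k) (e k)‖ ≤ η * (2 * Θ + n * κ) + n / m * η * Θ := by
  have hm' : (0 : ℝ) < m := by exact_mod_cast hm
  have hη : 0 ≤ η := (norm_nonneg _).trans (hG 0 0 (Nat.zero_le _) (Nat.zero_le _))
  have hΘ : 0 ≤ Θ := (norm_nonneg _).trans (he 0 (Nat.zero_le _))
  set H : ℕ → E →L[ℝ] F := fun k => (m : ℝ)⁻¹ • ∑ j ∈ Finset.range m, G (k + j) with hH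
  have hHd : ∀ k < n, ‖H (k + 1) - H k‖ ≤ η / m := by
    intro k hk
    have h1 : ∑ j ∈ Finset.range m, G (k + 1 + j) - ∑ j ∈ Finset.range m, G (k + j) =
        G (k + m) - G k := by
      have := Finset.sum_range_succ' (fun j => G (k + j)) m
      rw [Finset.sum_range_succ] at this
      simp only [add_zero] at this
      have h2 : ∀ j, G (k + 1 + j) = G (k + (j + 1)) := fun j => by congr 1; ring
      simp only [h2]
      rw [eq_sub_of_add_eq this.symm]; abel
    rw [hH, ← smul_sub, h1, norm_smul, norm_inv, Real.norm_of_nonneg hm'.le, inv_mul_eq_div]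
    gcongr
    exact hG k m hk.le le_rfl
  have hR : ∀ k ≤ n, ‖(G - H) k‖ ≤ η := by
    intro k hk
    have h1 : (G - H) k = (m : ℝ)⁻¹ • ∑ j ∈ Finset.range m, (G k - G (k + j)) := by
      simp only [Pi.sub_apply, hH, Finset.sum_sub_distrib, Finset.sum_const, Finset.card_range,
        smul_sub]
      rw [← Nat.cast_smul_eq_nsmul ℝ, smul_smul, inv_mul_cancel₀ hm'.ne', one_smul]
    rw [h1, norm_smul, norm_inv, Real.norm_of_nonneg hm'.le]
    have h2 : ‖∑ j ∈ Finset.range m, (G k - G (k + j))‖ ≤ m * η := by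
      refine (norm_sum_le_of_le _ fun j hj => ?_).trans (b := ∑ _j ∈ Finset.range m, η) ?_
      · rw [norm_sub_rev]
        exact hG k j hk (Finset.mem_range.1 hj).le
      · simp
    calc (m : ℝ)⁻¹ * ‖∑ j ∈ Finset.range m, (G k - G (k + j))‖ ≤ (m : ℝ)⁻¹ * (m * η) := by gcongr
      _ = η := by field_simp
  have hsplit : ∑ k ∈ Finset.range n, (G (k + 1) - G k) (e k) =
      ∑ k ∈ Finset.range n, (H (k + 1) - H k) (e k) +
        ∑ k ∈ Finset.range n, ((G - H) (k + 1) - (G - H) k) (e k) := by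
    rw [← Finset.sum_add_distrib]
    refine Finset.sum_congr rfl fun k _ => ?_
    simp only [Pi.sub_apply, sub_apply]
    abel
  have b1 : ‖∑ k ∈ Finset.range n, (H (k + 1) - H k) (e k)‖ ≤ n / m * η * Θ := by
    refine (norm_sum_le_of_le _ fun k hk => ?_).trans (b := ∑ _k ∈ Finset.range n, η / m * Θ) ?_
    · have hk' := Finset.mem_range.1 hk
      exact (ContinuousLinearMap.le_opNorm _ _).trans
        (mul_le_mul (hHd k hk') (he k hk'.le) (norm_nonneg _) (by positivity))
    · simp only [Finset.sum_const, Finset.card_range, nsmul_eq_mul]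
      apply le_of_eq; ring
  have b2 : ‖∑ k ∈ Finset.range n, (G - H) (k + 1) (e (k + 1) - e k)‖ ≤ n * (η * κ) := by
    refine (norm_sum_le_of_le _ fun k hk => ?_).trans (b := ∑ _k ∈ Finset.range n, η * κ) ?_
    · have hk' := Finset.mem_range.1 hk
      exact (ContinuousLinearMap.le_opNorm _ _).trans
        (mul_le_mul (hR (k + 1) hk') (he' k hk') (norm_nonneg _) hη)
    · simp
  have b3 : ∀ k ≤ n, ‖(G - H) k (e k)‖ ≤ η * Θ := fun k hk =>
    (ContinuousLinearMap.le_opNorm _ _).trans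
      (mul_le_mul (hR k hk) (he k hk) (norm_nonneg _) hη)
  rw [hsplit, sum_sub_apply_by_parts (G - H)]
  have := norm_sub_le ((G - H) n (e n)) ((G - H) 0 (e 0))
  have h4 := norm_sub_le ((G - H) n (e n) - (G - H) 0 (e 0))
    (∑ k ∈ Finset.range n, (G - H) (k + 1) (e (k + 1) - e k))
  refine (norm_add_le _ _).trans ?_
  linarith [b3 n le_rfl, b3 0 (Nat.zero_le _)]

end Abel

/-! ### Integrals of functions that are piecewise continuous along the integers -/

section Floor

variable {F : Type*} [NormedAddCommGroup F] [NormedSpace ℝ F]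

omit [NormedAddCommGroup F] [NormedSpace ℝ F] in
theorem floor_eqOn_uIoo (H : ℕ → ℝ → F) (k : ℕ) :
    EqOn (fun s => H ⌊s⌋₊ s) (H k) (uIoo (k : ℝ) (k + 1)) := by
  intro s hs
  rw [uIoo_of_le (by linarith)] at hs
  have : ⌊s⌋₊ = k := by
    rw [Nat.floor_eq_iff ((Nat.cast_nonneg k).trans hs.1.le)]
    exact ⟨hs.1.le, hs.2⟩
  simp only [this]

omit [NormedSpace ℝ F] in
theorem intervalIntegrable_floor {H : ℕ → ℝ → F}
    (hH : ∀ k : ℕ, ContinuousOn (H k) (Icc k (k + 1))) (n : ℕ) :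
    IntervalIntegrable (fun s => H ⌊s⌋₊ s) volume 0 n := by
  have h1 : ∀ k : ℕ, IntervalIntegrable (fun s => H ⌊s⌋₊ s) volume k (k + 1 : ℕ) := by
    intro k
    push_cast
    refine IntervalIntegrable.congr_uIoo (f := H k) ?_ (floor_eqOn_uIoo H k).symm
    refine ContinuousOn.intervalIntegrable ?_
    rw [uIcc_of_le (by linarith)]
    exact hH k
  have := IntervalIntegrable.trans_iterate (a := fun k : ℕ => (k : ℝ)) (n := n) fun k _ => h1 k
  simpa using this

theorem integral_floor_succ {H : ℕ → ℝ → F}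
    (hH : ∀ k : ℕ, ContinuousOn (H k) (Icc k (k + 1))) (n : ℕ) :
    ∫ s in (0 : ℝ)..(n + 1 : ℕ), H ⌊s⌋₊ s =
      (∫ s in (0 : ℝ)..n, H ⌊s⌋₊ s) + ∫ s in (n : ℝ)..(n + 1), H n s := by
  have h1 := intervalIntegrable_floor hH n
  have h2 := intervalIntegrable_floor hH (n + 1)
  rw [← intervalIntegral.integral_add_adjacent_intervals h1 (h1.symm.trans h2)]
  congr 1
  push_cast
  exact intervalIntegral.integral_congr_uIoo (floor_eqOn_uIoo H n)

variable [CompleteSpace F]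

theorem norm_integral_sub_smul_le {h : ℝ → F} {a b κ : ℝ} (hab : a ≤ b) (c : F)
    (hi : IntervalIntegrable h volume a b) (hκ : ∀ s ∈ Ioc a b, ‖h s - c‖ ≤ κ) :
    ‖(∫ s in a..b, h s) - (b - a) • c‖ ≤ κ * (b - a) := by
  have h1 : (∫ s in a..b, h s) - (b - a) • c = ∫ s in a..b, (h s - c) := by
    rw [intervalIntegral.integral_sub hi intervalIntegrable_const, intervalIntegral.integral_const]
  rw [h1]
  have := intervalIntegral.norm_integral_le_of_norm_le_const (f := fun s => h s - c) (C := κ)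
    (a := a) (b := b) (by rwa [uIoc_of_le hab])
  rwa [abs_of_nonneg (sub_nonneg.2 hab)] at this

theorem norm_integral_floor_succ_sub_le {H : ℕ → ℝ → F} {κ : ℝ}
    (hH : ∀ k : ℕ, ContinuousOn (H k) (Icc k (k + 1)))
    (hκ : ∀ k : ℕ, ∀ s ∈ Icc (k : ℝ) (k + 1), ‖H k s - H k k‖ ≤ κ) (n : ℕ) :
    ‖(∫ s in (0 : ℝ)..(n + 1 : ℕ), H ⌊s⌋₊ s) - (∫ s in (0 : ℝ)..n, H ⌊s⌋₊ s) - H n n‖ ≤ κ := by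
  rw [integral_floor_succ hH, add_sub_cancel_left]
  have hi : IntervalIntegrable (H n) volume n (n + 1) := by
    refine ContinuousOn.intervalIntegrable ?_
    rw [uIcc_of_le (by linarith)]
    exact hH n
  have := norm_integral_sub_smul_le (by linarith) (H n n) hi
    fun s hs => hκ n s (Ioc_subset_Icc_self hs)
  simpa using this

theorem norm_integral_floor_sub_sum_le {H : ℕ → ℝ → F} {κ : ℝ}
    (hH : ∀ k : ℕ, ContinuousOn (H k) (Icc k (k + 1)))
    (hκ : ∀ k : ℕ, ∀ s ∈ Icc (k : ℝ) (k + 1), ‖H k s - H k k‖ ≤ κ) (n : ℕ) :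
    ‖(∫ s in (0 : ℝ)..n, H ⌊s⌋₊ s) - ∑ k ∈ Finset.range n, H k k‖ ≤ n * κ := by
  have h0 : (∫ s in (0 : ℝ)..n, H ⌊s⌋₊ s) = ∑ k ∈ Finset.range n,
      ((∫ s in (0 : ℝ)..(k + 1 : ℕ), H ⌊s⌋₊ s) - ∫ s in (0 : ℝ)..k, H ⌊s⌋₊ s) := by
    rw [Finset.sum_range_sub (fun k : ℕ => ∫ s in (0 : ℝ)..k, H ⌊s⌋₊ s)]
    simp
  rw [h0, ← Finset.sum_sub_distrib]
  refine (norm_sum_le_of_le _ fun k _ => norm_integral_floor_succ_sub_le hH hκ k).trans ?_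
  simp

end Floor

/-- A discrete Grönwall inequality on an initial segment. -/
theorem le_mul_exp_of_le_add_sum {e : ℕ → ℝ} {Θ κ : ℝ} {N : ℕ} (hΘ : 0 ≤ Θ) (hκ : 0 ≤ κ)
    (h : ∀ n ≤ N, e n ≤ Θ + κ * ∑ k ∈ Finset.range n, e k) {n : ℕ} (hn : n ≤ N) :
    e n ≤ Θ * Real.exp (κ * n) := by
  have key : ∀ n ≤ N, Θ + κ * ∑ k ∈ Finset.range n, e k ≤ Θ * Real.exp (κ * n) := by
    intro n
    induction n with
    | zero => simp
    | succ n ih =>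
      intro hn
      have h1 := ih (by omega)
      have h2 := h n (by omega)
      rw [Finset.sum_range_succ]
      have h3 : κ + 1 ≤ Real.exp κ := Real.add_one_le_exp κ
      calc Θ + κ * (∑ k ∈ Finset.range n, e k + e n)
          = (Θ + κ * ∑ k ∈ Finset.range n, e k) + κ * e n := by ring
        _ ≤ Θ * Real.exp (κ * n) + κ * (Θ * Real.exp (κ * n)) :=
            add_le_add h1 (mul_le_mul_of_nonneg_left (h2.trans h1) hκ)
        _ = (κ + 1) * (Θ * Real.exp (κ * n)) := by ring
        _ ≤ Real.exp κ * (Θ * Real.exp (κ * n)) := by gcongr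
        _ = Θ * Real.exp (κ * (n + 1 : ℕ)) := by
            rw [mul_left_comm, ← Real.exp_add]; push_cast; ring_nf
  exact (h n hn).trans (key n hn)

/-! ### One passage through the suspension -/

/-- The data of the averaging problem along one orbit of the base map. The orbit passes through the
suspension during the successive time intervals `[t_k, t_{k+1})`, `t_k = ∑_{j < k} r_j`; the fast
field `φ` integrates to `F k` over the `k`-th passage; `X` and `W` solve the perturbed and the
averaged equation at scale `ε`. All the bounds are expressed by a single constant `C ≥ 1`. -/
structure PassageSystem {E : Type*} [NormedAddCommGroup E] [NormedSpace ℝ E] (C ε τbar : ℝ) (x : E)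
    (φ : ℝ → E → E) (fb : E → E) (r : ℕ → ℝ) (F : ℕ → E → E) (W X : ℝ → E) : Prop where
  one_le : 1 ≤ C
  eps_pos : 0 < ε
  le_roof : ∀ k, C⁻¹ ≤ r k
  roof_le : ∀ k, r k ≤ C
  le_bar : C⁻¹ ≤ τbar
  bar_le : τbar ≤ C
  field_integrable : ∀ y a b, IntervalIntegrable (fun u => φ u y) volume a b
  field_le : ∀ u y, ‖φ u y‖ ≤ C
  field_lip : ∀ u y z, ‖φ u y - φ u z‖ ≤ C * ‖y - z‖
  mean_le : ∀ y, ‖fb y‖ ≤ C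
  mean_lip : ∀ y z, ‖fb y - fb z‖ ≤ C * ‖y - z‖
  passage_eq : ∀ k y, F k y =
    ∫ u in (∑ j ∈ Finset.range k, r j)..(∑ j ∈ Finset.range (k + 1), r j), φ u y
  passage_lip : ∀ k y z, ‖F k y - F k z‖ ≤ C * ‖y - z‖
  sol_mean : IsSolution (fun _ y => fb y) x W
  sol : IsSolution (fun t y => φ (t / ε) y + fb y) x X

namespace PassageSystem

variable {E : Type*} [NormedAddCommGroup E] [NormedSpace ℝ E] {C ε τbar : ℝ} {x : E}
  {φ : ℝ → E → E} {fb : E → E} {r : ℕ → ℝ} {F : ℕ → E → E} {W X : ℝ → E}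

theorem const_pos (h : PassageSystem C ε τbar x φ fb r F W X) : 0 < C :=
  zero_lt_one.trans_le h.one_le

theorem roof_pos (h : PassageSystem C ε τbar x φ fb r F W X) (k : ℕ) : 0 < r k :=
  (inv_pos.2 h.const_pos).trans_le (h.le_roof k)

theorem bar_pos (h : PassageSystem C ε τbar x φ fb r F W X) : 0 < τbar :=
  (inv_pos.2 h.const_pos).trans_le h.le_bar

theorem time_nonneg (h : PassageSystem C ε τbar x φ fb r F W X) (k : ℕ) :
    0 ≤ ∑ j ∈ Finset.range k, r j := Finset.sum_nonneg fun j _ => (h.roof_pos j).le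

theorem norm_X_sub_le (h : PassageSystem C ε τbar x φ fb r F W X) {s t : ℝ} (hs : 0 ≤ s)
    (ht : 0 ≤ t) : ‖X t - X s‖ ≤ 2 * C * |t - s| :=
  h.sol.norm_sub_le (fun t y => (norm_add_le _ _).trans (by
    linarith [h.field_le (t / ε) y, h.mean_le y])) hs ht

theorem norm_W_sub_le (h : PassageSystem C ε τbar x φ fb r F W X) {s t : ℝ} (hs : 0 ≤ s)
    (ht : 0 ≤ t) : ‖W t - W s‖ ≤ C * |t - s| :=
  h.sol_mean.norm_sub_le (fun _ y => h.mean_le y) hs ht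

theorem continuous_mean (h : PassageSystem C ε τbar x φ fb r F W X) : Continuous fb :=
  (LipschitzWith.of_dist_le_mul (K := ⟨C, h.const_pos.le⟩) fun y z => by
    rw [dist_eq_norm, dist_eq_norm]; exact h.mean_lip y z).continuous

theorem integrable_mean_X (h : PassageSystem C ε τbar x φ fb r F W X) {s t : ℝ} (hs : 0 ≤ s)
    (ht : 0 ≤ t) : IntervalIntegrable (fun u => fb (X u)) volume s t := by
  refine ContinuousOn.intervalIntegrable ?_
  refine h.continuous_mean.comp_continuousOn (h.sol.1.mono fun u hu => ?_)
  exact (le_min hs ht).trans hu.1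

theorem integrable_field_X (h : PassageSystem C ε τbar x φ fb r F W X) {s t : ℝ} (hs : 0 ≤ s)
    (ht : 0 ≤ t) : IntervalIntegrable (fun u => φ (u / ε) (X u)) volume s t := by
  have := (h.sol.intervalIntegrable hs ht).sub (h.integrable_mean_X hs ht)
  refine this.congr fun u _ => ?_
  simp

theorem integrable_field_scaled (h : PassageSystem C ε τbar x φ fb r F W X) (y : E) (s t : ℝ) :
    IntervalIntegrable (fun u => φ (u / ε) y) volume s t := by
  have h1 := (h.field_integrable y (s / ε) (t / ε)).comp_mul_right (c := ε⁻¹)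
  have hε := h.eps_pos.ne'
  simp only [← div_eq_mul_inv] at h1
  have e : ∀ s : ℝ, s / ε / ε⁻¹ = s := fun s => by field_simp
  rwa [e, e] at h1

variable [CompleteSpace E]

omit [CompleteSpace E] in
/-- During one passage the slow variable can be frozen in the fast field. -/
theorem norm_integral_field_sub_le (h : PassageSystem C ε τbar x φ fb r F W X) (k : ℕ) :
    ‖(∫ s in (ε * ∑ j ∈ Finset.range k, r j)..(ε * ∑ j ∈ Finset.range (k + 1), r j),
      φ (s / ε) (X s)) - ε • F k (X (ε * ∑ j ∈ Finset.range k, r j))‖ ≤ 2 * C ^ 4 * ε ^ 2 := by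
  set a := ε * ∑ j ∈ Finset.range k, r j with ha
  set b := ε * ∑ j ∈ Finset.range (k + 1), r j with hb
  have hε := h.eps_pos
  have hC := h.const_pos
  have ha0 : 0 ≤ a := mul_nonneg hε.le (h.time_nonneg k)
  have hba : b - a = ε * r k := by rw [hb, ha, Finset.sum_range_succ]; ring
  have hab : a ≤ b := by
    have := mul_nonneg hε.le (h.roof_pos k).le
    linarith
  have hba' : b - a ≤ ε * C := hba ▸ mul_le_mul_of_nonneg_left (h.roof_le k) hε.le
  have h1 : ε • F k (X a) = ∫ s in a..b, φ (s / ε) (X a) := by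
    rw [h.passage_eq]
    have := intervalIntegral.integral_comp_div (a := a) (b := b) (fun u => φ u (X a)) hε.ne'
    rw [this, ha, hb, mul_div_cancel_left₀ _ hε.ne', mul_div_cancel_left₀ _ hε.ne']
  rw [h1, ← intervalIntegral.integral_sub (h.integrable_field_X ha0 (ha0.trans hab))
    (h.integrable_field_scaled _ _ _)]
  have h2 := intervalIntegral.norm_integral_le_of_norm_le_const (a := a) (b := b)
    (f := fun s => φ (s / ε) (X s) - φ (s / ε) (X a)) (C := C * (2 * C * (ε * C))) (fun s hs => by
      rw [uIoc_of_le hab] at hs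
      refine (h.field_lip _ _ _).trans (mul_le_mul_of_nonneg_left ?_ hC.le)
      refine (h.norm_X_sub_le ha0 (ha0.trans hs.1.le)).trans ?_
      rw [abs_of_pos (sub_pos.2 hs.1)]
      gcongr
      linarith [hs.2])
  rw [abs_of_nonneg (sub_nonneg.2 hab)] at h2
  refine h2.trans ?_
  calc C * (2 * C * (ε * C)) * (b - a) ≤ C * (2 * C * (ε * C)) * (ε * C) := by gcongr
    _ = _ := by ring

theorem norm_integral_mean_sub_le (h : PassageSystem C ε τbar x φ fb r F W X) (k : ℕ) :
    ‖(∫ s in (ε * ∑ j ∈ Finset.range k, r j)..(ε * ∑ j ∈ Finset.range (k + 1), r j),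
      fb (X s)) - (ε * r k) • fb (X (ε * ∑ j ∈ Finset.range k, r j))‖ ≤ 2 * C ^ 4 * ε ^ 2 := by
  set a := ε * ∑ j ∈ Finset.range k, r j with ha
  set b := ε * ∑ j ∈ Finset.range (k + 1), r j with hb
  have hε := h.eps_pos
  have hC := h.const_pos
  have ha0 : 0 ≤ a := mul_nonneg hε.le (h.time_nonneg k)
  have hba : b - a = ε * r k := by rw [hb, ha, Finset.sum_range_succ]; ring
  have hab : a ≤ b := by
    have := mul_nonneg hε.le (h.roof_pos k).le
    linarith
  have hba' : b - a ≤ ε * C := hba ▸ mul_le_mul_of_nonneg_left (h.roof_le k) hε.le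
  rw [← hba]
  refine (norm_integral_sub_smul_le hab (fb (X a)) (h.integrable_mean_X ha0 (ha0.trans hab))
    (κ := C * (2 * C * (ε * C))) fun s hs => ?_).trans ?_
  · refine (h.mean_lip _ _).trans (mul_le_mul_of_nonneg_left ?_ hC.le)
    refine (h.norm_X_sub_le ha0 (ha0.trans hs.1.le)).trans ?_
    rw [abs_of_pos (sub_pos.2 hs.1)]
    gcongr
    linarith [hs.2]
  · calc C * (2 * C * (ε * C)) * (b - a) ≤ C * (2 * C * (ε * C)) * (ε * C) := by gcongr
      _ = _ := by ring

theorem norm_W_step_le (h : PassageSystem C ε τbar x φ fb r F W X) (k : ℕ) :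
    ‖W (τbar * (ε * (k + 1 : ℕ))) - W (τbar * (ε * k)) - (ε * τbar) • fb (W (τbar * (ε * k)))‖ ≤
      C ^ 4 * ε ^ 2 := by
  set a := τbar * (ε * (k : ℝ)) with ha
  set b := τbar * (ε * ((k + 1 : ℕ) : ℝ)) with hb
  have hε := h.eps_pos
  have hC := h.const_pos
  have hbar := h.bar_pos
  have ha0 : 0 ≤ a := by positivity
  have hba : b - a = ε * τbar := by rw [hb, ha]; push_cast; ring
  have hab : a ≤ b := by
    have : 0 ≤ ε * τbar := by positivity
    linarith
  have hba' : b - a ≤ ε * C := hba ▸ mul_le_mul_of_nonneg_left h.bar_le hε.le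
  rw [h.sol_mean.sub_eq_integral ha0 (ha0.trans hab), ← hba]
  refine (norm_integral_sub_smul_le hab (fb (W a)) (h.sol_mean.intervalIntegrable ha0
    (ha0.trans hab)) (κ := C * (C * (ε * C))) fun s hs => ?_).trans ?_
  · refine (h.mean_lip _ _).trans (mul_le_mul_of_nonneg_left ?_ hC.le)
    refine (h.norm_W_sub_le ha0 (ha0.trans hs.1.le)).trans ?_
    rw [abs_of_pos (sub_pos.2 hs.1)]
    gcongr
    linarith [hs.2]
  · calc C * (C * (ε * C)) * (b - a) ≤ C * (C * (ε * C)) * (ε * C) := by gcongr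
      _ = _ := by ring

/-- The difference `e_k = X(ε t_k) - W(ε τbar k)` at the beginning of the `k`-th passage, bounded
in terms of the fluctuations along the averaged trajectory. -/
theorem norm_error_le (h : PassageSystem C ε τbar x φ fb r F W X) {N : ℕ} {A B : ℝ}
    (hA : ∀ n ≤ N, ‖∑ k ∈ Finset.range n, ε • F k (W (τbar * (ε * k)))‖ ≤ A)
    (hB : ∀ n ≤ N, ‖∑ k ∈ Finset.range n, (ε * (r k - τbar)) • fb (W (τbar * (ε * k)))‖ ≤ B)
    {n : ℕ} (hn : n ≤ N) :
    ‖X (ε * ∑ j ∈ Finset.range n, r j) - W (τbar * (ε * n))‖ ≤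
      (A + B + 5 * C ^ 4 * ε * (ε * N)) * Real.exp (2 * C ^ 2 * (ε * N)) := by
  have hε := h.eps_pos
  have hC := h.const_pos
  have hA0 : 0 ≤ A := (norm_nonneg _).trans (hA 0 (Nat.zero_le _))
  have hB0 : 0 ≤ B := (norm_nonneg _).trans (hB 0 (Nat.zero_le _))
  set xk : ℕ → E := fun k => X (ε * ∑ j ∈ Finset.range k, r j) with hx
  set wk : ℕ → E := fun k => W (τbar * (ε * k)) with hw
  -- `q k` is the part of the step controlled by the previous error, `err k` is the `O(ε²)` remainder
  set q : ℕ → E := fun k => ε • (F k (xk k) - F k (wk k)) + (ε * r k) • (fb (xk k) - fb (wk k))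
    with hq
  set err : ℕ → E := fun k => (xk (k + 1) - wk (k + 1)) - (xk k - wk k) - q k - ε • F k (wk k) -
    (ε * (r k - τbar)) • fb (wk k) with herr
  have hqle : ∀ k, ‖q k‖ ≤ 2 * C ^ 2 * ε * ‖xk k - wk k‖ := by
    intro k
    have h1 : ‖ε • (F k (xk k) - F k (wk k))‖ ≤ ε * (C * ‖xk k - wk k‖) := by
      rw [norm_smul, Real.norm_of_nonneg hε.le]
      exact mul_le_mul_of_nonneg_left (h.passage_lip k _ _) hε.le
    have h2 : ‖(ε * r k) • (fb (xk k) - fb (wk k))‖ ≤ ε * C * (C * ‖xk k - wk k‖) := by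
      rw [norm_smul, Real.norm_of_nonneg (mul_nonneg hε.le (h.roof_pos k).le)]
      exact mul_le_mul (mul_le_mul_of_nonneg_left (h.roof_le k) hε.le) (h.mean_lip _ _)
        (norm_nonneg _) (by positivity)
    refine (norm_add_le _ _).trans ((add_le_add h1 h2).trans ?_)
    have h3 : ε * (C * ‖xk k - wk k‖) ≤ ε * (C * C * ‖xk k - wk k‖) := by
      gcongr
      exact le_mul_of_one_le_left hC.le h.one_le
    linarith
  have herrle : ∀ k, ‖err k‖ ≤ 5 * C ^ 4 * ε ^ 2 := by
    intro k
    have h1 := h.norm_integral_field_sub_le k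
    have h2 := h.norm_integral_mean_sub_le k
    have h3 := h.norm_W_step_le k
    have ha0 : ∀ k, 0 ≤ ε * ∑ j ∈ Finset.range k, r j := fun k => mul_nonneg hε.le (h.time_nonneg k)
    have h4 := h.sol.sub_eq_integral (ha0 k) (ha0 (k + 1))
    rw [intervalIntegral.integral_add (h.integrable_field_X (ha0 k) (ha0 (k + 1)))
      (h.integrable_mean_X (ha0 k) (ha0 (k + 1)))] at h4
    have h5 : err k = ((∫ s in (ε * ∑ j ∈ Finset.range k, r j)..
        (ε * ∑ j ∈ Finset.range (k + 1), r j), φ (s / ε) (X s)) - ε • F k (xk k)) +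
        ((∫ s in (ε * ∑ j ∈ Finset.range k, r j)..(ε * ∑ j ∈ Finset.range (k + 1), r j),
          fb (X s)) - (ε * r k) • fb (xk k)) -
        (wk (k + 1) - wk k - (ε * τbar) • fb (wk k)) := by
      have h6 : err k = (xk (k + 1) - xk k) - (wk (k + 1) - wk k) - q k - ε • F k (wk k) -
        (ε * (r k - τbar)) • fb (wk k) := by simp only [herr]; abel
      have h7 : xk (k + 1) - xk k = _ := h4
      rw [h6, h7, hq]
      module
    rw [h5]
    refine (norm_sub_le _ _).trans ?_
    linarith [norm_add_le ((∫ s in (ε * ∑ j ∈ Finset.range k, r j)..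
        (ε * ∑ j ∈ Finset.range (k + 1), r j), φ (s / ε) (X s)) - ε • F k (xk k))
        ((∫ s in (ε * ∑ j ∈ Finset.range k, r j)..(ε * ∑ j ∈ Finset.range (k + 1), r j),
          fb (X s)) - (ε * r k) • fb (xk k))]
  have hsum : ∀ n, xk n - wk n = ∑ k ∈ Finset.range n, q k + ∑ k ∈ Finset.range n, err k +
      ∑ k ∈ Finset.range n, ε • F k (wk k) +
      ∑ k ∈ Finset.range n, (ε * (r k - τbar)) • fb (wk k) := by
    intro n
    have h0 : xk 0 - wk 0 = 0 := by
      simp [hx, hw, h.sol.apply_zero, h.sol_mean.apply_zero]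
    have h1 := Finset.sum_range_sub (fun k => xk k - wk k) n
    simp only [h0, sub_zero] at h1
    rw [← h1, ← Finset.sum_add_distrib, ← Finset.sum_add_distrib, ← Finset.sum_add_distrib]
    refine Finset.sum_congr rfl fun k _ => ?_
    simp only [herr]
    abel
  have hgron := le_mul_exp_of_le_add_sum (e := fun n => ‖xk n - wk n‖)
    (Θ := A + B + 5 * C ^ 4 * ε * (ε * N)) (κ := 2 * C ^ 2 * ε) (N := N) (by positivity)
    (by positivity) (fun n hn => by
      have hn' : (n : ℝ) ≤ N := by exact_mod_cast hn
      have b1 : ‖∑ k ∈ Finset.range n, q k‖ ≤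
          2 * C ^ 2 * ε * ∑ k ∈ Finset.range n, ‖xk k - wk k‖ := by
        rw [Finset.mul_sum]
        exact norm_sum_le_of_le _ fun k _ => hqle k
      have b2 : ‖∑ k ∈ Finset.range n, err k‖ ≤ 5 * C ^ 4 * ε * (ε * N) := by
        refine (norm_sum_le_of_le _ fun k _ => herrle k).trans ?_
        rw [Finset.sum_const, Finset.card_range, nsmul_eq_mul]
        calc (n : ℝ) * (5 * C ^ 4 * ε ^ 2) ≤ N * (5 * C ^ 4 * ε ^ 2) := by gcongr
          _ = _ := by ring
      rw [hsum n]
      refine (norm_add_le _ _).trans ?_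
      have b3 := norm_add₃_le (a := ∑ k ∈ Finset.range n, q k) (b := ∑ k ∈ Finset.range n, err k)
        (c := ∑ k ∈ Finset.range n, ε • F k (wk k))
      linarith [hA n hn, hB n hn]) hn
  refine hgron.trans ?_
  have hn' : (n : ℝ) ≤ N := by exact_mod_cast hn
  gcongr ?_ * Real.exp ?_
  calc 2 * C ^ 2 * ε * n ≤ 2 * C ^ 2 * ε * N := by gcongr
    _ = _ := by ring

omit [CompleteSpace E] in
theorem norm_error_succ_sub_le (h : PassageSystem C ε τbar x φ fb r F W X) (k : ℕ) :
    ‖(X (ε * ∑ j ∈ Finset.range (k + 1), r j) - W (τbar * (ε * (k + 1 : ℕ)))) -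
      (X (ε * ∑ j ∈ Finset.range k, r j) - W (τbar * (ε * k)))‖ ≤ 3 * C ^ 2 * ε := by
  have hε := h.eps_pos
  have hC := h.const_pos
  have hbar := h.bar_pos
  have ha0 : ∀ k, 0 ≤ ε * ∑ j ∈ Finset.range k, r j := fun k => mul_nonneg hε.le (h.time_nonneg k)
  have h1 := h.norm_X_sub_le (ha0 k) (ha0 (k + 1))
  have h2 := h.norm_W_sub_le (s := τbar * (ε * k)) (t := τbar * (ε * (k + 1 : ℕ)))
    (by positivity) (by positivity)
  have e1 : ε * ∑ j ∈ Finset.range (k + 1), r j - ε * ∑ j ∈ Finset.range k, r j = ε * r k := by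
    rw [Finset.sum_range_succ]; ring
  have e2 : τbar * (ε * (k + 1 : ℕ)) - τbar * (ε * k) = ε * τbar := by push_cast; ring
  rw [e1, abs_of_nonneg (mul_nonneg hε.le (h.roof_pos k).le)] at h1
  rw [e2, abs_of_nonneg (by positivity)] at h2
  have h3 : ε * r k ≤ ε * C := mul_le_mul_of_nonneg_left (h.roof_le k) hε.le
  have h4 : ε * τbar ≤ ε * C := mul_le_mul_of_nonneg_left h.bar_le hε.le
  rw [sub_sub_sub_comm]
  refine (norm_sub_le _ _).trans ?_
  have h5 := mul_le_mul_of_nonneg_left h3 (by positivity : 0 ≤ 2 * C)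
  have h6 := mul_le_mul_of_nonneg_left h4 hC.le
  nlinarith

omit [CompleteSpace E] in
/-- The integral of the fast field up to a time of the `n`-th passage. -/
theorem norm_integral_field_sub_sum_le (h : PassageSystem C ε τbar x φ fb r F W X) (n : ℕ) {t : ℝ}
    (ht : t ∈ Icc (ε * ∑ j ∈ Finset.range n, r j) (ε * ∑ j ∈ Finset.range (n + 1), r j)) :
    ‖(∫ s in (0 : ℝ)..t, φ (s / ε) (X s)) -
      ∑ k ∈ Finset.range n, ε • F k (X (ε * ∑ j ∈ Finset.range k, r j))‖ ≤
      2 * C ^ 4 * ε * (ε * n) + C ^ 2 * ε := by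
  have hε := h.eps_pos
  have hC := h.const_pos
  have ha0 : ∀ k, 0 ≤ ε * ∑ j ∈ Finset.range k, r j := fun k => mul_nonneg hε.le (h.time_nonneg k)
  have h1 := intervalIntegral.sum_integral_adjacent_intervals (n := n)
    (a := fun k => ε * ∑ j ∈ Finset.range k, r j) (f := fun s => φ (s / ε) (X s)) (μ := volume)
    (fun k _ => h.integrable_field_X (ha0 k) (ha0 (k + 1)))
  simp only [Finset.range_zero, Finset.sum_empty, mul_zero] at h1
  rw [← intervalIntegral.integral_add_adjacent_intervals (h.integrable_field_X le_rfl (ha0 n))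
    (h.integrable_field_X (ha0 n) ((ha0 n).trans ht.1)), ← h1, add_sub_right_comm,
    ← Finset.sum_sub_distrib]
  refine (norm_add_le _ _).trans (add_le_add ?_ ?_)
  · refine (norm_sum_le_of_le _ fun k _ => h.norm_integral_field_sub_le k).trans (le_of_eq ?_)
    rw [Finset.sum_const, Finset.card_range, nsmul_eq_mul]; ring
  · have h2 := intervalIntegral.norm_integral_le_of_norm_le_const
      (a := ε * ∑ j ∈ Finset.range n, r j) (b := t) (f := fun s => φ (s / ε) (X s)) (C := C)
      fun s _ => h.field_le _ _
    refine h2.trans ?_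
    rw [abs_of_nonneg (sub_nonneg.2 ht.1)]
    have h3 : t - ε * ∑ j ∈ Finset.range n, r j ≤ ε * C := by
      have := ht.2
      rw [Finset.sum_range_succ, mul_add] at this
      linarith [mul_le_mul_of_nonneg_left (h.roof_le n) hε.le]
    calc C * (t - ε * ∑ j ∈ Finset.range n, r j) ≤ C * (ε * C) := by gcongr
      _ = _ := by ring

end PassageSystem

/-! ### The fast integral and the perturbed Birkhoff sums -/

namespace PassageSystem

variable {E : Type*} [NormedAddCommGroup E] [NormedSpace ℝ E] {C ε τbar : ℝ} {x : E}
  {φ : ℝ → E → E} {fb : E → E} {r : ℕ → ℝ} {F : ℕ → E → E} {W X : ℝ → E}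

theorem continuousOn_W_scaled (h : PassageSystem C ε τbar x φ fb r F W X) (k : ℕ) :
    ContinuousOn (fun s => W (τbar * (ε * s))) (Icc (k : ℝ) (k + 1)) := by
  refine h.sol_mean.1.comp (by fun_prop) fun s hs => ?_
  exact mul_nonneg h.bar_pos.le (mul_nonneg h.eps_pos.le ((Nat.cast_nonneg k).trans hs.1))

theorem norm_W_scaled_sub_le (h : PassageSystem C ε τbar x φ fb r F W X) (k : ℕ) {s : ℝ}
    (hs : s ∈ Icc (k : ℝ) (k + 1)) :
    ‖W (τbar * (ε * s)) - W (τbar * (ε * k))‖ ≤ C ^ 2 * ε := by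
  have hε := h.eps_pos
  have hC := h.const_pos
  have hbar := h.bar_pos
  have hk : (0 : ℝ) ≤ k := Nat.cast_nonneg k
  have h1 := h.norm_W_sub_le (s := τbar * (ε * k)) (t := τbar * (ε * s)) (by positivity)
    (mul_nonneg hbar.le (mul_nonneg hε.le (hk.trans hs.1)))
  have e1 : τbar * (ε * s) - τbar * (ε * k) = τbar * (ε * (s - k)) := by ring
  rw [e1, abs_of_nonneg (mul_nonneg hbar.le (mul_nonneg hε.le (sub_nonneg.2 hs.1)))] at h1
  refine h1.trans ?_
  have h2 : ε * (s - k) ≤ ε * 1 := mul_le_mul_of_nonneg_left (by linarith [hs.2]) hε.le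
  calc C * (τbar * (ε * (s - k))) ≤ C * (C * (ε * 1)) := by
        gcongr
        · exact mul_nonneg hε.le (sub_nonneg.2 hs.1)
        · exact h.bar_le
    _ = _ := by ring

theorem abs_roof_sub_le (h : PassageSystem C ε τbar x φ fb r F W X) (k : ℕ) : |r k - τbar| ≤ C :=
  abs_le.2 ⟨by linarith [h.roof_pos k, h.bar_le], by linarith [h.roof_le k, h.bar_pos]⟩

variable [CompleteSpace E]

/-- Up to a time of the `n`-th passage, the rescaled integral of the fast field along the perturbed
solution is close to the perturbed Birkhoff sum along the averaged solution. A Taylor expansion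
around the averaged trajectory leaves a linear term, which is small because it pairs increments of
an equicontinuous process with the small and slowly varying errors at the passage times. -/
theorem norm_smul_integral_field_sub_le (h : PassageSystem C ε τbar x φ fb r F W X)
    (hF : ∀ k, Differentiable ℝ (F k)) (hF' : ∀ k, Differentiable ℝ (fderiv ℝ (F k)))
    (hF'' : ∀ k y, ‖fderiv ℝ (fderiv ℝ (F k)) y‖ ≤ C)
    {a T₀ A B η Θ : ℝ} {N m : ℕ} (ha : 0 < a) (hm : 0 < m) (hN : ε * N ≤ T₀)
    (hV : ∀ n ≤ N, ‖a • ∫ s in (0 : ℝ)..n, F ⌊s⌋₊ (W (τbar * (ε * s)))‖ ≤ A)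
    (hz : ∀ n ≤ N, ‖Real.sqrt (ε * a) • ∫ s in (0 : ℝ)..n,
      (r ⌊s⌋₊ - τbar) • fb (W (τbar * (ε * s)))‖ ≤ B)
    (hG : ∀ k l, k ≤ N → l ≤ m →
      ‖(a • ∫ s in (0 : ℝ)..(k + l : ℕ), fderiv ℝ (F ⌊s⌋₊) (W (τbar * (ε * s)))) -
        a • ∫ s in (0 : ℝ)..k, fderiv ℝ (F ⌊s⌋₊) (W (τbar * (ε * s)))‖ ≤ η)
    (hΘ : (ε / a * A + ε / Real.sqrt (ε * a) * B + 7 * C ^ 4 * ε * T₀) *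
      Real.exp (2 * C ^ 2 * T₀) ≤ Θ) {n : ℕ} (hn : n ≤ N) {t : ℝ}
    (ht : t ∈ Icc (ε * ∑ j ∈ Finset.range n, r j) (ε * ∑ j ∈ Finset.range (n + 1), r j)) :
    ‖((a / ε) • ∫ s in (0 : ℝ)..t, φ (s / ε) (X s)) -
      a • ∫ s in (0 : ℝ)..n, F ⌊s⌋₊ (W (τbar * (ε * s)))‖ ≤
      a * (3 * C ^ 4 * T₀ + C ^ 2 + C ^ 3 * T₀ * Θ) + a / ε * C * T₀ * Θ ^ 2 +
        η * (2 * Θ + 3 * C ^ 2 * T₀) + T₀ / (ε * m) * η * Θ := by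
  have hε := h.eps_pos
  have hC := h.const_pos
  have hC1 := h.one_le
  have hm' : (0 : ℝ) < m := by exact_mod_cast hm
  have hsq : 0 < Real.sqrt (ε * a) := Real.sqrt_pos.2 (mul_pos hε ha)
  have hη : 0 ≤ η := (norm_nonneg _).trans (hG 0 0 (Nat.zero_le _) (Nat.zero_le _))
  have hn' : (n : ℝ) ≤ N := by exact_mod_cast hn
  have hεn : ε * n ≤ T₀ := (mul_le_mul_of_nonneg_left hn' hε.le).trans hN
  have hT₀ : 0 ≤ T₀ := le_trans (by positivity) hεn
  set w : ℕ → E := fun k => W (τbar * (ε * k)) with hw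
  set xk : ℕ → E := fun k => X (ε * ∑ j ∈ Finset.range k, r j) with hx
  -- the three floor integrals against the corresponding sums
  have hcF : ∀ k : ℕ, ContinuousOn (fun s => F k (W (τbar * (ε * s)))) (Icc k (k + 1)) := fun k =>
    (hF k).continuous.comp_continuousOn (h.continuousOn_W_scaled k)
  have hcG : ∀ k : ℕ, ContinuousOn (fun s => fderiv ℝ (F k) (W (τbar * (ε * s))))
      (Icc k (k + 1)) := fun k =>
    (hF' k).continuous.comp_continuousOn (h.continuousOn_W_scaled k)
  have hcz : ∀ k : ℕ, ContinuousOn (fun s => (r k - τbar) • fb (W (τbar * (ε * s))))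
      (Icc k (k + 1)) := fun k =>
    (h.continuous_mean.comp_continuousOn (h.continuousOn_W_scaled k)).const_smul (r k - τbar)
  have hκF : ∀ k : ℕ, ∀ s ∈ Icc (k : ℝ) (k + 1),
      ‖F k (W (τbar * (ε * s))) - F k (W (τbar * (ε * k)))‖ ≤ C ^ 3 * ε := fun k s hs => by
    refine (h.passage_lip k _ _).trans ?_
    calc C * ‖W (τbar * (ε * s)) - W (τbar * (ε * k))‖ ≤ C * (C ^ 2 * ε) := by
          gcongr
          exact h.norm_W_scaled_sub_le k hs
      _ = _ := by ring
  have hκG : ∀ k : ℕ, ∀ s ∈ Icc (k : ℝ) (k + 1),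
      ‖fderiv ℝ (F k) (W (τbar * (ε * s))) - fderiv ℝ (F k) (W (τbar * (ε * k)))‖ ≤ C ^ 3 * ε :=
    fun k s hs => by
      refine (norm_sub_le_of_fderiv_le (hF' k) (hF'' k) _ _).trans ?_
      calc C * ‖W (τbar * (ε * s)) - W (τbar * (ε * k))‖ ≤ C * (C ^ 2 * ε) := by
            gcongr
            exact h.norm_W_scaled_sub_le k hs
        _ = _ := by ring
  have hκz : ∀ k : ℕ, ∀ s ∈ Icc (k : ℝ) (k + 1),
      ‖(r k - τbar) • fb (W (τbar * (ε * s))) - (r k - τbar) • fb (W (τbar * (ε * k)))‖ ≤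
        C ^ 4 * ε := fun k s hs => by
    rw [← smul_sub, norm_smul, Real.norm_eq_abs]
    calc |r k - τbar| * ‖fb (W (τbar * (ε * s))) - fb (W (τbar * (ε * k)))‖
        ≤ C * (C * (C ^ 2 * ε)) := by
          gcongr
          · exact h.abs_roof_sub_le k
          · refine (h.mean_lip _ _).trans ?_
            gcongr
            exact h.norm_W_scaled_sub_le k hs
      _ = _ := by ring
  have hsumF : ∀ n : ℕ, ‖(∫ s in (0 : ℝ)..n, F ⌊s⌋₊ (W (τbar * (ε * s)))) -
      ∑ k ∈ Finset.range n, F k (w k)‖ ≤ n * (C ^ 3 * ε) := fun n =>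
    norm_integral_floor_sub_sum_le hcF hκF n
  have hsumz : ∀ n : ℕ, ‖(∫ s in (0 : ℝ)..n, (r ⌊s⌋₊ - τbar) • fb (W (τbar * (ε * s)))) -
      ∑ k ∈ Finset.range n, (r k - τbar) • fb (w k)‖ ≤ n * (C ^ 4 * ε) := fun n =>
    norm_integral_floor_sub_sum_le hcz hκz n
  have hpow : C ^ 3 ≤ C ^ 4 := pow_le_pow_right₀ hC1 (by norm_num)
  -- the errors at the passage times
  have hA : ∀ n ≤ N, ‖∑ k ∈ Finset.range n, ε • F k (W (τbar * (ε * k)))‖ ≤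
      ε / a * A + C ^ 4 * ε * T₀ := by
    intro n hn
    have hεn : ε * n ≤ T₀ :=
      (mul_le_mul_of_nonneg_left (by exact_mod_cast hn : (n : ℝ) ≤ N) hε.le).trans hN
    have h1 : ∑ k ∈ Finset.range n, ε • F k (W (τbar * (ε * k))) =
        (ε / a) • (a • ∫ s in (0 : ℝ)..n, F ⌊s⌋₊ (W (τbar * (ε * s)))) -
          ε • ((∫ s in (0 : ℝ)..n, F ⌊s⌋₊ (W (τbar * (ε * s)))) -
            ∑ k ∈ Finset.range n, F k (w k)) := by
      rw [smul_smul, div_mul_cancel₀ _ ha.ne', smul_sub, sub_sub_cancel, Finset.smul_sum]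
    rw [h1]
    refine (norm_sub_le _ _).trans (add_le_add ?_ ?_)
    · rw [norm_smul, Real.norm_of_nonneg (by positivity)]
      gcongr
      exact hV n hn
    · rw [norm_smul, Real.norm_of_nonneg hε.le]
      calc ε * ‖_‖ ≤ ε * (n * (C ^ 3 * ε)) := by gcongr; exact hsumF n
        _ = C ^ 3 * ε * (ε * n) := by ring
        _ ≤ C ^ 4 * ε * T₀ := by gcongr
  have hB : ∀ n ≤ N, ‖∑ k ∈ Finset.range n, (ε * (r k - τbar)) • fb (W (τbar * (ε * k)))‖ ≤
      ε / Real.sqrt (ε * a) * B + C ^ 4 * ε * T₀ := by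
    intro n hn
    have hεn : ε * n ≤ T₀ :=
      (mul_le_mul_of_nonneg_left (by exact_mod_cast hn : (n : ℝ) ≤ N) hε.le).trans hN
    have h1 : ∑ k ∈ Finset.range n, (ε * (r k - τbar)) • fb (W (τbar * (ε * k))) =
        (ε / Real.sqrt (ε * a)) • (Real.sqrt (ε * a) • ∫ s in (0 : ℝ)..n,
          (r ⌊s⌋₊ - τbar) • fb (W (τbar * (ε * s)))) -
          ε • ((∫ s in (0 : ℝ)..n, (r ⌊s⌋₊ - τbar) • fb (W (τbar * (ε * s)))) -
            ∑ k ∈ Finset.range n, (r k - τbar) • fb (w k)) := by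
      rw [smul_smul, div_mul_cancel₀ _ hsq.ne', smul_sub, sub_sub_cancel, Finset.smul_sum]
      simp only [mul_smul, hw]
    rw [h1]
    refine (norm_sub_le _ _).trans (add_le_add ?_ ?_)
    · rw [norm_smul, Real.norm_of_nonneg (by positivity)]
      gcongr
      exact hz n hn
    · rw [norm_smul, Real.norm_of_nonneg hε.le]
      calc ε * ‖_‖ ≤ ε * (n * (C ^ 4 * ε)) := by gcongr; exact hsumz n
        _ = C ^ 4 * ε * (ε * n) := by ring
        _ ≤ C ^ 4 * ε * T₀ := by gcongr
  have hA0 : 0 ≤ ε / a * A := by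
    have : 0 ≤ A := (norm_nonneg _).trans (hV 0 (Nat.zero_le _))
    positivity
  have hB0 : 0 ≤ ε / Real.sqrt (ε * a) * B := by
    have : 0 ≤ B := (norm_nonneg _).trans (hz 0 (Nat.zero_le _))
    positivity
  have hE : ∀ k ≤ N, ‖xk k - w k‖ ≤ Θ := by
    intro k hk
    refine (h.norm_error_le hA hB hk).trans (le_trans ?_ hΘ)
    have h1 : 5 * C ^ 4 * ε * (ε * N) ≤ 5 * C ^ 4 * ε * T₀ := by gcongr
    have h2 : Real.exp (2 * C ^ 2 * (ε * N)) ≤ Real.exp (2 * C ^ 2 * T₀) := by gcongr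
    refine mul_le_mul (by linarith) h2 (Real.exp_pos _).le ?_
    positivity
  have hΘ0 : 0 ≤ Θ := (norm_nonneg _).trans (hE 0 (Nat.zero_le _))
  -- the linear term
  set G : ℕ → E →L[ℝ] E := fun k =>
    a • ∫ s in (0 : ℝ)..k, fderiv ℝ (F ⌊s⌋₊) (W (τbar * (ε * s))) with hGdef
  have hlin : ‖∑ k ∈ Finset.range n, (G (k + 1) - G k) (xk k - w k)‖ ≤
      η * (2 * Θ + 3 * C ^ 2 * T₀) + T₀ / (ε * m) * η * Θ := by
    have h1 := norm_sum_sub_apply_le (G := G) (e := fun k => xk k - w k) (n := n) hm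
      (fun k l hk hl => hG k l (hk.trans hn) hl) (fun k hk => hE k (hk.trans hn))
      (fun k _ => h.norm_error_succ_sub_le k)
    refine h1.trans (add_le_add ?_ ?_)
    · gcongr η * (2 * Θ + ?_)
      calc n * (3 * C ^ 2 * ε) = 3 * C ^ 2 * (ε * n) := by ring
        _ ≤ 3 * C ^ 2 * T₀ := by gcongr
    · gcongr ?_ * η * Θ
      rw [div_le_div_iff₀ hm' (by positivity)]
      calc n * (ε * m) = (ε * n) * m := by ring
        _ ≤ T₀ * m := by gcongr
  have hlin' : ‖∑ k ∈ Finset.range n, a • fderiv ℝ (F k) (w k) (xk k - w k) -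
      ∑ k ∈ Finset.range n, (G (k + 1) - G k) (xk k - w k)‖ ≤ a * (C ^ 3 * T₀ * Θ) := by
    rw [← Finset.sum_sub_distrib]
    refine (norm_sum_le_of_le _ fun k hk => ?_).trans
      (b := ∑ _k ∈ Finset.range n, a * (C ^ 3 * ε) * Θ) ?_
    · have hk' : k ≤ N := (Finset.mem_range.1 hk).le.trans hn
      have h1 := norm_integral_floor_succ_sub_le hcG hκG k
      have h2 : a • fderiv ℝ (F k) (w k) (xk k - w k) - (G (k + 1) - G k) (xk k - w k) =
          -(a • ((∫ s in (0 : ℝ)..(k + 1 : ℕ), fderiv ℝ (F ⌊s⌋₊) (W (τbar * (ε * s)))) -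
            (∫ s in (0 : ℝ)..k, fderiv ℝ (F ⌊s⌋₊) (W (τbar * (ε * s)))) -
              fderiv ℝ (F k) (w k))) (xk k - w k) := by
        simp only [hGdef, sub_apply, smul_apply, smul_sub]
        abel
      rw [h2, norm_neg]
      refine (ContinuousLinearMap.le_opNorm _ _).trans ?_
      rw [norm_smul, Real.norm_of_nonneg ha.le]
      gcongr
      exact hE k hk'
    · rw [Finset.sum_const, Finset.card_range, nsmul_eq_mul]
      calc n * (a * (C ^ 3 * ε) * Θ) = a * (C ^ 3 * (ε * n) * Θ) := by ring
        _ ≤ _ := by gcongr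
  -- the quadratic remainder
  have hquad : ‖∑ k ∈ Finset.range n,
      a • (F k (xk k) - F k (w k) - fderiv ℝ (F k) (w k) (xk k - w k))‖ ≤
        a / ε * C * T₀ * Θ ^ 2 := by
    refine (norm_sum_le_of_le _ fun k hk => ?_).trans
      (b := ∑ _k ∈ Finset.range n, a * (C * Θ ^ 2)) ?_
    · have hk' : k ≤ N := (Finset.mem_range.1 hk).le.trans hn
      rw [norm_smul, Real.norm_of_nonneg ha.le]
      gcongr
      refine (norm_sub_sub_fderiv_le (hF k) (hF' k) (hF'' k) _ _).trans ?_
      gcongr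
      exact hE k hk'
    · rw [Finset.sum_const, Finset.card_range, nsmul_eq_mul]
      calc n * (a * (C * Θ ^ 2)) = a / ε * C * (ε * n) * Θ ^ 2 := by field_simp
        _ ≤ _ := by gcongr
  have hfirst : ‖(a / ε) • ((∫ s in (0 : ℝ)..t, φ (s / ε) (X s)) -
      ∑ k ∈ Finset.range n, ε • F k (xk k))‖ ≤ a * (2 * C ^ 4 * T₀ + C ^ 2) := by
    rw [norm_smul, Real.norm_of_nonneg (by positivity)]
    calc a / ε * ‖_‖ ≤ a / ε * (2 * C ^ 4 * ε * (ε * n) + C ^ 2 * ε) := by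
          gcongr
          exact h.norm_integral_field_sub_sum_le n ht
      _ = a * (2 * C ^ 4 * (ε * n) + C ^ 2) := by field_simp
      _ ≤ _ := by gcongr
  have hlast : ‖a • ((∫ s in (0 : ℝ)..n, F ⌊s⌋₊ (W (τbar * (ε * s)))) -
      ∑ k ∈ Finset.range n, F k (w k))‖ ≤ a * (C ^ 4 * T₀) := by
    rw [norm_smul, Real.norm_of_nonneg ha.le]
    gcongr
    refine (hsumF n).trans ?_
    calc n * (C ^ 3 * ε) = C ^ 3 * (ε * n) := by ring
      _ ≤ _ := by gcongr
  -- in this order: discretization of the fast integral, Taylor remainder, discretization of `v̇`,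
  -- linear term, discretization of `v`
  have hdecomp : ((a / ε) • ∫ s in (0 : ℝ)..t, φ (s / ε) (X s)) -
      a • (∫ s in (0 : ℝ)..n, F ⌊s⌋₊ (W (τbar * (ε * s)))) =
      (a / ε) • ((∫ s in (0 : ℝ)..t, φ (s / ε) (X s)) - ∑ k ∈ Finset.range n, ε • F k (xk k)) +
      ∑ k ∈ Finset.range n, a • (F k (xk k) - F k (w k) - fderiv ℝ (F k) (w k) (xk k - w k)) +
      (∑ k ∈ Finset.range n, a • fderiv ℝ (F k) (w k) (xk k - w k) -
        ∑ k ∈ Finset.range n, (G (k + 1) - G k) (xk k - w k)) +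
      ∑ k ∈ Finset.range n, (G (k + 1) - G k) (xk k - w k) -
      a • ((∫ s in (0 : ℝ)..n, F ⌊s⌋₊ (W (τbar * (ε * s)))) - ∑ k ∈ Finset.range n, F k (w k)) := by
    simp only [smul_sub, Finset.sum_sub_distrib, ← Finset.smul_sum, smul_smul,
      div_mul_cancel₀ _ hε.ne']
    abel
  rw [hdecomp]
  refine (norm_sub_le _ _).trans ?_
  refine (add_le_add_left (norm_add_le _ _) _).trans ?_
  refine (add_le_add_left (add_le_add_left norm_add₃_le _) _).trans ?_
  linarith

end PassageSystem

/-! ### The linear response along one orbit -/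

namespace PassageSystem

variable {E : Type*} [NormedAddCommGroup E] [NormedSpace ℝ E] [CompleteSpace E]

/-- If the rescaled fast integral is close to `V`, then the rescaled error is close to the linear
response to `V`: the error solves the linearized equation up to a quadratic term. -/
theorem norm_smul_sub_linearResponse_le {C ε τbar : ℝ} {x : E}
    {φ : ℝ → E → E} {fb : E → E} {r : ℕ → ℝ} {F : ℕ → E → E} {W X : ℝ → E}
    (h : PassageSystem C ε τbar x φ fb r F W X)
    (hfb : Differentiable ℝ fb) (hfb' : Differentiable ℝ (fderiv ℝ fb))
    (hfbC : ∀ y, ‖fderiv ℝ fb y‖ ≤ C) (hfbC' : ∀ y, ‖fderiv ℝ (fderiv ℝ fb) y‖ ≤ C)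
    {α δ A S : ℝ} (hα : 0 < α) {V : ℝ → E} (hVc : ContinuousOn V (Ici 0))
    (hV : ∀ t ∈ Icc 0 S, ‖V t‖ ≤ A)
    (hg : ∀ t ∈ Icc 0 S, ‖(α • ∫ s in (0 : ℝ)..t, φ (s / ε) (X s)) - V t‖ ≤ δ) :
    ∀ t ∈ Icc 0 S, ‖α • (X t - W t) - linearResponse (fun u => fderiv ℝ fb (W u)) V t‖ ≤
      (δ + S * (C * α⁻¹ * ((δ + A) * Real.exp (C * S)) ^ 2)) * Real.exp (C * S) := by
  intro t₀ ht₀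
  have hS : 0 ≤ S := ht₀.1.trans ht₀.2
  have hC := h.const_pos
  have hδA : 0 ≤ δ + A :=
    add_nonneg ((norm_nonneg _).trans (hg t₀ ht₀)) ((norm_nonneg _).trans (hV t₀ ht₀))
  set U : ℝ → E := fun t => α • (X t - W t) with hU
  have hUc : ContinuousOn U (Ici 0) := (h.sol.1.sub h.sol_mean.1).const_smul α
  have hAc : ContinuousOn (fun u => fderiv ℝ fb (W u)) (Ici 0) :=
    hfb'.continuous.comp_continuousOn h.sol_mean.1
  have hXm : ∀ t, 0 ≤ t → IntervalIntegrable (fun s => fb (X s)) volume 0 t := fun t ht =>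
    h.integrable_mean_X le_rfl ht
  have hWm : ∀ t, 0 ≤ t → IntervalIntegrable (fun s => fb (W s)) volume 0 t := fun t ht =>
    h.sol_mean.intervalIntegrable le_rfl ht
  have hAU : ∀ t, 0 ≤ t → IntervalIntegrable (fun s => fderiv ℝ fb (W s) (U s)) volume 0 t := by
    intro t ht
    refine ContinuousOn.intervalIntegrable ?_
    rw [uIcc_of_le ht]
    exact (hAc.clm_apply hUc).mono Icc_subset_Ici_self
  have hUeq : ∀ t, 0 ≤ t → U t = (α • ∫ s in (0 : ℝ)..t, φ (s / ε) (X s)) +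
      ∫ s in (0 : ℝ)..t, α • (fb (X s) - fb (W s)) := by
    intro t ht
    simp only [hU]
    rw [(h.sol.2 t ht).2, (h.sol_mean.2 t ht).2,
      intervalIntegral.integral_add (h.integrable_field_X le_rfl ht) (hXm t ht),
      intervalIntegral.integral_smul, intervalIntegral.integral_sub (hXm t ht) (hWm t ht)]
    module
  have hUn : ContinuousOn (fun t => ‖U t‖) (Icc 0 S) := hUc.norm.mono Icc_subset_Ici_self
  have hUle : ∀ t ∈ Icc 0 S, ‖U t‖ ≤ (δ + A) * Real.exp (C * S) := by
    intro t ht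
    have key := le_mul_exp_of_le_add_integral hC hUn (K := δ + A) (fun t ht => by
      rw [hUeq t ht.1]
      refine (norm_add_le _ _).trans (add_le_add ?_ ?_)
      · have := norm_add_le ((α • ∫ s in (0 : ℝ)..t, φ (s / ε) (X s)) - V t) (V t)
        rw [sub_add_cancel] at this
        linarith [hg t ht, hV t ht]
      · rw [← intervalIntegral.integral_const_mul]
        refine intervalIntegral.norm_integral_le_of_norm_le ht.1 (ae_of_all _ fun s _ => ?_) ?_
        · simp only [hU]
          rw [norm_smul, norm_smul]
          have := mul_le_mul_of_nonneg_left (h.mean_lip (X s) (W s)) (norm_nonneg α)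
          linarith
        · refine ContinuousOn.intervalIntegrable ?_
          rw [uIcc_of_le ht.1]
          exact (hUn.mono (Icc_subset_Icc_right ht.2)).const_mul C) t ht
    refine key.trans ?_
    gcongr
    exact ht.2
  set R := (δ + A) * Real.exp (C * S) with hR
  refine norm_sub_le_of_volterra (V₁ := fun t => U t - ∫ s in (0 : ℝ)..t, fderiv ℝ fb (W s) (U s))
    (V₂ := V) hAc hC (fun u _ => hfbC (W u)) (hUc.mono Icc_subset_Ici_self)
    ((continuousOn_linearResponse hAc hVc hC fun u _ => hfbC (W u)).mono Icc_subset_Ici_self)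
    (fun t _ => (sub_add_cancel _ _).symm)
    (fun t ht => linearResponse_eq_add_integral hAc hVc hC (fun u _ => hfbC (W u)) ht.1)
    (fun t ht => ?_) t₀ ht₀
  have hXW : ∀ t, 0 ≤ t → IntervalIntegrable (fun s => α • (fb (X s) - fb (W s))) volume 0 t :=
    fun t ht => ((hXm t ht).sub (hWm t ht)).smul α
  have e1 : U t - (∫ s in (0 : ℝ)..t, fderiv ℝ fb (W s) (U s)) - V t =
      ((α • ∫ s in (0 : ℝ)..t, φ (s / ε) (X s)) - V t) +
        ∫ s in (0 : ℝ)..t, (α • (fb (X s) - fb (W s)) - fderiv ℝ fb (W s) (U s)) := by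
    rw [intervalIntegral.integral_sub (hXW t ht.1) (hAU t ht.1), hUeq t ht.1]
    abel
  rw [e1]
  refine (norm_add_le _ _).trans (add_le_add (hg t ht) ?_)
  have h2 := intervalIntegral.norm_integral_le_of_norm_le_const (a := 0) (b := t)
    (f := fun s => α • (fb (X s) - fb (W s)) - fderiv ℝ fb (W s) (U s))
    (C := C * α⁻¹ * R ^ 2) (fun s hs => by
      rw [uIoc_of_le ht.1] at hs
      have hs' : s ∈ Icc 0 S := ⟨hs.1.le, hs.2.trans ht.2⟩
      have e2 : α • (fb (X s) - fb (W s)) - fderiv ℝ fb (W s) (U s) =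
          α • (fb (X s) - fb (W s) - fderiv ℝ fb (W s) (X s - W s)) := by
        simp only [hU]
        rw [map_smul, ← smul_sub]
      have h3 := norm_sub_sub_fderiv_le hfb hfb' hfbC' (W s) (X s)
      have h4 := hUle s hs'
      simp only [hU, norm_smul, Real.norm_of_nonneg hα.le] at h4
      rw [e2, norm_smul, Real.norm_of_nonneg hα.le]
      have h5 : ‖X s - W s‖ = α⁻¹ * (α * ‖X s - W s‖) := by field_simp
      calc α * ‖fb (X s) - fb (W s) - fderiv ℝ fb (W s) (X s - W s)‖
          ≤ α * (C * ‖X s - W s‖ ^ 2) := by gcongr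
        _ = C * α⁻¹ * (α * ‖X s - W s‖) ^ 2 := by
            rw [h5]; field_simp
        _ ≤ C * α⁻¹ * R ^ 2 := by gcongr)
  refine h2.trans ?_
  rw [sub_zero, abs_of_nonneg ht.1, mul_comm]
  gcongr
  exact ht.2

set_option maxHeartbeats 1000000 in
/-- The deterministic heart of the argument: for small `ε`, along every orbit on which the processes
`v^ε` and `v̇^ε` have the modulus of continuity `η + Λ |s - t|`, the process `z^ε` is at most `η` and
the number of passages is close to its mean, the rescaled error is within `O(η)` of the linear
response to `v^ε`. The processes are controlled slightly beyond the time `C * S`, to leave room for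
a moving average. -/
theorem exists_eventually_norm_sub_linearResponse_le {C S τbar : ℝ} (hC : 1 ≤ C) (hS : 0 < S)
    {a : ℝ → ℝ} (ha_pos : ∀ ε, 0 < ε → 0 < a ε) (ha : Tendsto a (𝓝[>] 0) (𝓝 0))
    (hεa : Tendsto (fun ε => ε / a ε) (𝓝[>] 0) (𝓝 0)) :
    ∃ K : ℝ, 0 < K ∧ ∀ η ∈ Ioc (0 : ℝ) 1, ∀ Λ : ℝ, 0 ≤ Λ → ∀ᶠ ε in 𝓝[>] (0 : ℝ),
      ∀ (x : E) (φ : ℝ → E → E) (fb : E → E) (r : ℕ → ℝ) (F : ℕ → E → E) (W X : ℝ → E)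
        (v z : ℝ → E) (vdot : ℝ → E →L[ℝ] E) (nt : ℝ → ℕ),
      PassageSystem C ε τbar x φ fb r F W X →
      Differentiable ℝ fb → Differentiable ℝ (fderiv ℝ fb) → (∀ y, ‖fderiv ℝ fb y‖ ≤ C) →
      (∀ y, ‖fderiv ℝ (fderiv ℝ fb) y‖ ≤ C) →
      (∀ k, Differentiable ℝ (F k)) → (∀ k, Differentiable ℝ (fderiv ℝ (F k))) →
      (∀ k y, ‖fderiv ℝ (fderiv ℝ (F k)) y‖ ≤ C) →
      (∀ t, v t = a ε • ∫ s in (0 : ℝ)..t / ε, F ⌊s⌋₊ (W (τbar * (ε * s)))) →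
      (∀ t, vdot t = a ε • ∫ s in (0 : ℝ)..t / ε, fderiv ℝ (F ⌊s⌋₊) (W (τbar * (ε * s)))) →
      (∀ t, z t = Real.sqrt (ε * a ε) • ∫ s in (0 : ℝ)..t / ε,
        (r ⌊s⌋₊ - τbar) • fb (W (τbar * (ε * s)))) →
      ContinuousOn v (Ici 0) →
      (∀ s ∈ Icc 0 (C * S + 2), ∀ t ∈ Icc 0 (C * S + 2), ‖v s - v t‖ ≤ η + Λ * |s - t|) →
      (∀ s ∈ Icc 0 (C * S + 2), ∀ t ∈ Icc 0 (C * S + 2), ‖vdot s - vdot t‖ ≤ η + Λ * |s - t|) →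
      (∀ t ∈ Icc 0 (C * S + 2), ‖z t‖ ≤ η) →
      (∀ t ∈ Icc 0 S, t ∈ Icc (ε * ∑ j ∈ Finset.range (nt t), r j)
        (ε * ∑ j ∈ Finset.range (nt t + 1), r j) ∧ |ε * nt t - t / τbar| ≤ η / (Λ + 1)) →
      ∀ t ∈ Icc 0 S, ‖(a ε / ε) • (X t - W t) -
        linearResponse (fun u => fderiv ℝ fb (W u)) (fun s => v (s / τbar)) t‖ ≤ K * η := by
  have hC0 : 0 < C := zero_lt_one.trans_le hC
  -- bounds `t / τbar`, and `ε` times the number of passages before the time `t`, for `t ≤ S`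
  set T₀ := C * S with hT₀
  have hT₀0 : 0 < T₀ := mul_pos hC0 hS
  set ex := Real.exp (2 * C ^ 2 * T₀) with hex
  have hex0 : 0 < ex := Real.exp_pos _
  -- collects the contributions `b1`, …, `b5` below
  set K₁ : ℝ := 9 + 4 * C * T₀ * ex ^ 2 + 9 * C ^ 2 * T₀ + 3 * T₀ with hK₁
  have hK₁0 : 0 < K₁ := by positivity
  refine ⟨(K₁ + 1) * Real.exp (C * S), by positivity, ?_⟩
  rintro η ⟨hη, hη1⟩ Λ hΛ
  have hs : Tendsto (fun ε => Real.sqrt (ε / a ε)) (𝓝[>] 0) (𝓝 0) := by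
    simpa [Function.comp_def] using (Real.continuous_sqrt.tendsto 0).comp hεa
  have hε0 : Tendsto (fun ε : ℝ => ε) (𝓝[>] 0) (𝓝 0) := tendsto_id.mono_left nhdsWithin_le_nhds
  have hp : Tendsto (fun ε => Real.sqrt (ε * a ε)) (𝓝[>] 0) (𝓝 0) := by
    have h1 := hε0.mul ha
    rw [mul_zero] at h1
    simpa [Function.comp_def] using (Real.continuous_sqrt.tendsto 0).comp h1
  -- the time scale at which the slope `Λ` contributes at most `η`
  set δ' := η / (Λ + 1) with hδ'
  have hδ'0 : 0 < δ' := by positivity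
  have hδ'η : δ' ≤ η := div_le_self hη.le (by linarith)
  have hΛδ' : Λ * δ' ≤ η := by
    rw [hδ', mul_div_assoc', div_le_iff₀ (by linarith)]; nlinarith
  -- a bound for `v` on `[0, T₀]`, as `v 0 = 0`
  set A := 1 + Λ * T₀ with hA
  have hA0 : 0 ≤ A := by positivity
  set M := 3 * C ^ 4 * T₀ + C ^ 2 + C ^ 3 * T₀ with hM
  set R := ((K₁ * η + A) * Real.exp (C * S)) ^ 2 with hR
  have c1 : ∀ᶠ ε in 𝓝[>] (0 : ℝ), ε ≤ 1 := hε0.eventually_le_const one_pos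
  have c2 : ∀ᶠ ε in 𝓝[>] (0 : ℝ), Λ * ε ≤ η := by
    have := hε0.const_mul Λ
    rw [mul_zero] at this
    exact this.eventually_le_const hη
  have c3 : ∀ᶠ ε in 𝓝[>] (0 : ℝ),
      Real.sqrt (ε / a ε) * A + 7 * C ^ 4 * T₀ * Real.sqrt (ε * a ε) ≤ η := by
    have := (hs.mul_const A).add (hp.const_mul (7 * C ^ 4 * T₀))
    rw [mul_zero, zero_mul, add_zero] at this
    exact this.eventually_le_const hη
  have c4 : ∀ᶠ ε in 𝓝[>] (0 : ℝ), Real.sqrt (ε / a ε) * 2 * ex ≤ δ' := by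
    have := (hs.mul_const 2).mul_const ex
    rw [zero_mul, zero_mul] at this
    exact this.eventually_le_const hδ'0
  have c5 : ∀ᶠ ε in 𝓝[>] (0 : ℝ), a ε * M ≤ η := by
    have := ha.mul_const M
    rw [zero_mul] at this
    exact this.eventually_le_const hη
  have c6 : ∀ᶠ ε in 𝓝[>] (0 : ℝ), S * (C * (ε / a ε) * R) ≤ η := by
    have := ((hεa.const_mul C).mul_const R).const_mul S
    rw [mul_zero, zero_mul, mul_zero] at this
    exact this.eventually_le_const hη
  filter_upwards [c1, c2, c3, c4, c5, c6, self_mem_nhdsWithin] with ε c1 c2 c3 c4 c5 c6 hε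
  intro x φ fb r F W X v z vdot nt h hfb hfb' hfbC hfbC' hF hF' hF'' hv hvdot hz hvc hvmod hvdmod
    hzle hnt
  replace hε : 0 < ε := hε
  have haε := ha_pos ε hε
  -- the errors at the passage times will be of the order of `η * s`
  set s := Real.sqrt (ε / a ε) with hsdef
  set p := Real.sqrt (ε * a ε) with hpdef
  have hs0 : 0 < s := Real.sqrt_pos.2 (div_pos hε haε)
  have hp0 : 0 < p := Real.sqrt_pos.2 (mul_pos hε haε)
  have hss : s * s = ε / a ε := Real.mul_self_sqrt (div_pos hε haε).le
  have hsp : s * p = ε := by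
    rw [hsdef, hpdef, ← Real.sqrt_mul (div_pos hε haε).le]
    have : ε / a ε * (ε * a ε) = ε * ε := by field_simp
    rw [this, Real.sqrt_mul_self hε.le]
  have hεp : ε / p = s := by rw [← hsp]; field_simp
  have hτ := h.bar_pos
  have h0mem : (0 : ℝ) ∈ Icc 0 (C * S + 2) := ⟨le_rfl, by positivity⟩
  have hv0 : v 0 = 0 := by rw [hv]; simp
  have hvle : ∀ t ∈ Icc 0 T₀, ‖v t‖ ≤ A := by
    intro t ht
    have h1 := hvmod t ⟨ht.1, by linarith [ht.2]⟩ 0 h0mem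
    rw [hv0, sub_zero, sub_zero, abs_of_nonneg ht.1] at h1
    have h2 : Λ * t ≤ Λ * T₀ := mul_le_mul_of_nonneg_left ht.2 hΛ
    linarith
  have hbar : ∀ t ∈ Icc 0 S, t / τbar ∈ Icc 0 T₀ := by
    intro t ht
    refine ⟨div_nonneg ht.1 hτ.le, ?_⟩
    rw [div_le_iff₀ hτ]
    have h1 : 1 ≤ C * τbar := by
      have := mul_le_mul_of_nonneg_left h.le_bar hC0.le
      rwa [mul_inv_cancel₀ hC0.ne'] at this
    calc t ≤ S := ht.2
      _ ≤ S * (C * τbar) := le_mul_of_one_le_right hS.le h1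
      _ = T₀ * τbar := by rw [hT₀]; ring
  -- the length of the moving average, in number of passages
  set m := ⌈δ' / ε⌉₊ with hm
  have hm0 : 0 < m := Nat.ceil_pos.2 (div_pos hδ'0 hε)
  have hm1 : δ' ≤ ε * m := by
    have := Nat.le_ceil (δ' / ε)
    rw [div_le_iff₀ hε] at this
    linarith
  have hm2 : ε * m ≤ δ' + ε := by
    have := (Nat.ceil_lt_add_one (div_pos hδ'0 hε).le).le
    calc ε * m ≤ ε * (δ' / ε + 1) := by gcongr
      _ = δ' + ε := by field_simp
  have hdiv : ∀ k : ℕ, ε * k / ε = k := fun k => mul_div_cancel_left₀ _ hε.ne'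
  have hfast : ∀ t ∈ Icc 0 S, ‖((a ε / ε) • ∫ s in (0 : ℝ)..t, φ (s / ε) (X s)) -
      v (t / τbar)‖ ≤ K₁ * η := by
    intro t ht
    obtain ⟨ht1, ht2⟩ := hnt t ht
    have hnT : ε * nt t ≤ T₀ := by
      have h1 : (nt t : ℝ) * C⁻¹ ≤ ∑ j ∈ Finset.range (nt t), r j := by
        have := Finset.card_nsmul_le_sum (Finset.range (nt t)) r C⁻¹ fun j _ => h.le_roof j
        simpa using this
      have h2 : ε * (nt t * C⁻¹) ≤ S :=
        (mul_le_mul_of_nonneg_left h1 hε.le).trans (ht1.1.trans ht.2)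
      calc ε * nt t = C * (ε * (nt t * C⁻¹)) := by field_simp
        _ ≤ C * S := by gcongr
    have hkT : ∀ k : ℕ, k ≤ nt t → ε * k ∈ Icc 0 T₀ := fun k hk =>
      ⟨by positivity, (mul_le_mul_of_nonneg_left (by exact_mod_cast hk) hε.le).trans hnT⟩
    have key := h.norm_smul_integral_field_sub_le hF hF' hF'' haε hm0 hnT (A := A) (B := η)
      (η := 3 * η) (Θ := s * (2 * η) * ex)
      (fun k hk => by
        have h1 := hvle _ (hkT k hk)
        rwa [hv, hdiv] at h1)
      (fun k hk => by
        have h1 := hzle (ε * k) ⟨(hkT k hk).1, by linarith [(hkT k hk).2]⟩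
        rwa [hz, hdiv] at h1)
      (fun k l hk hl => by
        have hl' : ε * l ≤ δ' + ε :=
          (mul_le_mul_of_nonneg_left (by exact_mod_cast hl) hε.le).trans hm2
        have hl0 : 0 ≤ ε * (l : ℝ) := by positivity
        have e1 : ε * ((k + l : ℕ) : ℝ) = ε * k + ε * l := by push_cast; ring
        have h1 := hvdmod (ε * ((k + l : ℕ) : ℝ))
          ⟨by positivity, by rw [e1]; linarith [(hkT k hk).2]⟩
          (ε * k) ⟨(hkT k hk).1, by linarith [(hkT k hk).2]⟩
        rw [hvdot, hvdot, hdiv, hdiv] at h1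
        refine h1.trans ?_
        rw [e1, add_sub_cancel_left, abs_of_nonneg hl0]
        have h2 := mul_le_mul_of_nonneg_left hl' hΛ
        rw [mul_add] at h2
        linarith)
      (by
        rw [← hpdef, hεp, ← hss]
        have e1 : s * s * A + s * η + 7 * C ^ 4 * ε * T₀ =
            s * (s * A + 7 * C ^ 4 * T₀ * p + η) := by rw [← hsp]; ring
        rw [e1]
        gcongr
        linarith)
      le_rfl ht1
    have hΘ1 : s * (2 * η) * ex ≤ δ' * η := by
      calc s * (2 * η) * ex = s * 2 * ex * η := by ring
        _ ≤ δ' * η := by gcongr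
    have hΘ2 : s * (2 * η) * ex ≤ 1 := hΘ1.trans (by nlinarith)
    have hΘ0 : 0 ≤ s * (2 * η) * ex := by positivity
    have b1 : a ε * (3 * C ^ 4 * T₀ + C ^ 2 + C ^ 3 * T₀ * (s * (2 * η) * ex)) ≤ η := by
      refine le_trans ?_ c5
      refine mul_le_mul_of_nonneg_left (add_le_add_right ?_ _) haε.le
      exact mul_le_of_le_one_right (by positivity) hΘ2
    have b2 : a ε / ε * C * T₀ * (s * (2 * η) * ex) ^ 2 ≤ 4 * C * T₀ * ex ^ 2 * η := by
      have e1 : a ε / ε * (s * s) = 1 := by rw [hss]; field_simp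
      calc a ε / ε * C * T₀ * (s * (2 * η) * ex) ^ 2
          = (a ε / ε * (s * s)) * (4 * C * T₀ * ex ^ 2 * (η * η)) := by ring
        _ = 4 * C * T₀ * ex ^ 2 * (η * η) := by rw [e1, one_mul]
        _ ≤ 4 * C * T₀ * ex ^ 2 * (η * 1) := by gcongr
        _ = _ := by ring
    have b3 : 3 * η * (2 * (s * (2 * η) * ex) + 3 * C ^ 2 * T₀) ≤ 3 * η * (2 + 3 * C ^ 2 * T₀) := by
      gcongr
      linarith
    have b4 : T₀ / (ε * m) * (3 * η) * (s * (2 * η) * ex) ≤ 3 * T₀ * η := by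
      calc T₀ / (ε * m) * (3 * η) * (s * (2 * η) * ex) ≤ T₀ / δ' * (3 * η) * (δ' * η) := by
            gcongr
        _ = 3 * T₀ * (η * η) := by field_simp
        _ ≤ 3 * T₀ * (η * 1) := by gcongr
        _ = _ := by ring
    have b5 : ‖v (ε * nt t) - v (t / τbar)‖ ≤ 2 * η := by
      have h1 := hkT _ le_rfl
      have h2 := hbar t ht
      have h3 := hvmod _ ⟨h1.1, by linarith [h1.2]⟩ _ ⟨h2.1, by linarith [h2.2]⟩
      have h4 := mul_le_mul_of_nonneg_left ht2 hΛ
      linarith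
    rw [hv (ε * nt t), hdiv] at b5
    have h6 := norm_sub_le_norm_sub_add_norm_sub
      ((a ε / ε) • ∫ s in (0 : ℝ)..t, φ (s / ε) (X s))
      (a ε • ∫ s in (0 : ℝ)..(nt t : ℝ), F ⌊s⌋₊ (W (τbar * (ε * s)))) (v (t / τbar))
    rw [hK₁]
    linarith
  intro t ht
  have hfin := h.norm_smul_sub_linearResponse_le hfb hfb' hfbC hfbC' (div_pos haε hε)
    (V := fun s => v (s / τbar))
    (hvc.comp (by fun_prop) fun s hs => div_nonneg hs hτ.le)
    (fun t ht => hvle _ (hbar t ht)) hfast t ht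
  refine hfin.trans ?_
  rw [inv_div]
  have : K₁ * η + S * (C * (ε / a ε) * R) ≤ (K₁ + 1) * η := by linarith
  calc _ ≤ (K₁ + 1) * η * Real.exp (C * S) := mul_le_mul_of_nonneg_right this (Real.exp_pos _).le
    _ = _ := by ring

end PassageSystem

/-! ### Moduli of continuity of random paths -/

section Modulus

variable {G : Type*} [NormedAddCommGroup G]

theorem pathOn_apply {S : ℝ} {g : ℝ → G} (h : ContinuousOn g (Icc 0 S)) (t : Icc (0 : ℝ) S) :
    pathOn S g t = g t := by
  rw [pathOn, dif_pos h]; rfl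

theorem pathOn_zero {S : ℝ} : pathOn S (fun _ => (0 : G)) = 0 := by
  ext t
  rw [pathOn_apply continuousOn_const]; rfl

/-- An affine bound `η + Λ |s - t|` for the oscillations of all the elements of a compact set of
paths. It is the form in which compactness is used: the slope `Λ` is absorbed by the small
time scale. -/
theorem IsCompact.exists_affine_modulus {X : Type*} [PseudoMetricSpace X] [CompactSpace X]
    {K : Set C(X, G)} (hK : IsCompact K) {η : ℝ} (hη : 0 < η) :
    ∃ Λ : ℝ, 0 ≤ Λ ∧ ∀ g ∈ K, ∀ s t, ‖g s - g t‖ ≤ η + Λ * dist s t := by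
  refine hK.induction_on (p := fun K => ∃ Λ : ℝ, 0 ≤ Λ ∧ ∀ g ∈ K, ∀ s t,
    ‖g s - g t‖ ≤ η + Λ * dist s t) ⟨0, le_rfl, by simp⟩ ?_ ?_ ?_
  · rintro s t hst ⟨Λ, hΛ, h⟩
    exact ⟨Λ, hΛ, fun g hg => h g (hst hg)⟩
  · rintro s t ⟨Λ, hΛ, h⟩ ⟨Λ', hΛ', h'⟩
    refine ⟨max Λ Λ', le_max_of_le_left hΛ, ?_⟩
    rintro g (hg | hg) u r
    · exact (h g hg u r).trans (by gcongr; exact le_max_left _ _)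
    · exact (h' g hg u r).trans (by gcongr; exact le_max_right _ _)
  · intro g _
    have hη3 : 0 < η / 3 := by positivity
    obtain ⟨δ, hδ, h⟩ := Metric.uniformContinuous_iff.1
      (CompactSpace.uniformContinuous_of_continuous g.continuous) (η / 3) hη3
    have hg : ∀ s t, ‖g s - g t‖ ≤ η / 3 + 2 * ‖g‖ / δ * dist s t := by
      intro s t
      rcases lt_or_ge (dist s t) δ with hst | hst
      · have := h hst
        rw [dist_eq_norm] at this
        have h0 : 0 ≤ 2 * ‖g‖ / δ * dist s t := by positivity
        linarith
      · have h1 : ‖g s - g t‖ ≤ 2 * ‖g‖ := by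
          linarith [norm_sub_le (g s) (g t), g.norm_coe_le_norm s, g.norm_coe_le_norm t]
        have h2 : 2 * ‖g‖ ≤ 2 * ‖g‖ / δ * dist s t := by
          rw [div_mul_eq_mul_div, le_div_iff₀ hδ]
          gcongr
        linarith
    refine ⟨Metric.ball g (η / 3), mem_nhdsWithin_of_mem_nhds (Metric.ball_mem_nhds g hη3),
      2 * ‖g‖ / δ, by positivity, fun g' hg' s t => ?_⟩
    have hd : ∀ s, ‖g' s - g s‖ ≤ η / 3 := fun s => by
      rw [← dist_eq_norm]
      exact (ContinuousMap.dist_apply_le_dist s).trans (Metric.mem_ball.1 hg').le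
    have e : g' s - g' t = (g' s - g s) + (g s - g t) - (g' t - g t) := by abel
    rw [e]
    linarith [norm_sub_le ((g' s - g s) + (g s - g t)) (g' t - g t),
      norm_add_le (g' s - g s) (g s - g t), hd s, hd t, hg s t]

/-- The path `g` oscillates by at most `η + Λ |s - t|` on `[0, S]`. -/
def HasAffineModulus (S η Λ : ℝ) (g : ℝ → G) : Prop :=
  ∀ s ∈ Icc 0 S, ∀ t ∈ Icc 0 S, ‖g s - g t‖ ≤ η + Λ * |s - t|

theorem HasAffineModulus.mono {S η Λ Λ' : ℝ} {g : ℝ → G} (h : HasAffineModulus S η Λ g)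
    (hΛ : Λ ≤ Λ') : HasAffineModulus S η Λ' g := fun s hs t ht =>
  (h s hs t ht).trans (by gcongr)

theorem hasAffineModulus_of_pathOn {S η Λ : ℝ} {g : ℝ → G} (hg : ContinuousOn g (Icc 0 S))
    (h : ∀ s t, ‖pathOn S g s - pathOn S g t‖ ≤ η + Λ * dist s t) : HasAffineModulus S η Λ g := by
  intro s hs t ht
  have := h ⟨s, hs⟩ ⟨t, ht⟩
  rwa [pathOn_apply hg, pathOn_apply hg] at this

end Modulus

section Probability

variable {Ω Ω' ι X : Type*} [MeasurableSpace Ω] [MeasurableSpace Ω'] {P : Measure Ω}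
  [IsProbabilityMeasure P] {Q : Measure Ω'} [IsProbabilityMeasure Q] {l : Filter ι}

/-- The portmanteau inequality for closed sets, for random elements. -/
theorem MeasureTheory.TendstoInDistribution.eventually_measure_le [PseudoMetricSpace X] [MeasurableSpace X]
    [BorelSpace X] {R : ι → Ω → X} {Z : Ω' → X}
    (h : TendstoInDistribution R l Z (fun _ => P) Q) {A : Set X} (hA : IsClosed A) {δ : ENNReal}
    (hδ : Q {ω | Z ω ∈ A} < δ) : ∀ᶠ i in l, P {ω | R i ω ∈ A} ≤ δ := by
  have h1 := ProbabilityMeasure.limsup_measure_closed_le_of_tendsto h.tendsto hA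
  have h2 : Q.map Z A < δ := by
    rw [Measure.map_apply_of_aemeasurable h.aemeasurable_limit hA.measurableSet]
    exact hδ
  have h3 := eventually_lt_of_limsup_lt (h1.trans_lt h2)
  filter_upwards [h3] with i hi
  refine le_trans ?_ hi.le
  exact Measure.le_map_apply (h.forall_aemeasurable i) A

/-- Convergence in distribution in a Polish space keeps the random elements, with a probability
close to `1`, in a neighbourhood of a compact set. -/
theorem MeasureTheory.TendstoInDistribution.exists_isCompact_eventually_measure_le [PseudoMetricSpace X]
    [CompleteSpace X] [SecondCountableTopology X] [MeasurableSpace X] [BorelSpace X]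
    {R : ι → Ω → X} {Z : Ω' → X} (h : TendstoInDistribution R l Z (fun _ => P) Q) {ρ : ℝ}
    (hρ : 0 < ρ) {δ : ENNReal} (hδ : 0 < δ) :
    ∃ K : Set X, IsCompact K ∧ ∀ᶠ i in l, P {ω | R i ω ∉ Metric.thickening ρ K} ≤ δ := by
  have hZ := h.aemeasurable_limit
  have : IsProbabilityMeasure (Q.map Z) := Measure.isProbabilityMeasure_map hZ
  obtain ⟨δ', hδ'0, hδ'⟩ := exists_between hδ
  obtain ⟨K, hK, hKδ⟩ := isTightMeasureSet_iff_exists_isCompact_measure_compl_le.1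
    (isTightMeasureSet_singleton (μ := Q.map Z)) δ' hδ'0
  refine ⟨K, hK, ?_⟩
  refine h.eventually_measure_le (A := (Metric.thickening ρ K)ᶜ)
    Metric.isOpen_thickening.isClosed_compl ?_
  refine lt_of_le_of_lt ?_ hδ'
  refine le_trans ?_ (hKδ _ rfl)
  refine le_trans (measure_mono fun ω hω => ?_) (Measure.le_map_apply hZ Kᶜ)
  exact fun hK' => hω (Metric.self_subset_thickening hρ K hK')

theorem eventually_comap_Ioi {p : ℝ → Prop}
    (h : ∀ᶠ ε : Ioi (0 : ℝ) in comap (fun ε : Ioi (0 : ℝ) => (ε : ℝ)) (𝓝[>] 0), p ε) :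
    ∀ᶠ ε in 𝓝[>] (0 : ℝ), p ε := by
  rw [eventually_comap] at h
  filter_upwards [h, self_mem_nhdsWithin] with ε hε h0
  exact hε ⟨ε, h0⟩ rfl

variable {G : Type*} [NormedAddCommGroup G]

/-- The paths of a family which converges in law are equicontinuous, with a probability close to
`1`, for small `ε`. -/
theorem LocallyConvergesInLaw.exists_affine_modulus [CompleteSpace G] [SecondCountableTopology G]
    {Z : ℝ → ℝ → Ω → G} {Z₀ : ℝ → Ω' → G} (h : LocallyConvergesInLaw P Z Q Z₀) {S : ℝ}
    (hS : 0 < S) {η : ℝ} (hη : 0 < η) {δ : ENNReal} (hδ : 0 < δ) :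
    ∃ Λ : ℝ, 0 ≤ Λ ∧ ∀ Λ', Λ ≤ Λ' →
      ∀ᶠ ε in 𝓝[>] (0 : ℝ), P {ω | ¬ HasAffineModulus S η Λ' fun t => Z ε t ω} ≤ δ := by
  obtain ⟨K, hK, hKδ⟩ := (h.tendsto S hS).exists_isCompact_eventually_measure_le
    (ρ := η / 3) (by positivity) hδ
  obtain ⟨Λ, hΛ, hmod⟩ := hK.exists_affine_modulus (η := η / 3) (by positivity)
  refine ⟨Λ, hΛ, fun Λ' hΛ' => ?_⟩
  refine eventually_comap_Ioi ?_
  filter_upwards [hKδ] with ε hε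
  refine (measure_mono fun ω hω => ?_).trans hε
  contrapose! hω
  simp only [mem_ofPred_eq, not_not] at hω ⊢
  have hc : ContinuousOn (fun t => Z ε t ω) (Icc 0 S) :=
    (h.continuous_paths ε ε.2 ω).mono Icc_subset_Ici_self
  refine HasAffineModulus.mono (hasAffineModulus_of_pathOn hc fun s t => ?_) hΛ'
  obtain ⟨g, hgK, hg⟩ := Metric.mem_thickening_iff.1 hω
  set q := pathOn S fun t => Z ε t ω
  have hd : ∀ s, ‖q s - g s‖ ≤ η / 3 := fun s => by
    rw [← dist_eq_norm]
    exact (ContinuousMap.dist_apply_le_dist s).trans hg.le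
  have e : q s - q t = (q s - g s) + (g s - g t) - (q t - g t) := by abel
  rw [e]
  linarith [norm_sub_le ((q s - g s) + (g s - g t)) (q t - g t),
    norm_add_le (q s - g s) (g s - g t), hd s, hd t, hmod g hgK s t]

theorem LocallyConvergesInLaw.eventually_measure_norm_le {Z : ℝ → ℝ → Ω → G}
    (h : LocallyConvergesInLaw P Z Q (fun _ _ => 0)) {S : ℝ} (hS : 0 < S) {η : ℝ} (hη : 0 < η)
    {δ : ENNReal} (hδ : 0 < δ) :
    ∀ᶠ ε in 𝓝[>] (0 : ℝ), P {ω | ¬ ∀ t ∈ Icc 0 S, ‖Z ε t ω‖ ≤ η} ≤ δ := by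
  have h1 := (h.tendsto S hS).eventually_measure_le
    (A := {g | η ≤ ‖g‖}) (isClosed_le continuous_const continuous_norm) (δ := δ) (by
      simp only [pathOn_zero, mem_ofPred_eq, norm_zero, hη.not_ge]
      simpa using hδ)
  refine eventually_comap_Ioi ?_
  filter_upwards [h1] with ε hε
  refine (measure_mono fun ω hω => ?_).trans hε
  rw [mem_ofPred_eq] at hω
  by_contra hlt
  simp only [mem_ofPred_eq, not_le] at hlt
  refine hω fun t ht => ?_
  have hc : ContinuousOn (fun t => Z ε t ω) (Icc 0 S) :=
    (h.continuous_paths ε ε.2 ω).mono Icc_subset_Ici_self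
  rw [← pathOn_apply hc ⟨t, ht⟩]
  exact (ContinuousMap.norm_coe_le_norm _ _).trans hlt.le

omit [IsProbabilityMeasure P] in
theorem TightAtZero.exists_affine_modulus {Z : ℝ → ℝ → Ω → G} (h : TightAtZero P Z)
    (hc : ∀ ε, 0 < ε → ∀ ω, ContinuousOn (fun t => Z ε t ω) (Ici 0)) {S : ℝ} (hS : 0 < S) {η : ℝ}
    (hη : 0 < η) {δ : ENNReal} (hδ : 0 < δ) :
    ∃ Λ : ℝ, 0 ≤ Λ ∧ ∀ Λ', Λ ≤ Λ' →
      ∀ᶠ ε in 𝓝[>] (0 : ℝ), P {ω | ¬ HasAffineModulus S η Λ' fun t => Z ε t ω} ≤ δ := by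
  obtain ⟨K, hK, hKδ⟩ := h S hS δ hδ
  obtain ⟨Λ, hΛ, hmod⟩ := hK.exists_affine_modulus hη
  refine ⟨Λ, hΛ, fun Λ' hΛ' => ?_⟩
  filter_upwards [hKδ, self_mem_nhdsWithin] with ε hε h0
  refine (measure_mono fun ω hω => ?_).trans hε
  contrapose! hω
  simp only [mem_ofPred_eq, not_not] at hω ⊢
  exact (hasAffineModulus_of_pathOn ((hc ε h0 ω).mono Icc_subset_Ici_self) (hmod _ hω)).mono hΛ'

/-- A sequence of random paths that stays uniformly close, up to events of small probability, to a
sequence converging in distribution has the same limit. -/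
theorem tendstoInDistribution_of_forall_eventually_measure_le [SeminormedAddCommGroup X]
    [SecondCountableTopology X] [MeasurableSpace X] [BorelSpace X] [l.IsCountablyGenerated]
    {R R' : ι → Ω → X} {Z : Ω' → X}
    (h : TendstoInDistribution R l Z (fun _ => P) Q) (hR' : ∀ i, AEMeasurable (R' i) P)
    (hd : ∀ η > 0, ∀ δ : ENNReal, 0 < δ → ∀ᶠ i in l, P {ω | ¬ ‖R' i ω - R i ω‖ ≤ η} ≤ δ) :
    TendstoInDistribution R' l Z (fun _ => P) Q := by
  refine tendstoInDistribution_of_tendstoInMeasure_sub R' Z h ?_ hR'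
  rw [tendstoInMeasure_iff_norm]
  intro η hη
  rw [ENNReal.tendsto_nhds_zero]
  intro δ hδ
  filter_upwards [hd (η / 2) (by positivity) δ hδ] with i hi
  refine (measure_mono fun ω hω => ?_).trans hi
  simp only [mem_ofPred_eq, Pi.sub_apply, Pi.zero_apply, sub_zero, not_le] at hω ⊢
  linarith

end Probability

/-! ### The averaging problem on the suspension -/

section Suspended

variable {M : Type*} [MeasurableSpace M] {τ : M → ℝ} {T : M → M}

/-- The roof integral is the integral of the field along one passage of the suspension flow. -/
theorem roofIntegral_iterate_eq_integral {E : Type*} [NormedAddCommGroup E] [NormedSpace ℝ E]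
    (hτ : IsRoof τ) (T : M → M) (f : E → SuspensionSpace τ → E) (z : E) (y : M) (k : ℕ) :
    roofIntegral τ f z (T^[k] y) =
      ∫ u in birkhoffSum T τ k y..birkhoffSum T τ (k + 1) y,
        f z (suspensionFlow T hτ u.toNNReal (hτ.basePoint y)) := by
  have h0 : 0 ≤ τ (T^[k] y) := by
    obtain ⟨c, hc0, hc⟩ := hτ.bounded_below
    exact hc0.le.trans (hc _)
  have h1 := intervalIntegral.integral_comp_add_right (a := 0) (b := τ (T^[k] y))
    (fun u => f z (suspensionFlow T hτ u.toNNReal (hτ.basePoint y))) (birkhoffSum T τ k y)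
  rw [zero_add, add_comm (τ _), ← birkhoffSum_succ] at h1
  rw [← h1, roofIntegral]
  refine intervalIntegral.integral_congr_Ioo_of_le h0 fun s hs => ?_
  have hs' : 0 ≤ s ∧ s < τ (T^[k] y) := ⟨hs.1.le, hs.2⟩
  simp only [dif_pos hs', suspensionFlow_basePoint_of_mem hτ T y k hs']

variable {E : Type*} [NormedAddCommGroup E] [NormedSpace ℝ E]

/-- All the bounds on the data of the averaging problem, expressed by a single constant `C ≥ 1`. -/
structure AveragingBounds (C τbar : ℝ) (τ : M → ℝ) (f : E → SuspensionSpace τ → E) (fbar : E → E) :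
    Prop where
  one_le : 1 ≤ C
  le_roof : ∀ y, C⁻¹ ≤ τ y
  roof_le : ∀ y, τ y ≤ C
  le_bar : C⁻¹ ≤ τbar
  bar_le : τbar ≤ C
  field_le : ∀ x p, ‖f x p‖ ≤ C
  field_lip : ∀ p x y, ‖f x p - f y p‖ ≤ C * ‖x - y‖
  mean_le : ∀ x, ‖fbar x‖ ≤ C
  mean_lip : ∀ x y, ‖fbar x - fbar y‖ ≤ C * ‖x - y‖
  mean_diff : Differentiable ℝ fbar
  mean_diff_diff : Differentiable ℝ (fderiv ℝ fbar)
  mean_fderiv_le : ∀ x, ‖fderiv ℝ fbar x‖ ≤ C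
  mean_fderiv_fderiv_le : ∀ x, ‖fderiv ℝ (fderiv ℝ fbar) x‖ ≤ C
  passage_diff : ∀ y, Differentiable ℝ fun x => roofIntegral τ f x y
  passage_diff_diff : ∀ y, Differentiable ℝ (fderiv ℝ fun x => roofIntegral τ f x y)
  passage_fderiv_le : ∀ y x, ‖fderiv ℝ (fun x => roofIntegral τ f x y) x‖ ≤ C
  passage_fderiv_fderiv_le : ∀ y x,
    ‖fderiv ℝ (fderiv ℝ fun x => roofIntegral τ f x y) x‖ ≤ C

theorem exists_averagingBounds {τbar : ℝ} (hτbar : 0 < τbar) (hτ : IsRoof τ)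
    {f : E → SuspensionSpace τ → E} {fbar : E → E} (hf_bdd : ∃ C : ℝ, ∀ x p, ‖f x p‖ ≤ C)
    (hf_lip : ∃ K : NNReal, ∀ p, LipschitzWith K (fun x => f x p))
    (hF_diff : UniformlyBoundedTwiceDiff (fun y x => roofIntegral τ f x y))
    (hfbar_diff : UniformlyBoundedTwiceDiff (fun _ : Unit => fbar)) :
    ∃ C, AveragingBounds C τbar τ f fbar := by
  obtain ⟨c, hc0, hc⟩ := hτ.bounded_below
  obtain ⟨C₁, hC₁⟩ := hτ.bounded_above
  obtain ⟨C₂, hC₂⟩ := hf_bdd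
  obtain ⟨K, hK⟩ := hf_lip
  obtain ⟨hF, hF', C₃, hC₃⟩ := hF_diff
  obtain ⟨hb, hb', C₄, hC₄⟩ := hfbar_diff
  have hlip : ∀ p x y, ‖f x p - f y p‖ ≤ K * ‖x - y‖ := fun p x y => by
    simpa only [dist_eq_norm] using (hK p).dist_le_mul x y
  have hblip : ∀ x y, ‖fbar x - fbar y‖ ≤ C₄ * ‖x - y‖ := fun x y =>
    norm_sub_le_of_fderiv_le (hb ()) (fun z => (hC₄ () z).2.1) y x
  obtain ⟨C, hC⟩ : ∃ C, 1 ≤ C ∧ c⁻¹ ≤ C ∧ τbar⁻¹ ≤ C ∧ τbar ≤ C ∧ C₁ ≤ C ∧ C₂ ≤ C ∧ K ≤ C ∧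
      C₃ ≤ C ∧ C₄ ≤ C := by
    have h1 : ∀ᶠ C : ℝ in atTop, 1 ≤ C ∧ c⁻¹ ≤ C ∧ τbar⁻¹ ≤ C ∧ τbar ≤ C ∧ C₁ ≤ C ∧ C₂ ≤ C ∧
        K ≤ C ∧ C₃ ≤ C ∧ C₄ ≤ C := by
      simp only [eventually_and, eventually_ge_atTop, and_self]
    exact h1.exists
  obtain ⟨h1, hc', hτ', hτ'', h₁, h₂, hK', h₃, h₄⟩ := hC
  have hci : C⁻¹ ≤ c := (inv_le_comm₀ (by linarith) hc0).2 hc'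
  exact ⟨C, {
    one_le := h1
    le_roof := fun y => hci.trans (hc y)
    roof_le := fun y => (hC₁ y).trans h₁
    le_bar := (inv_le_comm₀ (by linarith) hτbar).2 hτ'
    bar_le := hτ''
    field_le := fun x p => (hC₂ x p).trans h₂
    field_lip := fun p x y => (hlip p x y).trans (by gcongr)
    mean_le := fun x => (hC₄ () x).1.trans h₄
    mean_lip := fun x y => (hblip x y).trans (by gcongr)
    mean_diff := hb ()
    mean_diff_diff := hb' ()
    mean_fderiv_le := fun x => (hC₄ () x).2.1.trans h₄
    mean_fderiv_fderiv_le := fun x => (hC₄ () x).2.2.trans h₄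
    passage_diff := hF
    passage_diff_diff := hF'
    passage_fderiv_le := fun y x => (hC₃ y x).2.1.trans h₃
    passage_fderiv_fderiv_le := fun y x => (hC₃ y x).2.2.trans h₃ }⟩

namespace AveragingBounds

variable {C τbar : ℝ} {f : E → SuspensionSpace τ → E} {fbar : E → E}

omit [MeasurableSpace M] in
theorem const_pos (h : AveragingBounds C τbar τ f fbar) : 0 < C := zero_lt_one.trans_le h.one_le

omit [MeasurableSpace M] in
theorem bar_pos (h : AveragingBounds C τbar τ f fbar) : 0 < τbar :=
  (inv_pos.2 h.const_pos).trans_le h.le_bar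

omit [MeasurableSpace M] in
theorem perturbed_le (h : AveragingBounds C τbar τ f fbar) (x : E) (p : SuspensionSpace τ) :
    ‖f x p + fbar x‖ ≤ 2 * C :=
  (norm_add_le _ _).trans (by linarith [h.field_le x p, h.mean_le x])

omit [MeasurableSpace M] in
theorem perturbed_lip (h : AveragingBounds C τbar τ f fbar) (p : SuspensionSpace τ) (x y : E) :
    ‖(f x p + fbar x) - (f y p + fbar y)‖ ≤ 2 * C * ‖x - y‖ := by
  rw [add_sub_add_comm]
  exact (norm_add_le _ _).trans (by linarith [h.field_lip p x y, h.mean_lip x y])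

omit [MeasurableSpace M] in
theorem continuousOn_fderiv_comp (h : AveragingBounds C τbar τ f fbar) {W : ℝ → E}
    (hW : ContinuousOn W (Ici 0)) : ContinuousOn (fun u => fderiv ℝ fbar (W u)) (Ici 0) :=
  h.mean_diff_diff.continuous.comp_continuousOn hW

omit [MeasurableSpace M] in
theorem continuousOn_perturbedBirkhoffDeriv (h : AveragingBounds C τbar τ f fbar) {W : ℝ → E}
    (hW : ContinuousOn W (Ici 0)) (a : ℝ → ℝ) {ε : ℝ} (hε : 0 < ε) (y : M) :
    ContinuousOn (fun t => perturbedBirkhoffDeriv T (roofIntegral τ f) a (fun t => W (τbar * t))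
      ε t y) (Ici 0) := by
  have hH : ∀ k : ℕ, ContinuousOn
      (fun s => fderiv ℝ (fun x => roofIntegral τ f x (T^[k] y)) (W (τbar * (ε * s))))
      (Icc (k : ℝ) (k + 1)) := fun k => by
    refine (h.passage_diff_diff _).continuous.comp_continuousOn
      (hW.comp (by fun_prop) fun s hs => ?_)
    exact mul_nonneg h.bar_pos.le (mul_nonneg hε.le ((Nat.cast_nonneg k).trans hs.1))
  have hI := intervalIntegrable_floor hH
  intro t ht
  obtain ⟨n, hn⟩ := exists_nat_gt (t / ε)
  have h1 := intervalIntegral.continuousOn_primitive_interval' (hI n) left_mem_uIcc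
  rw [uIcc_of_le (Nat.cast_nonneg n)] at h1
  have h2 : ContinuousOn (fun t : ℝ => a ε • ∫ s in (0 : ℝ)..t / ε,
      fderiv ℝ (fun x => roofIntegral τ f x (T^[⌊s⌋₊] y)) (W (τbar * (ε * s))))
      (Icc 0 (n * ε)) := by
    refine ContinuousOn.const_smul (h1.comp (by fun_prop) fun s hs => ?_) (a ε)
    exact ⟨div_nonneg hs.1 hε.le, (div_le_iff₀ hε).2 hs.2⟩
  have ht' : t < n * ε := (div_lt_iff₀ hε).1 hn
  refine (h2 t ⟨ht, ht'.le⟩).mono_of_mem_nhdsWithin ?_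
  exact mem_nhdsWithin.2 ⟨Iio (n * ε), isOpen_Iio, ht', fun s hs => ⟨hs.2, hs.1.le⟩⟩

section Orbit

variable [MeasurableSpace E] [BorelSpace E] [SecondCountableTopology E]

/-- The orbit of `y` under `T`, with the perturbed solution started above `y`, is a passage system. -/
theorem passageSystem (h : AveragingBounds C τbar τ f fbar) (hτ : IsRoof τ) (hT : Measurable T)
    (hf : Measurable fun p : E × SuspensionSpace τ => f p.1 p.2) {x : E} {W : ℝ → E}
    (hW : IsSolution (fun _ y => fbar y) x W) {ε : ℝ} (hε : 0 < ε) (y : M) {X : ℝ → E}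
    (hX : IsSolution (fun t z => f z (suspensionFlow T hτ (t / ε).toNNReal (hτ.basePoint y)) +
      fbar z) x X) :
    PassageSystem C ε τbar x
      (fun u z => f z (suspensionFlow T hτ u.toNNReal (hτ.basePoint y))) fbar
      (fun k => τ (T^[k] y)) (fun k z => roofIntegral τ f z (T^[k] y)) W X where
  one_le := h.one_le
  eps_pos := hε
  le_roof k := h.le_roof _
  roof_le k := h.roof_le _
  le_bar := h.le_bar
  bar_le := h.bar_le
  field_integrable z a b := by
    have hm : Measurable fun u : ℝ =>
        f z (suspensionFlow T hτ u.toNNReal (hτ.basePoint y)) :=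
      hf.comp (measurable_const.prodMk ((hτ.measurable_suspensionFlow hT).comp
        (measurable_real_toNNReal.prodMk measurable_const)))
    refine (intervalIntegrable_const (c := C)).mono_fun hm.aestronglyMeasurable
      (ae_of_all _ fun u => ?_)
    exact (h.field_le _ _).trans (le_abs_self C)
  field_le u z := h.field_le _ _
  field_lip u z z' := h.field_lip _ _ _
  mean_le := h.mean_le
  mean_lip := h.mean_lip
  passage_eq k z := roofIntegral_iterate_eq_integral hτ T f z y k
  passage_lip k z z' := norm_sub_le_of_fderiv_le (h.passage_diff _) (h.passage_fderiv_le _) z' z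
  sol_mean := hW
  sol := hX

theorem measurable_perturbed (h : AveragingBounds C τbar τ f fbar) (hτ : IsRoof τ)
    (hT : Measurable T) (hf : Measurable fun p : E × SuspensionSpace τ => f p.1 p.2) (ε : ℝ) :
    Measurable fun q : SuspensionSpace τ × ℝ × E =>
      f q.2.2 (suspensionFlow T hτ (q.2.1 / ε).toNNReal q.1) + fbar q.2.2 := by
  have h0 : Measurable fun q : SuspensionSpace τ × ℝ × E => (q.2.1 / ε).toNNReal := by fun_prop
  have h1 := (hτ.measurable_suspensionFlow hT).comp (h0.prodMk measurable_fst)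
  have h2 : Measurable fun q : SuspensionSpace τ × ℝ × E => q.2.2 :=
    measurable_snd.comp measurable_snd
  exact (hf.comp (h2.prodMk h1)).add (h.mean_diff.continuous.measurable.comp h2)

theorem measurable_solution (h : AveragingBounds C τbar τ f fbar) (hτ : IsRoof τ)
    (hT : Measurable T) (hf : Measurable fun p : E × SuspensionSpace τ => f p.1 p.2) {x : E} {ε : ℝ}
    {X : SuspensionSpace τ → ℝ → E}
    (hX : ∀ p, IsSolution (fun t z => f z (suspensionFlow T hτ (t / ε).toNNReal p) + fbar z) x
      (X p)) {t : ℝ} (ht : 0 ≤ t) : Measurable fun p => X p t :=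
  measurable_of_isSolution
    (g := fun p t z => f z (suspensionFlow T hτ (t / ε).toNNReal p) + fbar z)
    (C := 2 * C) (L := 2 * C) (h.measurable_perturbed hτ hT hf ε) (by linarith [h.one_le])
    (fun p t z => h.perturbed_le _ _) (fun p t z z' => h.perturbed_lip _ _ _) hX ht

theorem measurable_pathOn_error (h : AveragingBounds C τbar τ f fbar) (hτ : IsRoof τ)
    (hT : Measurable T) (hf : Measurable fun p : E × SuspensionSpace τ => f p.1 p.2) {x : E} {ε : ℝ}
    {X : SuspensionSpace τ → ℝ → E}
    (hX : ∀ p, IsSolution (fun t z => f z (suspensionFlow T hτ (t / ε).toNNReal p) + fbar z) x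
      (X p)) {W : ℝ → E} (hW : ContinuousOn W (Ici 0)) (α S : ℝ) :
    Measurable fun p => pathOn S fun t => α • (X p t - W t) := by
  refine measurable_continuousMap_of_eval fun t => ?_
  have hc : ∀ p, ContinuousOn (fun t => α • (X p t - W t)) (Icc 0 S) := fun p =>
    ((((hX p).1).sub hW).const_smul α).mono Icc_subset_Ici_self
  simp only [pathOn_apply (hc _)]
  exact ((h.measurable_solution hτ hT hf hX t.2.1).sub_const _).const_smul α

end Orbit

/-- The perturbed solutions started above `y` and above `T y` differ by `O(ε)`. -/
theorem norm_solution_map_sub_le [CompleteSpace E] (h : AveragingBounds C τbar τ f fbar)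
    (hτ : IsRoof τ) {x : E} {ε : ℝ} (hε : 0 < ε) {X : SuspensionSpace τ → ℝ → E}
    (hX : ∀ p, IsSolution (fun t z => f z (suspensionFlow T hτ (t / ε).toNNReal p) + fbar z) x
      (X p)) (y : M) {S t : ℝ} (ht : t ∈ Icc 0 S) :
    ‖X (hτ.basePoint (T y)) t - X (hτ.basePoint y) t‖ ≤
      2 * C * (ε * C) * (Real.exp (2 * C * S) + 1) := by
  have hC := h.const_pos
  have hτy : 0 ≤ τ y := (inv_pos.2 hC).le.trans (h.le_roof y)
  refine ((hX (hτ.basePoint y)).norm_sub_le_of_shift (hX (hτ.basePoint (T y))) (L := 2 * C)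
    (C := 2 * C) (h := ε * τ y) (by linarith) (by positivity) (fun t z => h.perturbed_le _ _)
    (fun t z z' => h.perturbed_lip _ _ _) (fun t ht => ?_) ht).trans ?_
  · have e : (t + ε * τ y) / ε = t / ε + τ y := by field_simp
    simp only [e, suspensionFlow_basePoint_map hτ T (div_nonneg ht hε.le)]
  · gcongr
    exact h.roof_le y

/-- The perturbed solutions started at a point of the suspension and at its projection to the base
differ by `O(ε)`. -/
theorem norm_solution_sub_basePoint_le [CompleteSpace E] (h : AveragingBounds C τbar τ f fbar)
    (hτ : IsRoof τ) {x : E} {ε : ℝ} (hε : 0 < ε) {X : SuspensionSpace τ → ℝ → E}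
    (hX : ∀ p, IsSolution (fun t z => f z (suspensionFlow T hτ (t / ε).toNNReal p) + fbar z) x
      (X p)) (p : SuspensionSpace τ) {S t : ℝ} (ht : t ∈ Icc 0 S) :
    ‖X p t - X (hτ.basePoint p.1.1) t‖ ≤ 2 * C * (ε * C) * (Real.exp (2 * C * S) + 1) := by
  have hC := h.const_pos
  have hp := p.2.1
  refine ((hX (hτ.basePoint p.1.1)).norm_sub_le_of_shift (hX p) (L := 2 * C)
    (C := 2 * C) (h := ε * p.1.2) (by linarith) (by positivity) (fun t z => h.perturbed_le _ _)
    (fun t z z' => h.perturbed_lip _ _ _) (fun t ht => ?_) ht).trans ?_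
  · have e : (t + ε * p.1.2) / ε = t / ε + p.1.2 := by field_simp
    simp only [e, suspensionFlow_eq_basePoint hτ T (div_nonneg ht hε.le)]
  · gcongr
    exact p.2.2.le.trans (h.roof_le _)

end AveragingBounds

end Suspended

/-! ### Dependence of the linear response on the driving path -/

section Stability

variable {E : Type*} [NormedAddCommGroup E] [NormedSpace ℝ E] [CompleteSpace E]
  {A : ℝ → E →L[ℝ] E} {C : ℝ}

theorem norm_linearResponse_sub_le (hA : ContinuousOn A (Ici 0)) (hC : 0 < C)
    (hAC : ∀ u, 0 ≤ u → ‖A u‖ ≤ C) {V V' : ℝ → E} (hV : ContinuousOn V (Ici 0))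
    (hV' : ContinuousOn V' (Ici 0)) {S δ : ℝ} (hd : ∀ t ∈ Icc 0 S, ‖V t - V' t‖ ≤ δ) :
    ∀ t ∈ Icc 0 S, ‖linearResponse A V t - linearResponse A V' t‖ ≤ δ * Real.exp (C * S) :=
  norm_sub_le_of_volterra hA hC hAC
    ((continuousOn_linearResponse hA hV hC hAC).mono Icc_subset_Ici_self)
    ((continuousOn_linearResponse hA hV' hC hAC).mono Icc_subset_Ici_self)
    (fun _ ht => linearResponse_eq_add_integral hA hV hC hAC ht.1)
    (fun _ ht => linearResponse_eq_add_integral hA hV' hC hAC ht.1) hd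

/-- On `[0, S]`, the linear response to `v (· / τbar)` is a continuous functional of the path of `v`
on `[0, S / τbar]`. -/
theorem exists_continuous_linearResponse (hA : ContinuousOn A (Ici 0)) (hC : 0 < C)
    (hAC : ∀ u, 0 ≤ u → ‖A u‖ ≤ C) {S τbar : ℝ} (hS : 0 < S) (hτbar : 0 < τbar) :
    ∃ Φ : C(Icc (0 : ℝ) (S / τbar), E) → C(Icc (0 : ℝ) S, E), Continuous Φ ∧
      ∀ v : ℝ → E, ContinuousOn v (Ici 0) →
        pathOn S (linearResponse A fun s => v (s / τbar)) = Φ (pathOn (S / τbar) v) := by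
  have hS' : 0 ≤ S / τbar := (div_pos hS hτbar).le
  set V : C(Icc (0 : ℝ) (S / τbar), E) → ℝ → E := fun g s => IccExtend hS' g (s / τbar) with hVdef
  have hV : ∀ g, Continuous (V g) := fun g => g.continuous.Icc_extend' |>.comp (by fun_prop)
  have hmem : ∀ t ∈ Icc 0 S, t / τbar ∈ Icc 0 (S / τbar) := fun t ht =>
    ⟨div_nonneg ht.1 hτbar.le, by gcongr; exact ht.2⟩
  have hVt : ∀ g, ∀ t (ht : t ∈ Icc 0 S), V g t = g ⟨t / τbar, hmem t ht⟩ := fun g t ht =>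
    IccExtend_of_mem _ _ _
  have hc : ∀ g, ContinuousOn (linearResponse A (V g)) (Icc 0 S) := fun g =>
    (continuousOn_linearResponse hA (hV g).continuousOn hC hAC).mono Icc_subset_Ici_self
  refine ⟨fun g => pathOn S (linearResponse A (V g)), ?_, fun v hv => ?_⟩
  · refine (LipschitzWith.of_dist_le_mul (K := (Real.exp (C * S)).toNNReal) fun g g' => ?_).continuous
    rw [Real.coe_toNNReal _ (Real.exp_pos _).le]
    refine (ContinuousMap.dist_le (by positivity)).2 fun t => ?_
    rw [pathOn_apply (hc g), pathOn_apply (hc g'), dist_eq_norm, mul_comm]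
    refine norm_linearResponse_sub_le hA hC hAC (hV g).continuousOn (hV g').continuousOn
      (fun s hs => ?_) t t.2
    rw [hVt g s hs, hVt g' s hs, ← dist_eq_norm]
    exact ContinuousMap.dist_apply_le_dist _
  · have hv' : ContinuousOn (fun s => v (s / τbar)) (Ici 0) :=
      hv.comp (by fun_prop) fun s hs => div_nonneg hs hτbar.le
    ext t
    rw [pathOn_apply (hc _), pathOn_apply
      ((continuousOn_linearResponse hA hv' hC hAC).mono Icc_subset_Ici_self)]
    have h1 := norm_linearResponse_sub_le hA hC hAC hv' (hV (pathOn (S / τbar) v)).continuousOn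
      (S := S) (δ := 0) (fun s hs => ?_) t t.2
    · rw [zero_mul] at h1
      exact sub_eq_zero.1 (norm_le_zero_iff.1 h1)
    · rw [hVt _ s hs, pathOn_apply (hv.mono Icc_subset_Ici_self), sub_self, norm_zero]

end Stability

/-! ### Convergence in distribution of the rescaled error -/

section Convergence

variable {M : Type*} [MeasurableSpace M] {τ : M → ℝ} {T : M → M}

theorem IsRoof.map_base_absolutelyContinuous (hτ : IsRoof τ) {μ : Measure M} [SigmaFinite μ]
    {P : Measure (SuspensionSpace τ)} (hP : P ≪ suspensionMeasure μ τ) :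
    P.map (fun p => p.1.1) ≪ μ := by
  have hms : MeasurableSet {p : M × ℝ | 0 ≤ p.2 ∧ p.2 < τ p.1} :=
    (measurableSet_le measurable_const measurable_snd).inter
      (measurableSet_lt measurable_snd (hτ.measurable.comp measurable_fst))
  have h1 : (suspensionMeasure μ τ).map Subtype.val ≪ μ.prod volume := by
    have e : (suspensionMeasure μ τ).map Subtype.val = _ :=
      (MeasurableEmbedding.subtype_coe hms).map_comap (μ.prod volume)
    rw [e]
    exact Measure.absolutelyContinuous_of_le Measure.restrict_le_self
  have h2 := ((hP.map measurable_subtype_coe).trans h1).map measurable_fst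
  rw [Measure.map_map measurable_fst measurable_subtype_coe] at h2
  exact h2.trans Measure.quasiMeasurePreserving_fst.absolutelyContinuous

theorem MeasureTheory.TendstoInDistribution.comp_of_map {Ω Ω' ι X : Type*} [MeasurableSpace Ω]
    [MeasurableSpace Ω'] [TopologicalSpace X] [MeasurableSpace X] [OpensMeasurableSpace X]
    {P : Measure Ω} [IsProbabilityMeasure P] {Q : Measure Ω'} [IsProbabilityMeasure Q]
    {l : Filter ι} {π : Ω → M} (hπ : Measurable π) [IsProbabilityMeasure (P.map π)]
    {R : ι → M → X} (hR : ∀ i, Measurable (R i)) {Z : Ω' → X}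
    (h : TendstoInDistribution R l Z (fun _ => P.map π) Q) :
    TendstoInDistribution (fun i ω => R i (π ω)) l Z (fun _ => P) Q := by
  refine ⟨fun i => ((hR i).comp hπ).aemeasurable, h.aemeasurable_limit, ?_⟩
  refine h.tendsto.congr fun i => Subtype.ext ?_
  exact Measure.map_map (hR i) hπ

variable {E : Type*} [NormedAddCommGroup E] [NormedSpace ℝ E] [CompleteSpace E] [MeasurableSpace E]
  [BorelSpace E] [SecondCountableTopology E] {C τbar : ℝ} {f : E → SuspensionSpace τ → E}
  {fbar : E → E} {a : ℝ → ℝ} {W : ℝ → E} {x : E} {X : ℝ → SuspensionSpace τ → ℝ → E}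

namespace AveragingBounds

/-- Under the reference measure, the rescaled error started from the base of the suspension is
uniformly close to the linear response to `v^ε`, with a probability close to `1`. -/
theorem eventually_measure_norm_sub_linearResponse_le (h : AveragingBounds C τbar τ f fbar)
    (hτ : IsRoof τ) (hT : Measurable T) (hf : Measurable fun p : E × SuspensionSpace τ => f p.1 p.2)
    (hW : IsSolution (fun _ y => fbar y) x W)
    (hX : ∀ ε, 0 < ε → ∀ p,
      IsSolution (fun t y => f y (suspensionFlow T hτ (t / ε).toNNReal p) + fbar y) x (X ε p))
    {μbar : Measure M} [IsProbabilityMeasure μbar]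
    (ha_pos : ∀ ε, 0 < ε → 0 < a ε) (ha : Tendsto a (𝓝[>] 0) (𝓝 0))
    (hεa : Tendsto (fun ε => ε / a ε) (𝓝[>] 0) (𝓝 0))
    {Ω' : Type*} [MeasurableSpace Ω'] {Q : Measure Ω'} [IsProbabilityMeasure Q] {v : ℝ → Ω' → E}
    (hv : LocallyConvergesInLaw μbar
      (perturbedBirkhoff T (roofIntegral τ f) a (fun t => W (τbar * t))) Q v)
    (hvdot : TightAtZero μbar
      (perturbedBirkhoffDeriv T (roofIntegral τ f) a (fun t => W (τbar * t))))
    (hn : ∀ S : ℝ, 0 < S → ∀ δ : ℝ, 0 < δ →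
      Tendsto
        (fun ε : ℝ => μbar {y | ∃ t ∈ Icc 0 S, δ ≤ |ε * visitCount T τ (t / ε) y - t / τbar|})
        (𝓝[>] 0) (𝓝 0))
    (hz : LocallyConvergesInLaw μbar
      (roofFluctuation T τ τbar fbar a (fun t => W (τbar * t))) μbar (fun _ _ => 0))
    {S : ℝ} (hS : 0 < S) {η : ℝ} (hη : 0 < η) {δ : ENNReal} (hδ : 0 < δ) :
    ∀ᶠ ε in 𝓝[>] (0 : ℝ), μbar {y | ¬ ∀ t ∈ Icc 0 S,
      ‖(a ε / ε) • (X ε (hτ.basePoint y) t - W t) - linearResponse (fun u => fderiv ℝ fbar (W u))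
        (fun s => perturbedBirkhoff T (roofIntegral τ f) a (fun t => W (τbar * t)) ε (s / τbar) y)
        t‖ ≤ η} ≤ δ := by
  have hC := h.const_pos
  obtain ⟨K, hK, hmain⟩ := PassageSystem.exists_eventually_norm_sub_linearResponse_le (E := E)
    (τbar := τbar) h.one_le hS ha_pos ha hεa
  set η' := min 1 (η / K) with hη'
  have hη'0 : 0 < η' := by positivity
  have hKη' : K * η' ≤ η := by
    calc K * η' ≤ K * (η / K) := by gcongr; exact min_le_right _ _
      _ = η := by field_simp
  have hδ4 : 0 < δ / 4 := ENNReal.div_pos hδ.ne' (by simp)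
  have hS₁ : 0 < C * S + 2 := by positivity
  obtain ⟨Λ₁, hΛ₁, h₁⟩ := hv.exists_affine_modulus hS₁ hη'0 hδ4
  obtain ⟨Λ₂, hΛ₂, h₂⟩ := hvdot.exists_affine_modulus
    (fun ε hε y => h.continuousOn_perturbedBirkhoffDeriv hW.1 a hε y) hS₁ hη'0 hδ4
  set Λ := max Λ₁ Λ₂ with hΛ
  have hΛ0 : 0 ≤ Λ := le_max_of_le_left hΛ₁
  have h₃ := hz.eventually_measure_norm_le hS₁ hη'0 hδ4
  have h₄ := ENNReal.tendsto_nhds_zero.1 (hn S hS (η' / (Λ + 1)) (by positivity)) (δ / 4) hδ4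
  filter_upwards [h₁ Λ (le_max_left _ _), h₂ Λ (le_max_right _ _), h₃, h₄,
    hmain η' ⟨hη'0, min_le_left _ _⟩ Λ hΛ0, self_mem_nhdsWithin] with ε e₁ e₂ e₃ e₄ e₅ hε
  have hε : 0 < ε := hε
  have hsum : δ / 4 + δ / 4 + δ / 4 + δ / 4 = δ := by
    calc δ / 4 + δ / 4 + δ / 4 + δ / 4 = 4 * (δ / 4) := by ring
      _ = δ := ENNReal.mul_div_cancel (by norm_num) (by norm_num)
  rw [← hsum]
  refine le_trans (measure_mono ?_) ((measure_union_le _ _).trans (add_le_add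
    ((measure_union_le _ _).trans (add_le_add ((measure_union_le _ _).trans
      (add_le_add e₁ e₂)) e₃)) e₄))
  intro y hy
  rw [mem_ofPred_eq] at hy
  by_contra hcon
  simp only [mem_union, mem_ofPred_eq, not_or, not_not, not_exists, not_and, not_le] at hcon
  obtain ⟨⟨⟨g₁, g₂⟩, g₃⟩, g₄⟩ := hcon
  refine hy fun t ht => (e₅ x _ fbar _ _ W _ _ _ _ (fun t => visitCount T τ (t / ε) y)
    (h.passageSystem hτ hT hf hW hε y (hX ε hε (hτ.basePoint y))) h.mean_diff h.mean_diff_diff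
    h.mean_fderiv_le h.mean_fderiv_fderiv_le (fun k => h.passage_diff _)
    (fun k => h.passage_diff_diff _) (fun k z => h.passage_fderiv_fderiv_le _ z)
    (fun t => rfl) (fun t => rfl) (fun t => rfl) (hv.continuous_paths ε hε y) g₁ g₂ g₃
    (fun t ht => ⟨?_, (g₄ t ht).le⟩) t ht).trans hKη'
  have hspec := hτ.visitCount_spec T (div_nonneg ht.1 hε.le) y
  have e : ∀ n, ∑ j ∈ Finset.range n, τ (T^[j] y) = birkhoffSum T τ n y := fun n => rfl
  rw [e, e, birkhoffSum_succ]
  constructor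
  · rw [← le_div_iff₀' hε]; linarith [hspec.1]
  · rw [← div_le_iff₀' hε]; linarith [hspec.2]

/-- Convergence in distribution, under the reference measure, of the rescaled error started from the
base of the suspension. -/
theorem tendstoInDistribution_basePoint (h : AveragingBounds C τbar τ f fbar)
    (hτ : IsRoof τ) (hT : Measurable T) (hf : Measurable fun p : E × SuspensionSpace τ => f p.1 p.2)
    (hW : IsSolution (fun _ y => fbar y) x W)
    (hX : ∀ ε, 0 < ε → ∀ p,
      IsSolution (fun t y => f y (suspensionFlow T hτ (t / ε).toNNReal p) + fbar y) x (X ε p))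
    {μbar : Measure M} [IsProbabilityMeasure μbar]
    (ha_pos : ∀ ε, 0 < ε → 0 < a ε) (ha : Tendsto a (𝓝[>] 0) (𝓝 0))
    (hεa : Tendsto (fun ε => ε / a ε) (𝓝[>] 0) (𝓝 0))
    {Ω' : Type*} [MeasurableSpace Ω'] {Q : Measure Ω'} [IsProbabilityMeasure Q] {v : ℝ → Ω' → E}
    (hv : LocallyConvergesInLaw μbar
      (perturbedBirkhoff T (roofIntegral τ f) a (fun t => W (τbar * t))) Q v)
    (hvdot : TightAtZero μbar
      (perturbedBirkhoffDeriv T (roofIntegral τ f) a (fun t => W (τbar * t))))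
    (hn : ∀ S : ℝ, 0 < S → ∀ δ : ℝ, 0 < δ →
      Tendsto
        (fun ε : ℝ => μbar {y | ∃ t ∈ Icc 0 S, δ ≤ |ε * visitCount T τ (t / ε) y - t / τbar|})
        (𝓝[>] 0) (𝓝 0))
    (hz : LocallyConvergesInLaw μbar
      (roofFluctuation T τ τbar fbar a (fun t => W (τbar * t))) μbar (fun _ _ => 0))
    {S : ℝ} (hS : 0 < S) :
    TendstoInDistribution
      (fun (ε : Ioi (0 : ℝ)) y =>
        pathOn S fun t => (a ε / ε) • (X ε (hτ.basePoint y) t - W t))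
      (comap (fun ε : Ioi (0 : ℝ) => (ε : ℝ)) (𝓝[>] 0))
      (fun ω => pathOn S fun t =>
        linearResponse (fun u => fderiv ℝ fbar (W u)) (fun s => v (s / τbar) ω) t)
      (fun _ => μbar) Q := by
  have hA := h.continuousOn_fderiv_comp hW.1
  have hAC : ∀ u, 0 ≤ u → ‖fderiv ℝ fbar (W u)‖ ≤ C := fun u _ => h.mean_fderiv_le _
  obtain ⟨Φ, hΦ, hΦv⟩ := exists_continuous_linearResponse hA h.const_pos hAC hS h.bar_pos
  have hlim := (hv.tendsto (S / τbar) (div_pos hS h.bar_pos)).continuous_comp hΦ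
  have e₁ : (Φ ∘ fun ω => pathOn (S / τbar) fun t => v t ω) = fun ω => pathOn S fun t =>
      linearResponse (fun u => fderiv ℝ fbar (W u)) (fun s => v (s / τbar) ω) t :=
    funext fun ω => (hΦv _ (hv.continuous_limit ω)).symm
  rw [e₁] at hlim
  refine tendstoInDistribution_of_forall_eventually_measure_le hlim (fun ε => ?_) ?_
  · exact ((h.measurable_pathOn_error hτ hT hf (hX ε ε.2) hW.1 (a ε / ε) S).comp
      hτ.measurable_basePoint).aemeasurable
  · intro η hη δ hδ
    have hev := (tendsto_comap (f := fun ε : Ioi (0 : ℝ) => (ε : ℝ))).eventually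
      (h.eventually_measure_norm_sub_linearResponse_le hτ hT hf
      hW hX ha_pos ha hεa hv hvdot hn hz hS hη hδ)
    filter_upwards [hev] with ε hε
    refine (measure_mono fun y hy => ?_).trans hε
    rw [mem_ofPred_eq] at hy ⊢
    contrapose! hy
    have hvy : ContinuousOn (fun t => perturbedBirkhoff T (roofIntegral τ f) a
        (fun t => W (τbar * t)) ε t y) (Ici 0) := hv.continuous_paths ε ε.2 y
    have hvy' : ContinuousOn (fun s => perturbedBirkhoff T (roofIntegral τ f) a
        (fun t => W (τbar * t)) ε (s / τbar) y) (Ici 0) :=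
      hvy.comp (by fun_prop) fun s hs => div_nonneg hs h.bar_pos.le
    rw [Function.comp_apply, ← hΦv _ hvy, ContinuousMap.norm_le _ hη.le]
    intro t
    rw [ContinuousMap.sub_apply, pathOn_apply, pathOn_apply]
    · exact hy t t.2
    · exact (continuousOn_linearResponse hA hvy' h.const_pos hAC).mono Icc_subset_Ici_self
    · exact (((hX ε ε.2 _).1.sub hW.1).const_smul _).mono Icc_subset_Ici_self

/-- The convergence in distribution extends from the reference measure to all the probability
measures absolutely continuous with respect to the measure of the suspension. -/
theorem tendstoInDistribution_of_basePoint (h : AveragingBounds C τbar τ f fbar)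
    (hτ : IsRoof τ) {μ : Measure M} [SigmaFinite μ] (hT : Ergodic T μ)
    (hf : Measurable fun p : E × SuspensionSpace τ => f p.1 p.2)
    (hW : IsSolution (fun _ y => fbar y) x W)
    (hX : ∀ ε, 0 < ε → ∀ p,
      IsSolution (fun t y => f y (suspensionFlow T hτ (t / ε).toNNReal p) + fbar y) x (X ε p))
    {μbar : Measure M} [IsProbabilityMeasure μbar] (hμbar : μbar ≪ μ)
    (ha_pos : ∀ ε, 0 < ε → 0 < a ε) (ha : Tendsto a (𝓝[>] 0) (𝓝 0))
    {Ω' : Type*} [MeasurableSpace Ω'] {Q : Measure Ω'} [IsProbabilityMeasure Q]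
    {S : ℝ} {Z : Ω' → C(Icc (0 : ℝ) S, E)}
    (hZ : TendstoInDistribution
      (fun (ε : Ioi (0 : ℝ)) y =>
        pathOn S fun t => (a ε / ε) • (X ε (hτ.basePoint y) t - W t))
      (comap (fun ε : Ioi (0 : ℝ) => (ε : ℝ)) (𝓝[>] 0)) Z (fun _ => μbar) Q)
    {P : Measure (SuspensionSpace τ)} [IsProbabilityMeasure P] (hP : P ≪ suspensionMeasure μ τ) :
    TendstoInDistribution
      (fun (ε : Ioi (0 : ℝ)) p => pathOn S fun t => (a ε / ε) • (X ε p t - W t))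
      (comap (fun ε : Ioi (0 : ℝ) => (ε : ℝ)) (𝓝[>] 0)) Z (fun _ => P) Q := by
  have hC := h.const_pos
  have hmeas : ∀ ε : Ioi (0 : ℝ), Measurable fun p => pathOn S fun t =>
      (a ε / (ε : ℝ)) • (X ε p t - W t) := fun ε =>
    h.measurable_pathOn_error hτ hT.measurable hf (hX ε ε.2) hW.1 (a ε / ε) S
  have hmeas' : ∀ ε : Ioi (0 : ℝ), Measurable fun y => pathOn S fun t =>
      (a ε / (ε : ℝ)) • (X ε (hτ.basePoint y) t - W t) := fun ε =>
    (hmeas ε).comp hτ.measurable_basePoint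
  -- a displacement of size `O(ε)` of the solution is of size `O(a ε)` after rescaling
  set r : Ioi (0 : ℝ) → ℝ := fun ε => a ε * (2 * C * C * (Real.exp (2 * C * S) + 1)) with hr
  have hr0 : Tendsto r (comap (fun ε : Ioi (0 : ℝ) => (ε : ℝ)) (𝓝[>] 0)) (𝓝 0) := by
    have := (ha.comp (tendsto_comap (f := fun ε : Ioi (0 : ℝ) => (ε : ℝ)))).mul_const (2 * C * C * (Real.exp (2 * C * S) + 1))
    rwa [zero_mul] at this
  have hdist : ∀ (ε : Ioi (0 : ℝ)) (p q : SuspensionSpace τ),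
      (∀ t ∈ Icc 0 S, ‖X ε p t - X ε q t‖ ≤ 2 * C * (ε * C) * (Real.exp (2 * C * S) + 1)) →
      ‖(pathOn S fun t => (a ε / (ε : ℝ)) • (X ε p t - W t)) -
        pathOn S fun t => (a ε / (ε : ℝ)) • (X ε q t - W t)‖ ≤ r ε := by
    intro ε p q hpq
    have hε : (0 : ℝ) < ε := ε.2
    have haε := ha_pos ε hε
    refine (ContinuousMap.norm_le _ (by positivity)).2 fun t => ?_
    have hc : ∀ p, ContinuousOn (fun t => (a ε / (ε : ℝ)) • (X ε p t - W t)) (Icc 0 S) := fun p =>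
      (((hX ε ε.2 p).1.sub hW.1).const_smul _).mono Icc_subset_Ici_self
    rw [ContinuousMap.sub_apply, pathOn_apply (hc p), pathOn_apply (hc q), ← smul_sub,
      sub_sub_sub_cancel_right, norm_smul, Real.norm_of_nonneg (by positivity)]
    calc a ε / ε * ‖X ε p t - X ε q t‖
        ≤ a ε / ε * (2 * C * (ε * C) * (Real.exp (2 * C * S) + 1)) := by
          gcongr; exact hpq t t.2
      _ = r ε := by rw [hr]; field_simp
  have hπ : Measurable fun p : SuspensionSpace τ => p.1.1 :=
    measurable_fst.comp measurable_subtype_coe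
  have : IsProbabilityMeasure (P.map fun p => p.1.1) :=
    Measure.isProbabilityMeasure_map hπ.aemeasurable
  have h1 := hT.tendstoInDistribution_of_asymptotically_invariant hmeas' hr0
    (.of_forall fun ε y => by
      rw [dist_eq_norm]
      exact hdist ε _ _ fun t ht => h.norm_solution_map_sub_le hτ ε.2 (hX ε ε.2) y ht)
    hμbar (hτ.map_base_absolutelyContinuous hP) hZ
  refine tendstoInDistribution_of_forall_eventually_measure_le (h1.comp_of_map hπ hmeas')
    (fun ε => (hmeas ε).aemeasurable) fun η hη δ hδ => ?_
  filter_upwards [hr0.eventually_le_const hη] with ε hε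
  have hempty : {p : SuspensionSpace τ | ¬ ‖(pathOn S fun t => (a ε / (ε : ℝ)) • (X ε p t - W t)) -
      pathOn S fun t => (a ε / (ε : ℝ)) • (X ε (hτ.basePoint p.1.1) t - W t)‖ ≤ η} = ∅ := by
    refine eq_empty_of_forall_notMem fun p hp => hp ?_
    exact (hdist ε _ _ fun t ht =>
      h.norm_solution_sub_basePoint_le hτ ε.2 (hX ε ε.2) p ht).trans hε
  rw [hempty, measure_empty]
  exact zero_le

end AveragingBounds

end Convergence

theorem mainTheorem3 {d : ℕ} {M : Type*} [MeasurableSpace M]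
    -- the conservative ergodic infinite measure preserving system and the roof function
    (μ : Measure M) [SigmaFinite μ] (hμ : μ Set.univ = ⊤)
    (T : M → M) (hergodic : Ergodic T μ) (hconservative : Conservative T μ)
    (τ : M → ℝ) (hτ : IsRoof τ)
    -- the vector fields
    (f : EuclideanSpace ℝ (Fin d) → SuspensionSpace τ → EuclideanSpace ℝ (Fin d))
    (fbar : EuclideanSpace ℝ (Fin d) → EuclideanSpace ℝ (Fin d))
    (hf_meas : Measurable (fun p : EuclideanSpace ℝ (Fin d) × SuspensionSpace τ => f p.1 p.2))
    (hf_bdd : ∃ C : ℝ, ∀ x p, ‖f x p‖ ≤ C)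
    (hf_lip : ∃ K : NNReal, ∀ p, LipschitzWith K (fun x => f x p))
    (hfbar_bdd : ∃ C : ℝ, ∀ x, ‖fbar x‖ ≤ C)
    (hfbar_lip : ∃ K : NNReal, LipschitzWith K fbar)
    -- the solutions of the averaged and of the perturbed equation started at `x`
    (x : EuclideanSpace ℝ (Fin d))
    (W : ℝ → EuclideanSpace ℝ (Fin d)) (hW : IsSolution (fun _ y => fbar y) x W)
    (X : ℝ → SuspensionSpace τ → ℝ → EuclideanSpace ℝ (Fin d))
    (hX : ∀ ε, 0 < ε → ∀ p,
      IsSolution (fun t y => f y (suspensionFlow T hτ (t / ε).toNNReal p) + fbar y) x (X ε p))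
    -- the reference probability measure, the normalization, the averaged roof
    (μbar : Measure M) [IsProbabilityMeasure μbar] (hμbar : μbar ≪ μ)
    (a : ℝ → ℝ) (ha_pos : ∀ ε, 0 < ε → 0 < a ε)
    (ha : Tendsto a (𝓝[>] 0) (𝓝 0))
    (hεa : Tendsto (fun ε => ε / a ε) (𝓝[>] 0) (𝓝 0))
    (τbar : ℝ) (hτbar : 0 < τbar)
    -- regularity
    (hF_diff : UniformlyBoundedTwiceDiff (fun y x => roofIntegral τ f x y))
    (hfbar_diff : UniformlyBoundedTwiceDiff (fun _ : Unit => fbar))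
    -- convergence of the perturbed Birkhoff processes, tightness of their derivatives
    {Ω' : Type*} [MeasurableSpace Ω'] (Q : Measure Ω') [IsProbabilityMeasure Q]
    (v : ℝ → Ω' → EuclideanSpace ℝ (Fin d))
    (hv : LocallyConvergesInLaw μbar
      (perturbedBirkhoff T (roofIntegral τ f) a (fun t => W (τbar * t))) Q v)
    (hvdot : TightAtZero μbar
      (perturbedBirkhoffDeriv T (roofIntegral τ f) a (fun t => W (τbar * t))))
    -- convergence of `ε n_{t/ε}` to `t / τbar`, uniformly on compacts, in probability
    (hn : ∀ S : ℝ, 0 < S → ∀ δ : ℝ, 0 < δ →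
      Tendsto
        (fun ε : ℝ => μbar {y | ∃ t ∈ Icc 0 S, δ ≤ |ε * visitCount T τ (t / ε) y - t / τbar|})
        (𝓝[>] 0) (𝓝 0))
    -- negligibility of the roof fluctuations
    (hz : LocallyConvergesInLaw μbar
      (roofFluctuation T τ τbar fbar a (fun t => W (τbar * t))) μbar (fun _ _ => 0))
    (hzdot : FiniteDimConvergesToZero μbar
      (roofFluctuationDeriv T τ τbar fbar (fun t => W (τbar * t)))) :
    -- convergence of the normalized error to `Y`
    StronglyLocallyConvergesInLaw (suspensionMeasure μ τ)
      (fun ε t p => (a ε / ε) • (X ε p t - W t)) Q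
      (fun t ω => linearResponse (fun u => fderiv ℝ fbar (W u)) (fun s => v (s / τbar) ω) t) ∧
    -- `Y` solves the linearized equation driven by `v_{t/τbar}`
    (∀ ω t, 0 ≤ t →
      linearResponse (fun u => fderiv ℝ fbar (W u)) (fun s => v (s / τbar) ω) t =
        v (t / τbar) ω + ∫ s in (0 : ℝ)..t, fderiv ℝ fbar (W s)
          (linearResponse (fun u => fderiv ℝ fbar (W u)) (fun r => v (r / τbar) ω) s)) ∧
    -- the formula with the usual exponential, when the derivatives along `W` commute
    ((∀ r u, 0 ≤ r → 0 ≤ u → Commute (fderiv ℝ fbar (W r)) (fderiv ℝ fbar (W u))) →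
      ∀ ω t, 0 ≤ t →
        linearResponse (fun u => fderiv ℝ fbar (W u)) (fun s => v (s / τbar) ω) t =
          v (t / τbar) ω + ∫ s in (0 : ℝ)..t,
            (fderiv ℝ fbar (W s) * NormedSpace.exp (∫ u in s..t, fderiv ℝ fbar (W u)))
              (v (s / τbar) ω)) := by
  obtain ⟨C, hC⟩ := exists_averagingBounds hτbar hτ hf_bdd hf_lip hF_diff hfbar_diff
  have hA := hC.continuousOn_fderiv_comp hW.1
  have hAC : ∀ u, 0 ≤ u → ‖fderiv ℝ fbar (W u)‖ ≤ C := fun u _ => hC.mean_fderiv_le _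
  have hV : ∀ ω, ContinuousOn (fun s => v (s / τbar) ω) (Ici 0) := fun ω =>
    (hv.continuous_limit ω).comp (by fun_prop) fun s hs => div_nonneg hs hτbar.le
  refine ⟨fun P _ hP => ⟨fun ε hε p => ?_, fun ω => ?_, fun S hS => ?_⟩, fun ω t ht => ?_,
    fun hcomm ω t ht => linearResponse_eq_of_commute hA hcomm ht⟩
  · exact ((hX ε hε p).1.sub hW.1).const_smul (a ε / ε)
  · exact continuousOn_linearResponse hA (hV ω) hC.const_pos hAC
  · exact hC.tendstoInDistribution_of_basePoint hτ hergodic hf_meas hW hX hμbar ha_pos ha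
      (hC.tendstoInDistribution_basePoint hτ hergodic.measurable hf_meas hW hX ha_pos ha hεa hv
        hvdot hn hz hS) hP
  · exact linearResponse_eq_add_integral hA (hV ω) hC.const_pos hAC ht
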